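/- Let $M$ be a complete Riemannian manifold of dimension $n+p$ ($n,p\ge 1$) with Levi-Civita connection $\nabla$ and curvature tensor $R(X,Y)Z=\nabla_X\nabla_YZ-\nabla_Y\nabla_XZ-\nabla_{[X,Y]}Z$. Let $\mathcal F$ and $\mathcal F^{\perp}$ be two orthogonal $C^\infty$ foliations of $M$ whose leaves have dimensions $n$ and $p$ respectively. Denote by $$h^{\perp}=\frac1p\sum_{\alpha}(\nabla_{e_\alpha}e_\alpha)^{\top}$$ the normalized mean curvature vector of the leaves of $\mathcal F^{\perp}$, where $(e_\alpha)$ is a local orthonormal frame of $T\mathcal F^{\perp}$ and $\top$ is the orthogonal projection onto $T\mathcal F$. For a vector field $X$ on $M$ and a unit vector $v\in T_x\mathcal F^{\perp}$ put $$\operatorname{div}_{\mathcal F}(X)=\sum_i\langle e_i,\nabla_{e_i}X\rangle,\qquad \operatorname{Tr}(K^{v})=\sum_i\langle R(v,e_i)e_i,v\rangle,$$ where $(e_i)$ is an orthonormal basis of $T_x\mathcal F$. Suppose that 1. if $p\ge 2$, then $\mathcal F^{\perp}$ is totally umbilical, i.e. all Weingarten operators of its leaves are multiples of the identity (no condition is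 imposed for $p=1$, so this case includes the foliations by round circles); 2. $\|h^{\perp}\|$ is bounded on $M$ and attains its maximum over $M$ at a point of a leaf $L^{\perp}$ of $\mathcal F^{\perp}$; 3. $\operatorname{Tr}(K^{v})\ge 0$ for every $x\in M$ and every unit vector $v\in T_x\mathcal F^{\perp}$; 4. $\operatorname{div}_{\mathcal F}(h^{\perp})(x)\le \operatorname{Tr}(K^{v})$ for every $x\in L^{\perp}$ and every unit vector $v\in T_x\mathcal F^{\perp}$. Then $\operatorname{Tr}(K^{v})=0$ for every unit vector $v$ tangent to $\mathcal F^{\perp}$, the foliations $\mathcal F$ and $\mathcal F^{\perp}$ are totally geodesic, and $M$ is locally a Riemannian product of a leaf of $\mathcal F$ and a leaf of $\mathcal F^{\perp}$: every $x\in M$ has a neighbourhood that is isometric to the Riemannian product of an open piece of the leaf of $\mathcal F$ through $x$ and an open piece of the leaf of $\mathcal F^{\perp}$ through $x$, in such a way that the two foliations correspond to the two families of slices of the product. -/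

import Mathlib

open Bundle Manifold Set FiberBundle
open scoped ContDiff Topology

noncomputable section

namespace OrthFol

/-- The model space `ℝᵏ`. -/
abbrev 𝔼 (k : ℕ) : Type := EuclideanSpace ℝ (Fin k)

/-! ### Foliations and their leaves -/

section Foliations

variable {m k l : ℕ} {M : Type*} [TopologicalSpace M] [ChartedSpace (𝔼 m) M]

/-- A distribution on an `m`-dimensional manifold: a subspace of every tangent space. -/
abbrev Distribution (m : ℕ) (M : Type*) [TopologicalSpace M] [ChartedSpace (𝔼 m) M] : Type _ :=
  ∀ x : M, Submodule ℝ (TangentSpace (𝓡 m) x)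

/-- `φ` is a smooth coordinate system of `M` with values in `ℝᵏ × ℝˡ`. -/
structure IsSmoothChart (φ : OpenPartialHomeomorph M (𝔼 k × 𝔼 l)) : Prop where
  smooth : ContMDiffOn (𝓡 m) 𝓘(ℝ, 𝔼 k × 𝔼 l) ∞ φ φ.source
  smooth_symm : ContMDiffOn 𝓘(ℝ, 𝔼 k × 𝔼 l) (𝓡 m) ∞ φ.symm φ.target

/-- On the domain of `φ`, the distribution `T` is tangent to the slices `ℝᵏ × {b}`. -/
def TangentToFstSlices (T : Distribution m M) (φ : OpenPartialHomeomorph M (𝔼 k × 𝔼 l)) : Prop :=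
  ∀ y ∈ φ.source, ∀ v : TangentSpace (𝓡 m) y,
    v ∈ T y ↔ mfderiv (𝓡 m) (𝓡 l) (fun z => (φ z).2) y v = 0

/-- On the domain of `φ`, the distribution `T` is tangent to the slices `{a} × ℝˡ`. -/
def TangentToSndSlices (T : Distribution m M) (φ : OpenPartialHomeomorph M (𝔼 k × 𝔼 l)) : Prop :=
  ∀ y ∈ φ.source, ∀ v : TangentSpace (𝓡 m) y,
    v ∈ T y ↔ mfderiv (𝓡 m) (𝓡 k) (fun z => (φ z).1) y v = 0

variable (m k l M) in
/-- A `C^∞` foliation of an `m`-dimensional manifold with leaves of dimension `k` and codimension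
`l`, given by its tangent bundle: around every point there is a smooth foliated chart
`φ : U → ℝᵏ × ℝˡ`, i.e. the tangent bundle of the foliation is tangent to the plaques
`φ₂ = const`. -/
structure Foliation where
  tangent : Distribution m M
  exists_chart : ∀ x : M, ∃ φ : OpenPartialHomeomorph M (𝔼 k × 𝔼 l),
    x ∈ φ.source ∧ IsSmoothChart (m := m) φ ∧ TangentToFstSlices tangent φ

/-- `x` and `y` are the end points of a `C¹` curve tangent to the distribution `T`. -/
def JoinedByTangentCurve (T : Distribution m M) (x y : M) : Prop :=
  ∃ (γ : ℝ → M) (a b : ℝ), a ≤ b ∧ ContMDiffOn 𝓘(ℝ) (𝓡 m) 1 γ (Icc a b) ∧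
    (∀ t ∈ Icc a b, mfderivWithin 𝓘(ℝ) (𝓡 m) γ (Icc a b) t (1 : ℝ) ∈ T (γ t)) ∧
    γ a = x ∧ γ b = y

/-- The leaf through `x`: the points that can be reached from `x` by piecewise `C¹` curves tangent
to the foliation. -/
def Foliation.leaf (F : Foliation m k l M) (x : M) : Set M :=
  {y | Relation.ReflTransGen (JoinedByTangentCurve F.tangent) x y}

/-- `L` is a leaf of the foliation `F`. -/
def Foliation.IsLeaf (F : Foliation m k l M) (L : Set M) : Prop :=
  ∃ x, L = F.leaf x

end Foliations

/-! ### The Riemannian connection and the curvature -/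

section Connection

variable {m : ℕ} {M : Type*} [TopologicalSpace M] [ChartedSpace (𝔼 m) M]

instance finiteDimensionalTangentSpace (x : M) : FiniteDimensional ℝ (TangentSpace (𝓡 m) x) :=
  inferInstanceAs (FiniteDimensional ℝ (𝔼 m))

variable [IsManifold (𝓡 m) ∞ M] [RiemannianBundle (fun x : M => TangentSpace (𝓡 m) x)]

/-- The right-hand side of the Koszul formula (the value of `2⟨∇_X Y, Z⟩` at `x`). -/
def koszul (X Y Z : ∀ x : M, TangentSpace (𝓡 m) x) (x : M) : ℝ :=
  mvfderiv (𝓡 m) (fun y => inner ℝ (Y y) (Z y)) x (X x)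
    + mvfderiv (𝓡 m) (fun y => inner ℝ (X y) (Z y)) x (Y x)
    - mvfderiv (𝓡 m) (fun y => inner ℝ (X y) (Y y)) x (Z x)
    + inner ℝ (VectorField.mlieBracket (𝓡 m) X Y x) (Z x)
    - inner ℝ (VectorField.mlieBracket (𝓡 m) X Z x) (Y x)
    - inner ℝ (VectorField.mlieBracket (𝓡 m) Y Z x) (X x)

/-- The Riemannian (Levi-Civita) connection: `nabla v Y` is the covariant derivative `∇_v Y` at `x`
of the vector field `Y` in the direction `v ∈ T_x M`, the vector whose inner product with every
`z ∈ T_x M` is given by the Koszul formula. -/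
def nabla {x : M} (v : TangentSpace (𝓡 m) x) (Y : ∀ x : M, TangentSpace (𝓡 m) x) :
    TangentSpace (𝓡 m) x :=
  ∑ i, ((1 / 2 : ℝ) * koszul (extend (𝔼 m) v) Y
      (extend (𝔼 m) (stdOrthonormalBasis ℝ (TangentSpace (𝓡 m) x) i)) x) •
    stdOrthonormalBasis ℝ (TangentSpace (𝓡 m) x) i

/-- The curvature tensor `R(u, v)w = ∇_U ∇_V W - ∇_V ∇_U W - ∇_[U,V] W` at `x`, where `U, V, W` are
smooth vector fields near `x` with values `u, v, w` at `x`. -/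
def curvature {x : M} (u v w : TangentSpace (𝓡 m) x) : TangentSpace (𝓡 m) x :=
  nabla u (fun y => nabla (extend (𝔼 m) v y) (extend (𝔼 m) w))
    - nabla v (fun y => nabla (extend (𝔼 m) u y) (extend (𝔼 m) w))
    - nabla (VectorField.mlieBracket (𝓡 m) (extend (𝔼 m) u) (extend (𝔼 m) v) x) (extend (𝔼 m) w)

end Connection

/-! ### Extrinsic geometry of the leaves -/

section Extrinsic

variable {m k l : ℕ} {M : Type*} [TopologicalSpace M] [ChartedSpace (𝔼 m) M]
  [IsManifold (𝓡 m) ∞ M] [RiemannianBundle (fun x : M => TangentSpace (𝓡 m) x)]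

/-- The component of the vector field `X` tangent to `F`. -/
def Foliation.tangentPart (F : Foliation m k l M) (X : ∀ x : M, TangentSpace (𝓡 m) x) (x : M) :
    TangentSpace (𝓡 m) x :=
  (F.tangent x).starProjection (X x)

/-- The component of the vector field `X` orthogonal to `F`. -/
def Foliation.normalPart (F : Foliation m k l M) (X : ∀ x : M, TangentSpace (𝓡 m) x) (x : M) :
    TangentSpace (𝓡 m) x :=
  X x - F.tangentPart X x

/-- The Weingarten operator `A_ν v = -(∇_v N)^⊤` of the leaf of `F` through `x`, for `v` tangent and
`ν` normal to `F` at `x`, where `N` is a vector field normal to `F` with `N x = ν`. -/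
def Foliation.weingarten (F : Foliation m k l M) {x : M} (ν v : TangentSpace (𝓡 m) x) :
    TangentSpace (𝓡 m) x :=
  -(F.tangent x).starProjection (nabla v (F.normalPart (extend (𝔼 m) ν)))

/-- The second fundamental form of the leaves of `F` in the direction `ν`: `⟨-∇_v N, w⟩`. -/
def Foliation.secondFundamentalForm (F : Foliation m k l M) {x : M}
    (ν v w : TangentSpace (𝓡 m) x) : ℝ :=
  inner ℝ (-nabla v (F.normalPart (extend (𝔼 m) ν))) w

/-- All leaves are totally umbilical submanifolds: every Weingarten operator is a multiple of the
identity. -/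
def Foliation.IsTotallyUmbilical (F : Foliation m k l M) : Prop :=
  ∀ x : M, ∀ ν ∈ (F.tangent x)ᗮ, ∃ c : ℝ, ∀ v ∈ F.tangent x, F.weingarten ν v = c • v

/-- All leaves are totally geodesic submanifolds: the second fundamental forms vanish. -/
def Foliation.IsTotallyGeodesic (F : Foliation m k l M) : Prop :=
  ∀ x : M, ∀ ν ∈ (F.tangent x)ᗮ, ∀ v ∈ F.tangent x, ∀ w ∈ F.tangent x,
    F.secondFundamentalForm ν v w = 0

/-- The (normalized) mean curvature vector of the `k`-dimensional leaves of `F`: the component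
normal to `F` of `(1/k) ∑ᵢ ∇_{eᵢ} eᵢ`, where the `eᵢ` are vector fields tangent to `F` forming an
orthonormal basis of the tangent space of the leaf at `x`. -/
def Foliation.meanCurvature (F : Foliation m k l M) (x : M) : TangentSpace (𝓡 m) x :=
  (1 / (k : ℝ)) • (F.tangent x)ᗮ.starProjection
    (∑ i, nabla (stdOrthonormalBasis ℝ (F.tangent x) i : TangentSpace (𝓡 m) x)
      (F.tangentPart
        (extend (𝔼 m) (stdOrthonormalBasis ℝ (F.tangent x) i : TangentSpace (𝓡 m) x))))

/-- The divergence along the leaves, `div_F X = ∑ᵢ ⟨eᵢ, ∇_{eᵢ} X⟩` for an orthonormal basis `(eᵢ)` of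
the tangent space of the leaf. -/
def Foliation.divergence (F : Foliation m k l M) (X : ∀ x : M, TangentSpace (𝓡 m) x) (x : M) : ℝ :=
  ∑ i, inner ℝ (stdOrthonormalBasis ℝ (F.tangent x) i : TangentSpace (𝓡 m) x)
    (nabla (stdOrthonormalBasis ℝ (F.tangent x) i : TangentSpace (𝓡 m) x) X)

/-- `∑ᵢ ⟨R(v, eᵢ)eᵢ, v⟩` for an orthonormal basis `(eᵢ)` of the tangent space of the leaf of `F`: the
trace of the matrix `⟨R(v, eᵢ)eⱼ, v⟩`. -/
def Foliation.curvatureTrace (F : Foliation m k l M) {x : M} (v : TangentSpace (𝓡 m) x) : ℝ :=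
  ∑ i, inner ℝ (curvature v (stdOrthonormalBasis ℝ (F.tangent x) i : TangentSpace (𝓡 m) x)
    (stdOrthonormalBasis ℝ (F.tangent x) i : TangentSpace (𝓡 m) x)) v

/-- The two foliations are orthogonal (their dimensions being complementary). -/
def Orthogonal (F : Foliation m k l M) (G : Foliation m l k M) : Prop :=
  ∀ x : M, ∀ u ∈ F.tangent x, ∀ v ∈ G.tangent x, inner ℝ u v = 0

/-- `M` is locally a Riemannian product of a leaf of `F` and a leaf of `G`. Every point `x` has a
neighbourhood `U` with coordinates `φ : U → A × B` in which `F` and `G` are tangent to the slices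
`A × {b}` and `{a} × B`; the slices through `x` are contained in the leaves of `F` and `G` through
`x`; and the resulting identification of `U` with the product of these two pieces of leaves,
`y ↦ (π₁ y, π₂ y)`, is an isometry for the product of the metrics induced on the leaves. -/
def IsLocallyRiemannianProduct (F : Foliation m k l M) (G : Foliation m l k M) : Prop :=
  ∀ x : M, ∃ (φ : OpenPartialHomeomorph M (𝔼 k × 𝔼 l)) (A : Set (𝔼 k)) (B : Set (𝔼 l)),
    x ∈ φ.source ∧ φ.target = A ×ˢ B ∧ IsSmoothChart (m := m) φ ∧
    TangentToFstSlices F.tangent φ ∧ TangentToSndSlices G.tangent φ ∧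
    (let π₁ : M → M := fun y => φ.symm ((φ y).1, (φ x).2)
     let π₂ : M → M := fun y => φ.symm ((φ x).1, (φ y).2)
     ∀ y ∈ φ.source, π₁ y ∈ F.leaf x ∧ π₂ y ∈ G.leaf x ∧
      ∀ u v : TangentSpace (𝓡 m) y,
        inner ℝ u v
          = inner ℝ (mfderiv (𝓡 m) (𝓡 m) π₁ y u) (mfderiv (𝓡 m) (𝓡 m) π₁ y v)
            + inner ℝ (mfderiv (𝓡 m) (𝓡 m) π₂ y u) (mfderiv (𝓡 m) (𝓡 m) π₂ y v))

end Extrinsic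

end OrthFol

end

noncomputable section

namespace OrthFol

/-! Write `G` for the foliation `Fperp`, `h` for its mean curvature vector and `ξ` for
`F.curvatureSum`, that is `n` times the mean curvature vector of `F`. Since `G` is umbilical or
one-dimensional, its second fundamental form is `⟨v, w⟩ h`. Tracing the mixed curvature over the `F`
directions then gives, for `v` tangent to `G`, Tr K^v = ⟨∇_v ξ, v⟩ + |v|² (div_F h − |h|²) − |A_v|²,
where `A_v` is the Weingarten operator of `F`. This is `Foliation.UmbilicalForm.curvatureTrace_eq`.

Where div_F h ≤ Tr K^v for unit `v`, the identity and Cauchy–Schwarz, ⟨ξ, v⟩² = (tr A_v)² ≤ n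
|A_v|², give the Riccati inequality ⟨ξ, v⟩² ≤ n ⟨∇_v ξ, v⟩. With `v = ξ/|ξ|` it says that 1/|ξ|
decreases at rate at least 1/n in the direction `v`, which is tangent to `G`. A positive function on
a complete manifold cannot do this forever, so `ξ = 0`. The blow-up argument uses no integral
curves: it is a Caristi-type descent (`eq_empty_of_descent`) on the closure of the leaf, where
completeness of `M` suffices (`Foliation.Saturated.curvatureSum_eq_zero`).

On a closed union of plaques where `ξ = 0` the term ⟨∇_v ξ, v⟩ vanishes too, and the identity
becomes |h|² + |A_v|² = div_F h − Tr K^v (`Foliation.Saturated.vanishing`). The argument is run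
twice. On the given leaf the right-hand side is nonpositive, so `h = 0` at the point where |h| is
maximal, hence everywhere. Now div_F h = 0 ≤ Tr K^v on all of `M`, and the second run, with `M` in
place of the leaf, gives `A_v = 0` and Tr K^v = 0 everywhere.

Both foliations are then totally geodesic. In coordinates adapted to both, the two blocks of the
metric are orthogonal and each is constant in the directions of the other foliation, which is the
local product structure (`Orthogonal.isLocallyRiemannianProduct`). -/

lemma isManifold_minSmoothness_two {m : ℕ} {M : Type*} [TopologicalSpace M] [ChartedSpace (𝔼 m) M]
    [IsManifold (𝓡 m) ∞ M] : IsManifold (𝓡 m) (minSmoothness ℝ 2) M :=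
  .of_le (n := ∞) (by simp; exact WithTop.coe_le_coe.2 le_top)

lemma isManifold_minSmoothness_three {m : ℕ} {M : Type*} [TopologicalSpace M]
    [ChartedSpace (𝔼 m) M] [IsManifold (𝓡 m) ∞ M] : IsManifold (𝓡 m) (minSmoothness ℝ 3) M :=
  .of_le (n := ∞) (by simp; exact WithTop.coe_le_coe.2 le_top)

attribute [local instance] isManifold_minSmoothness_two isManifold_minSmoothness_three

/-! ### Functions and vector fields smooth near a point. -/

section VectorFields

variable {m : ℕ} {M : Type*} [TopologicalSpace M] [ChartedSpace (𝔼 m) M]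

/-- The function `f` is smooth on a neighbourhood of `x`. -/
def SmoothFunNear (m : ℕ) {M : Type*} [TopologicalSpace M] [ChartedSpace (𝔼 m) M] (f : M → ℝ)
    (x : M) : Prop :=
  ∀ᶠ y in 𝓝 x, ContMDiffAt (𝓡 m) 𝓘(ℝ) ∞ f y

/-- Differentiability of the function `f` at `x`. -/
def FunDiffAt (m : ℕ) {M : Type*} [TopologicalSpace M] [ChartedSpace (𝔼 m) M] (f : M → ℝ)
    (x : M) : Prop :=
  MDifferentiableAt (𝓡 m) 𝓘(ℝ) f x

variable {f g : M → ℝ} {x : M}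

lemma SmoothFunNear.contMDiffAt (h : SmoothFunNear m f x) : ContMDiffAt (𝓡 m) 𝓘(ℝ) ∞ f x :=
  h.self_of_nhds

lemma SmoothFunNear.mdiff (h : SmoothFunNear m f x) : FunDiffAt m f x :=
  h.contMDiffAt.mdifferentiableAt (by simp)

/-- The point of asking for smoothness at all nearby points: for exponent `∞`, `ContMDiffAt` at one
point leaves the neighbourhood dependent on the order, while repeated derivatives need a hypothesis
that holds again nearby. -/
lemma SmoothFunNear.eventually (h : SmoothFunNear m f x) : ∀ᶠ y in 𝓝 x, SmoothFunNear m f y :=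
  eventually_eventually_nhds.2 h

lemma SmoothFunNear.congr (h : SmoothFunNear m f x) (hfg : g =ᶠ[𝓝 x] f) : SmoothFunNear m g x := by
  filter_upwards [h, hfg.eventuallyEq_nhds] with y hy hy'
  exact hy.congr_of_eventuallyEq hy'

lemma SmoothFunNear.const (c : ℝ) : SmoothFunNear m (fun _ : M => c) x :=
  Filter.Eventually.of_forall fun _ => contMDiffAt_const

lemma SmoothFunNear.add (hf : SmoothFunNear m f x) (hg : SmoothFunNear m g x) :
    SmoothFunNear m (fun y => f y + g y) x := by
  filter_upwards [hf, hg] with y hy hy' using hy.add hy'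

lemma SmoothFunNear.sub (hf : SmoothFunNear m f x) (hg : SmoothFunNear m g x) :
    SmoothFunNear m (fun y => f y - g y) x := by
  filter_upwards [hf, hg] with y hy hy' using hy.sub hy'

lemma SmoothFunNear.mul (hf : SmoothFunNear m f x) (hg : SmoothFunNear m g x) :
    SmoothFunNear m (fun y => f y * g y) x := by
  filter_upwards [hf, hg] with y hy hy' using hy.mul hy'

variable [IsManifold (𝓡 m) ∞ M]

/-- Differentiability of the vector field `X` at `x`. -/
def FieldDiffAt (X : ∀ x : M, TangentSpace (𝓡 m) x) (x : M) : Prop :=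
  MDifferentiableAt (𝓡 m) (𝓡 m).tangent (T% X) x

/-- The vector field `X` is smooth on a neighbourhood of `x`. -/
def SmoothNear (X : ∀ x : M, TangentSpace (𝓡 m) x) (x : M) : Prop :=
  ∀ᶠ y in 𝓝 x, ContMDiffAt (𝓡 m) (𝓡 m).tangent ∞ (T% X) y

variable {X Y Z : ∀ x : M, TangentSpace (𝓡 m) x}

omit [IsManifold (𝓡 m) ∞ M] in
lemma mvfderiv_congr (h : f =ᶠ[𝓝 x] g) (v : TangentSpace (𝓡 m) x) :
    mvfderiv (𝓡 m) f x v = mvfderiv (𝓡 m) g x v :=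
  congrArg (fun L : TangentSpace (𝓡 m) x →L[ℝ] ℝ => L v) h.mfderiv_eq

lemma fieldDiffAt_extend (v : TangentSpace (𝓡 m) x) : FieldDiffAt (extend (𝔼 m) v) x :=
  mdifferentiableAt_extend (𝓡 m) (𝔼 m) v

lemma FieldDiffAt.add (hX : FieldDiffAt X x) (hY : FieldDiffAt Y x) :
    FieldDiffAt (fun y => X y + Y y) x :=
  mdifferentiableAt_add_section hX hY

lemma FieldDiffAt.neg (hX : FieldDiffAt X x) : FieldDiffAt (fun y => - X y) x :=
  mdifferentiableAt_neg_section hX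

lemma FieldDiffAt.smul (hf : FunDiffAt m f x) (hX : FieldDiffAt X x) :
    FieldDiffAt (fun y => f y • X y) x :=
  MDifferentiableAt.smul_section hf hX

omit [IsManifold (𝓡 m) ∞ M] in
lemma FunDiffAt.const (c : ℝ) : FunDiffAt m (fun _ : M => c) x := mdifferentiableAt_const

lemma SmoothNear.contMDiffAt (h : SmoothNear X x) :
    ContMDiffAt (𝓡 m) (𝓡 m).tangent ∞ (T% X) x :=
  h.self_of_nhds

lemma SmoothNear.mdiff (h : SmoothNear X x) : FieldDiffAt X x :=
  h.contMDiffAt.mdifferentiableAt (by simp)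

lemma SmoothNear.eventually (h : SmoothNear X x) : ∀ᶠ y in 𝓝 x, SmoothNear X y :=
  eventually_eventually_nhds.2 h

lemma SmoothNear.congr (h : SmoothNear X x) (hXY : ∀ᶠ y in 𝓝 x, Y y = X y) :
    SmoothNear Y x := by
  filter_upwards [h, eventually_eventually_nhds.2 hXY] with y hy hy'
  refine hy.congr_of_eventuallyEq ?_
  filter_upwards [hy'] with z hz
  simp [hz]

lemma SmoothNear.sub (hX : SmoothNear X x) (hY : SmoothNear Y x) :
    SmoothNear (fun y => X y - Y y) x := by
  filter_upwards [hX, hY] with y hy hy' using hy.sub_section hy'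

lemma SmoothNear.smul (hf : SmoothFunNear m f x) (hX : SmoothNear X x) :
    SmoothNear (fun y => f y • X y) x := by
  filter_upwards [hf, hX] with y hy hy' using hy.smul_section hy'

lemma SmoothNear.const_smul (c : ℝ) (hX : SmoothNear X x) : SmoothNear (fun y => c • X y) x :=
  .smul (.const c) hX

lemma SmoothNear.sum {ι : Type*} {s : Finset ι} {X : ι → ∀ x : M, TangentSpace (𝓡 m) x}
    (hX : ∀ i ∈ s, SmoothNear (X i) x) : SmoothNear (fun y => ∑ i ∈ s, X i y) x := by
  have : ∀ᶠ y in 𝓝 x, ∀ i ∈ s, ContMDiffAt (𝓡 m) (𝓡 m).tangent ∞ (T% (X i)) y :=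
    (Filter.eventually_all_finset s).2 fun i hi => hX i hi
  filter_upwards [this] with y hy
  exact .sum_section hy

lemma smoothNear_zero : SmoothNear (fun y : M => (0 : TangentSpace (𝓡 m) y)) x :=
  Filter.Eventually.of_forall fun _ => (Bundle.contMDiff_zeroSection ℝ _).contMDiffAt

lemma smoothNear_extend (v : TangentSpace (𝓡 m) x) : SmoothNear (extend (𝔼 m) v) x := by
  obtain ⟨s, hs, h⟩ := exists_contMDiffOn_extend (k := ∞) (𝓡 m) (𝔼 m) v
  filter_upwards [eventually_mem_nhds_iff.2 hs] with y hy
  exact h.contMDiffAt hy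

lemma SmoothNear.mlieBracket (hX : SmoothNear X x) (hY : SmoothNear Y x) :
    SmoothNear (VectorField.mlieBracket (𝓡 m) X Y) x := by
  have : IsManifold (𝓡 m) (((⊤ : ℕ∞) : WithTop ℕ∞) + 1) M := ‹IsManifold (𝓡 m) ∞ M›
  filter_upwards [hX, hY] with y hy hy'
  exact ContMDiffAt.mlieBracket_vectorField (m := ⊤) (n := ⊤) hy hy' (by simp)

/-- The derivative of a smooth function along a smooth vector field is smooth. -/
lemma SmoothFunNear.mvfderiv (hf : SmoothFunNear m f x) (hX : SmoothNear X x) :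
    SmoothFunNear m (fun y => mvfderiv (𝓡 m) f y (X y)) x := by
  filter_upwards [hf, hX] with y hy hy'
  have h1 := hy.mfderiv_const (m := ∞) (by simp)
  have := ContMDiffAt.clm_apply_of_inCoordinates (b₁ := id) (b₂ := f)
    (ϕ := fun z => mfderiv (𝓡 m) 𝓘(ℝ) f z) h1 hy' (by exact hy)
  have h2 := (contMDiffAt_totalSpace.1 this).2
  simp only [trivializationAt_model_space_apply] at h2
  exact h2

variable [RiemannianBundle (fun x : M => TangentSpace (𝓡 m) x)]
  [IsContMDiffRiemannianBundle (𝓡 m) ∞ (𝔼 m) (fun x : M => TangentSpace (𝓡 m) x)]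

lemma SmoothNear.inner (hX : SmoothNear X x) (hY : SmoothNear Y x) :
    SmoothFunNear m (fun y => inner ℝ (X y) (Y y)) x := by
  filter_upwards [hX, hY] with y hy hy'
  exact ContMDiffAt.inner_bundle hy hy'

lemma FieldDiffAt.inner (hX : FieldDiffAt X x) (hY : FieldDiffAt Y x) :
    FunDiffAt m (fun y => inner ℝ (X y) (Y y)) x := by
  have : IsContMDiffRiemannianBundle (𝓡 m) 1 (𝔼 m) (fun x : M => TangentSpace (𝓡 m) x) :=
    .of_le (n := ∞) (WithTop.coe_le_coe.2 le_top)
  exact MDifferentiableAt.inner_bundle hX hY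

lemma SmoothNear.koszul (hX : SmoothNear X x) (hY : SmoothNear Y x) (hZ : SmoothNear Z x) :
    SmoothFunNear m (koszul X Y Z) x := by
  unfold OrthFol.koszul
  exact ((((((hY.inner hZ).mvfderiv hX).add ((hX.inner hZ).mvfderiv hY)).sub
    ((hX.inner hY).mvfderiv hZ)).add ((hX.mlieBracket hY).inner hZ)).sub
    ((hX.mlieBracket hZ).inner hY)).sub ((hY.mlieBracket hZ).inner hX)

end VectorFields

/-! ### The Levi-Civita connection from the Koszul formula. -/

section Connection

variable {m : ℕ} {M : Type*} [TopologicalSpace M] [ChartedSpace (𝔼 m) M] [IsManifold (𝓡 m) ∞ M]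
  [RiemannianBundle (fun x : M => TangentSpace (𝓡 m) x)]
  [IsContMDiffRiemannianBundle (𝓡 m) ∞ (𝔼 m) (fun x : M => TangentSpace (𝓡 m) x)]

variable {X Y Z : ∀ x : M, TangentSpace (𝓡 m) x} {f g : M → ℝ} {x : M}

omit [IsManifold (𝓡 m) ∞ M]
  [IsContMDiffRiemannianBundle (𝓡 m) ∞ (𝔼 m) (fun x : M => TangentSpace (𝓡 m) x)] in
lemma mvfderiv_inner_comm (X Y : ∀ x : M, TangentSpace (𝓡 m) x) (x : M) :
    mvfderiv (𝓡 m) (fun y => inner ℝ (X y) (Y y)) x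
      = mvfderiv (𝓡 m) (fun y => inner ℝ (Y y) (X y)) x := by
  simp only [real_inner_comm]

/-- When `X` is multiplied by `f`, the derivatives of `f` coming from the differentiated inner
products cancel those coming from the brackets. Hence `∇_X Y` depends only on the value of `X` at
the point. -/
lemma tensorialAt_koszul_left (hY : FieldDiffAt Y x) (hZ : FieldDiffAt Z x) :
    TensorialAt (𝓡 m) (𝔼 m) (fun X => koszul X Y Z x) x where
  smul {f X} hf hX := by
    replace hX : FieldDiffAt X x := hX
    have h1 : (fun y => inner ℝ ((f • X) y) (Z y)) = fun y => f y * inner ℝ (X y) (Z y) := by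
      ext y; simp [inner_smul_left]
    have h2 : (fun y => inner ℝ ((f • X) y) (Y y)) = fun y => f y * inner ℝ (X y) (Y y) := by
      ext y; simp [inner_smul_left]
    simp only [koszul, h1, h2, mvfderiv_fun_mul hf (hX.inner hZ),
      mvfderiv_fun_mul hf (hX.inner hY), VectorField.mlieBracket_smul_left hf hX]
    simp [inner_add_left, inner_smul_left, inner_smul_right]
    ring
  add {X X'} hX hX' := by
    replace hX : FieldDiffAt X x := hX
    replace hX' : FieldDiffAt X' x := hX'
    have h1 : (fun y => inner ℝ ((X + X') y) (Z y))
        = fun y => inner ℝ (X y) (Z y) + inner ℝ (X' y) (Z y) := by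
      ext y; simp [inner_add_left]
    have h2 : (fun y => inner ℝ ((X + X') y) (Y y))
        = fun y => inner ℝ (X y) (Y y) + inner ℝ (X' y) (Y y) := by
      ext y; simp [inner_add_left]
    simp only [koszul, h1, h2, mvfderiv_fun_add (hX.inner hZ) (hX'.inner hZ),
      mvfderiv_fun_add (hX.inner hY) (hX'.inner hY),
      VectorField.mlieBracket_add_left hX hX']
    simp [inner_add_left, inner_add_right]
    ring

/-- The same cancellation in the last argument makes the Koszul expression a linear form in `Z x`,
which is what allows it to be represented by a vector. -/
lemma tensorialAt_koszul_right (hX : FieldDiffAt X x) (hY : FieldDiffAt Y x) :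
    TensorialAt (𝓡 m) (𝔼 m) (fun Z => koszul X Y Z x) x where
  smul {f Z} hf hZ := by
    replace hZ : FieldDiffAt Z x := hZ
    have h1 : (fun y => inner ℝ (X y) ((f • Z) y)) = fun y => f y * inner ℝ (X y) (Z y) := by
      ext y; simp [inner_smul_right]
    have h2 : (fun y => inner ℝ (Y y) ((f • Z) y)) = fun y => f y * inner ℝ (Y y) (Z y) := by
      ext y; simp [inner_smul_right]
    simp only [koszul, h1, h2, mvfderiv_fun_mul hf (hX.inner hZ),
      mvfderiv_fun_mul hf (hY.inner hZ), VectorField.mlieBracket_smul_right hf hZ]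
    simp [inner_add_left, inner_smul_left, inner_smul_right, real_inner_comm]
    ring
  add {Z Z'} hZ hZ' := by
    replace hZ : FieldDiffAt Z x := hZ
    replace hZ' : FieldDiffAt Z' x := hZ'
    have h1 : (fun y => inner ℝ (X y) ((Z + Z') y))
        = fun y => inner ℝ (X y) (Z y) + inner ℝ (X y) (Z' y) := by
      ext y; simp [inner_add_right]
    have h2 : (fun y => inner ℝ (Y y) ((Z + Z') y))
        = fun y => inner ℝ (Y y) (Z y) + inner ℝ (Y y) (Z' y) := by
      ext y; simp [inner_add_right]
    simp only [koszul, h1, h2, mvfderiv_fun_add (hX.inner hZ) (hX.inner hZ'),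
      mvfderiv_fun_add (hY.inner hZ) (hY.inner hZ'),
      VectorField.mlieBracket_add_right hZ hZ']
    simp [inner_add_left, inner_add_right]
    ring

/-- The Koszul formula for the Riemannian connection. -/
lemma inner_nabla (hX : FieldDiffAt X x) (hY : FieldDiffAt Y x) (hZ : FieldDiffAt Z x) :
    inner ℝ (nabla (X x) Y) (Z x) = (1 / 2 : ℝ) * koszul X Y Z x := by
  have hv := fieldDiffAt_extend (X x)
  have hR := tensorialAt_koszul_right hv hY
  have hL := tensorialAt_koszul_left hY hZ
  have key : ∀ z : TangentSpace (𝓡 m) x, inner ℝ (nabla (X x) Y) z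
      = (1 / 2 : ℝ) * TensorialAt.mkHom _ x hR z := by
    intro z
    set b := stdOrthonormalBasis ℝ (TangentSpace (𝓡 m) x)
    conv_rhs => rw [← b.sum_repr z]
    simp only [nabla, sum_inner, inner_smul_left, map_sum, map_smul, Finset.mul_sum,
      TensorialAt.mkHom_apply_eq_extend]
    refine Finset.sum_congr rfl fun i _ => ?_
    rw [b.repr_apply_apply, smul_eq_mul]
    simp
    ring
  rw [key, TensorialAt.mkHom_apply hR hZ]
  -- What remains is to replace the canonical extension of `X x`, used in the definition of `nabla`,
  -- by `X` itself.
  congr 1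
  exact hL.pointwise hv hX (by simp)

lemma inner_nabla_extend (hY : FieldDiffAt Y x) (v w : TangentSpace (𝓡 m) x) :
    inner ℝ (nabla v Y) w = (1 / 2 : ℝ) * koszul (extend (𝔼 m) v) Y (extend (𝔼 m) w) x := by
  simpa using inner_nabla (fieldDiffAt_extend v) hY
    (fieldDiffAt_extend w)

lemma nabla_add_dir (hY : FieldDiffAt Y x) (v w : TangentSpace (𝓡 m) x) :
    nabla (v + w) Y = nabla v Y + nabla w Y := by
  refine ext_inner_right ℝ fun z => ?_
  have hv := fieldDiffAt_extend v
  have hw := fieldDiffAt_extend w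
  have hz := fieldDiffAt_extend z
  have h := inner_nabla (hv.add hw) hY hz
  have h' : koszul (fun y => extend (𝔼 m) v y + extend (𝔼 m) w y) Y (extend (𝔼 m) z) x = _ :=
    (tensorialAt_koszul_left hY hz).add hv hw
  rw [h'] at h
  simp only [extend_apply_self] at h
  rw [h, inner_add_left, inner_nabla_extend hY, inner_nabla_extend hY]
  ring

lemma nabla_smul_dir (hY : FieldDiffAt Y x) (c : ℝ) (v : TangentSpace (𝓡 m) x) :
    nabla (c • v) Y = c • nabla v Y := by
  refine ext_inner_right ℝ fun z => ?_
  have hv := fieldDiffAt_extend v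
  have hz := fieldDiffAt_extend z
  have hc : FunDiffAt m (fun _ : M => c) x := (.const _)
  have h := inner_nabla (FieldDiffAt.smul hc hv) hY hz
  have h' : koszul (fun y => c • extend (𝔼 m) v y) Y (extend (𝔼 m) z) x = _ :=
    (tensorialAt_koszul_left hY hz).smul hc hv
  rw [h'] at h
  simp only [extend_apply_self] at h
  rw [h, inner_smul_left, inner_nabla_extend hY]
  simp
  ring

lemma nabla_zero_dir (hY : FieldDiffAt Y x) : nabla (0 : TangentSpace (𝓡 m) x) Y = 0 := by
  simpa using nabla_smul_dir hY 0 0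

lemma nabla_neg_dir (hY : FieldDiffAt Y x) (v : TangentSpace (𝓡 m) x) :
    nabla (-v) Y = - nabla v Y := by
  simpa using nabla_smul_dir hY (-1) v

lemma nabla_sub_dir (hY : FieldDiffAt Y x) (v w : TangentSpace (𝓡 m) x) :
    nabla (v - w) Y = nabla v Y - nabla w Y := by
  rw [sub_eq_add_neg, nabla_add_dir hY, nabla_neg_dir hY, sub_eq_add_neg]

lemma nabla_sum_dir {ι : Type*} (s : Finset ι) (hY : FieldDiffAt Y x)
    (v : ι → TangentSpace (𝓡 m) x) :
    nabla (∑ i ∈ s, v i) Y = ∑ i ∈ s, nabla (v i) Y := by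
  classical
  induction s using Finset.induction_on with
  | empty => simpa using nabla_zero_dir hY
  | insert a s ha h => rw [Finset.sum_insert ha, Finset.sum_insert ha, nabla_add_dir hY, h]

omit [IsManifold (𝓡 m) ∞ M]
  [IsContMDiffRiemannianBundle (𝓡 m) ∞ (𝔼 m) (fun x : M => TangentSpace (𝓡 m) x)] in
lemma koszul_congr (hYZ : ∀ᶠ y in 𝓝 x, Y y = Z y) (X W : ∀ x : M, TangentSpace (𝓡 m) x) :
    koszul X Y W x = koszul X Z W x := by
  have h1 (v) : mvfderiv (𝓡 m) (fun y => inner ℝ (Y y) (W y)) x v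
      = mvfderiv (𝓡 m) (fun y => inner ℝ (Z y) (W y)) x v :=
    mvfderiv_congr (by filter_upwards [hYZ] with y hy using by rw [hy]) v
  have h2 (v) : mvfderiv (𝓡 m) (fun y => inner ℝ (X y) (Y y)) x v
      = mvfderiv (𝓡 m) (fun y => inner ℝ (X y) (Z y)) x v :=
    mvfderiv_congr (by filter_upwards [hYZ] with y hy using by rw [hy]) v
  have h3 : VectorField.mlieBracket (𝓡 m) Y W x = VectorField.mlieBracket (𝓡 m) Z W x :=
    Filter.EventuallyEq.mlieBracket_vectorField_eq hYZ (Filter.EventuallyEq.refl _ W)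
  have h4 : VectorField.mlieBracket (𝓡 m) X Y x = VectorField.mlieBracket (𝓡 m) X Z x :=
    Filter.EventuallyEq.mlieBracket_vectorField_eq (Filter.EventuallyEq.refl _ X) hYZ
  simp only [koszul, h1, h2, h3, h4, hYZ.self_of_nhds]

omit [IsContMDiffRiemannianBundle (𝓡 m) ∞ (𝔼 m) (fun x : M => TangentSpace (𝓡 m) x)] in
lemma nabla_congr (hYZ : ∀ᶠ y in 𝓝 x, Y y = Z y) (v : TangentSpace (𝓡 m) x) : nabla v Y = nabla v Z := by
  simp only [nabla, koszul_congr hYZ]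

lemma nabla_add (hY : FieldDiffAt Y x) (hZ : FieldDiffAt Z x) (v : TangentSpace (𝓡 m) x) :
    nabla v (fun y => Y y + Z y) = nabla v Y + nabla v Z := by
  refine ext_inner_right ℝ fun z => ?_
  have hv := fieldDiffAt_extend v
  have hz := fieldDiffAt_extend z
  have hs : FieldDiffAt (fun y => Y y + Z y) x := hY.add hZ
  rw [inner_add_left, inner_nabla_extend hs, inner_nabla_extend hY, inner_nabla_extend hZ]
  have h2 : VectorField.mlieBracket (𝓡 m) (extend (𝔼 m) v) (fun y => Y y + Z y) x = _ :=
    VectorField.mlieBracket_add_right hY hZ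
  have h3 : VectorField.mlieBracket (𝓡 m) (fun y => Y y + Z y) (extend (𝔼 m) z) x = _ :=
    VectorField.mlieBracket_add_left hY hZ
  simp only [koszul, inner_add_left, inner_add_right, h2, h3,
    mvfderiv_fun_add (hY.inner hz) (hZ.inner hz),
    mvfderiv_fun_add (hv.inner hY) (hv.inner hZ)]
  simp
  ring

lemma nabla_smul (hf : FunDiffAt m f x) (hY : FieldDiffAt Y x) (v : TangentSpace (𝓡 m) x) :
    nabla v (fun y => f y • Y y) = mvfderiv (𝓡 m) f x v • Y x + f x • nabla v Y := by
  refine ext_inner_right ℝ fun z => ?_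
  have hv := fieldDiffAt_extend v
  have hz := fieldDiffAt_extend z
  have hs : FieldDiffAt (fun y => f y • Y y) x := FieldDiffAt.smul hf hY
  rw [inner_add_left, inner_smul_left, inner_smul_left, inner_nabla_extend hs,
    inner_nabla_extend hY]
  have h2 : VectorField.mlieBracket (𝓡 m) (extend (𝔼 m) v) (fun y => f y • Y y) x = _ :=
    VectorField.mlieBracket_smul_right hf hY
  have h3 : VectorField.mlieBracket (𝓡 m) (fun y => f y • Y y) (extend (𝔼 m) z) x = _ :=
    VectorField.mlieBracket_smul_left hf hY
  simp only [koszul, inner_add_left, inner_smul_left, inner_smul_right, h2, h3,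
    conj_trivial, mvfderiv_fun_mul hf (hY.inner hz), mvfderiv_fun_mul hf (hv.inner hY)]
  simp [real_inner_comm]
  ring

lemma nabla_neg (hY : FieldDiffAt Y x) (v : TangentSpace (𝓡 m) x) :
    nabla v (fun y => - Y y) = - nabla v Y := by
  have := nabla_smul (f := fun _ => (-1 : ℝ)) (.const _) hY v
  simpa [mvfderiv_const] using this

lemma nabla_zero (v : TangentSpace (𝓡 m) x) :
    nabla v (fun y : M => (0 : TangentSpace (𝓡 m) y)) = 0 := by
  have := nabla_smul (f := fun _ => (0 : ℝ)) (.const _)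
    (smoothNear_zero (m := m) (x := x)).mdiff v
  simpa [mvfderiv_const] using this

/-- The Riemannian connection is metric. -/
lemma mvfderiv_inner (hY : FieldDiffAt Y x) (hZ : FieldDiffAt Z x) (v : TangentSpace (𝓡 m) x) :
    mvfderiv (𝓡 m) (fun y => inner ℝ (Y y) (Z y)) x v
      = inner ℝ (nabla v Y) (Z x) + inner ℝ (Y x) (nabla v Z) := by
  have hv := fieldDiffAt_extend v
  have h1 := inner_nabla hv hY hZ
  have h2 := inner_nabla hv hZ hY
  rw [extend_apply_self] at h1 h2
  rw [real_inner_comm (nabla v Z), h1, h2]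
  simp only [koszul, mvfderiv_inner_comm Z Y, extend_apply_self,
    VectorField.mlieBracket_swap_apply (V := Z) (W := Y), inner_neg_left]
  ring

/-- The Riemannian connection is torsion-free. -/
lemma nabla_sub_nabla (hX : FieldDiffAt X x) (hY : FieldDiffAt Y x) :
    nabla (X x) Y - nabla (Y x) X = VectorField.mlieBracket (𝓡 m) X Y x := by
  refine ext_inner_right ℝ fun z => ?_
  have hz := fieldDiffAt_extend z
  have h1 := inner_nabla hX hY hz
  have h2 := inner_nabla hY hX hz
  rw [extend_apply_self] at h1 h2
  rw [inner_sub_left, h1, h2]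
  simp only [koszul, mvfderiv_inner_comm Y X, extend_apply_self,
    VectorField.mlieBracket_swap_apply (V := Y) (W := X), inner_neg_left]
  ring

end Connection

/-- An orthonormal family in `K` with at least dim `K` members spans `K` by counting, so its Fourier
sum is the projection. -/
lemma starProjection_eq_sum_of_orthonormal {V : Type*} [NormedAddCommGroup V]
    [InnerProductSpace ℝ V] [FiniteDimensional ℝ V] (K : Submodule ℝ V) {k : ℕ} {e : Fin k → V}
    (he : Orthonormal ℝ e) (hmem : ∀ i, e i ∈ K) (hk : Module.finrank ℝ K ≤ k) (w : V) :
    K.starProjection w = ∑ i, inner ℝ (e i) w • e i := by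
  have hspan : Submodule.span ℝ (Set.range e) = K := by
    refine Submodule.eq_of_le_of_finrank_le (Submodule.span_le.2 ?_) ?_
    · rintro _ ⟨i, rfl⟩
      exact hmem i
    · rw [finrank_span_eq_card he.linearIndependent]
      simpa using hk
  refine Submodule.eq_starProjection_of_mem_of_inner_eq_zero
    (K.sum_mem fun i _ => K.smul_mem _ (hmem i)) fun u hu => ?_
  rw [← hspan] at hu
  induction hu using Submodule.span_induction with
  | mem u hu =>
    obtain ⟨j, rfl⟩ := hu
    rw [inner_sub_left, sum_inner]
    simp [inner_smul_left, orthonormal_iff_ite.1 he, real_inner_comm]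
  | zero => simp
  | add u v _ _ h1 h2 => rw [inner_add_right, h1, h2, add_zero]
  | smul c u _ h => rw [inner_smul_right, h, mul_zero]

/-! ### Local orthonormal frames, brackets as commutators, and tensoriality of the curvature. -/

section Frames

variable {m : ℕ} {M : Type*} [TopologicalSpace M] [ChartedSpace (𝔼 m) M]

lemma SmoothFunNear.inv {f : M → ℝ} {x : M} (hf : SmoothFunNear m f x) (hx : f x ≠ 0) :
    SmoothFunNear m (fun y => (f y)⁻¹) x := by
  filter_upwards [hf, hf.contMDiffAt.continuousAt.eventually_ne hx] with y hy hy0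
  exact ContMDiffAt.inv₀ hy hy0

lemma SmoothFunNear.sqrt {f : M → ℝ} {x : M} (hf : SmoothFunNear m f x) (hx : f x ≠ 0) :
    SmoothFunNear m (fun y => √(f y)) x := by
  filter_upwards [hf, hf.contMDiffAt.continuousAt.eventually_ne hx] with y hy hy0
  exact (Real.contDiffAt_sqrt hy0).contMDiffAt.comp y hy

variable [IsManifold (𝓡 m) ∞ M] [RiemannianBundle (fun x : M => TangentSpace (𝓡 m) x)]
  [IsContMDiffRiemannianBundle (𝓡 m) ∞ (𝔼 m) (fun x : M => TangentSpace (𝓡 m) x)]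

variable {X Y Z : ∀ x : M, TangentSpace (𝓡 m) x} {f g : M → ℝ} {x : M}

/-- At `x` the family is already orthonormal, so Gram–Schmidt fixes it there; the denominators equal
1 at `x` and stay nonzero nearby. -/
lemma smoothNear_gramSchmidt {k : ℕ} {S : Fin k → ∀ x : M, TangentSpace (𝓡 m) x}
    (hS : ∀ i, SmoothNear (S i) x) (hx : Orthonormal ℝ (fun i => S i x)) (i : Fin k) :
    SmoothNear (fun y => InnerProductSpace.gramSchmidt ℝ (fun j => S j y) i) x := by
  have hval : ∀ i, InnerProductSpace.gramSchmidt ℝ (fun j => S j x) i = S i x := fun i => by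
    rw [InnerProductSpace.gramSchmidt_of_orthogonal ℝ (fun i j hij => hx.2 hij)]
  induction i using WellFoundedLT.induction with
  | ind i ih =>
  simp only [InnerProductSpace.gramSchmidt_def ℝ _ i, Submodule.starProjection_singleton]
  refine (hS i).sub (SmoothNear.sum fun j hj => ?_)
  have hj' := ih j (Finset.mem_Iio.1 hj)
  refine SmoothNear.smul ?_ hj'
  have h := (hj'.inner (hS i)).mul ((hj'.inner hj').inv (by
    rw [hval, real_inner_self_eq_norm_sq, hx.1 j]; simp))
  refine h.congr (Filter.Eventually.of_forall fun y => ?_)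
  simp only [real_inner_self_eq_norm_sq, div_eq_mul_inv]
  rfl

/-- Vector fields that are orthonormal at a point can be orthonormalized near this point. -/
lemma exists_orthonormal_frame {k : ℕ} {S : Fin k → ∀ x : M, TangentSpace (𝓡 m) x}
    (hS : ∀ i, SmoothNear (S i) x) (hx : Orthonormal ℝ (fun i => S i x)) :
    ∃ E : Fin k → ∀ x : M, TangentSpace (𝓡 m) x, (∀ i, SmoothNear (E i) x) ∧
      (∀ᶠ y in 𝓝 x, Orthonormal ℝ (fun i => E i y)) ∧
      (∀ y i, E i y ∈ Submodule.span ℝ (Set.range fun j => S j y)) ∧ ∀ i, E i x = S i x := by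
  have hval : ∀ i, InnerProductSpace.gramSchmidt ℝ (fun j => S j x) i = S i x := fun i => by
    rw [InnerProductSpace.gramSchmidt_of_orthogonal ℝ (fun i j hij => hx.2 hij)]
  set G : Fin k → ∀ x : M, TangentSpace (𝓡 m) x :=
    fun i y => InnerProductSpace.gramSchmidt ℝ (fun j => S j y) i with hG
  have hGs : ∀ i, SmoothNear (G i) x := smoothNear_gramSchmidt hS hx
  have hG1 : ∀ i, inner ℝ (G i x) (G i x) = 1 := fun i => by
    rw [hG]
    simp only [hval, real_inner_self_eq_norm_sq, hx.1 i, one_pow]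
  have hG0 : ∀ i, ∀ᶠ y in 𝓝 x, inner ℝ (G i y) (G i y) ≠ 0 := fun i =>
    ((hGs i).inner (hGs i)).contMDiffAt.continuousAt.eventually_ne (by rw [hG1]; simp)
  refine ⟨fun i y => (√(inner ℝ (G i y) (G i y)))⁻¹ • G i y, fun i => ?_, ?_, fun y i => ?_,
    fun i => ?_⟩
  · refine SmoothNear.smul ((((hGs i).inner (hGs i)).sqrt (by rw [hG1]; simp)).inv ?_) (hGs i)
    rw [hG1]; simp
  · filter_upwards [Filter.eventually_all.2 hG0] with y hy
    refine ⟨fun i => ?_, fun i j hij => ?_⟩ <;> dsimp only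
    · have : ‖G i y‖ ≠ 0 := fun h => hy i (by rw [real_inner_self_eq_norm_sq, h]; simp)
      rw [← norm_eq_sqrt_real_inner, norm_smul, norm_inv, norm_norm, inv_mul_cancel₀ this]
    · rw [inner_smul_left, inner_smul_right, hG]
      simp only
      rw [InnerProductSpace.gramSchmidt_orthogonal ℝ _ hij]
      simp
  · exact Submodule.smul_mem _ _ (InnerProductSpace.span_gramSchmidt ℝ (fun j => S j y) ▸
      Submodule.subset_span ⟨i, rfl⟩)
  · simp only [hG1]
    simp [hG, hval]

/-- There is a smooth local orthonormal frame of the tangent bundle around every point. -/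
lemma exists_tangent_frame (x : M) :
    ∃ (k : ℕ) (E : Fin k → ∀ x : M, TangentSpace (𝓡 m) x), (∀ i, SmoothNear (E i) x) ∧
      ∀ᶠ y in 𝓝 x, ∀ w : TangentSpace (𝓡 m) y, w = ∑ i, inner ℝ (E i y) w • E i y := by
  set b := stdOrthonormalBasis ℝ (TangentSpace (𝓡 m) x)
  obtain ⟨E, hE, hon, -, -⟩ := exists_orthonormal_frame (x := x)
    (S := fun i => extend (𝔼 m) (b i)) (fun i => smoothNear_extend _) (by simp [b.orthonormal])
  refine ⟨_, E, hE, ?_⟩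
  filter_upwards [hon] with y hy w
  have h := starProjection_eq_sum_of_orthonormal ⊤ hy (fun _ => trivial) ?_ w
  · rwa [Submodule.starProjection_eq_self_iff.2 Submodule.mem_top] at h
  · rw [finrank_top]
    exact le_rfl

/-- The definition of `nabla` picks a basis and extensions separately at every point, so smoothness
is not visible in it. In a smooth orthonormal frame the coefficients are Koszul expressions of
smooth fields. -/
lemma SmoothNear.nabla (hX : SmoothNear X x) (hY : SmoothNear Y x) :
    SmoothNear (fun y => nabla (X y) Y) x := by
  obtain ⟨k, E, hE, hexp⟩ := exists_tangent_frame (m := m) x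
  have : SmoothNear (fun y => ∑ i, ((1 / 2 : ℝ) * OrthFol.koszul X Y (E i) y) • E i y) x :=
    .sum fun i _ => .smul ((SmoothFunNear.const _).mul (hX.koszul hY (hE i))) (hE i)
  refine this.congr ?_
  filter_upwards [hX.eventually, hY.eventually, hexp,
    Filter.eventually_all.2 fun i => (hE i).eventually] with y h1 h2 h3 h4
  rw [h3 (OrthFol.nabla (X y) Y)]
  refine Finset.sum_congr rfl fun i _ => ?_
  rw [← inner_nabla h1.mdiff h2.mdiff (h4 i).mdiff, real_inner_comm]

omit [RiemannianBundle (fun x : M => TangentSpace (𝓡 m) x)]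
  [IsContMDiffRiemannianBundle (𝓡 m) ∞ (𝔼 m) (fun x : M => TangentSpace (𝓡 m) x)] in
/-- The Lie bracket acts on functions as the commutator of derivations. -/
lemma mvfderiv_mlieBracket (hX : SmoothNear X x) (hY : SmoothNear Y x) (hf : SmoothFunNear m f x) :
    mvfderiv (𝓡 m) f x (VectorField.mlieBracket (𝓡 m) X Y x)
      = mvfderiv (𝓡 m) (fun y => mvfderiv (𝓡 m) f y (Y y)) x (X x)
        - mvfderiv (𝓡 m) (fun y => mvfderiv (𝓡 m) f y (X y)) x (Y x) := by
  by_cases hs : Subsingleton (TangentSpace (𝓡 m) x)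
  · rw [Subsingleton.elim (VectorField.mlieBracket (𝓡 m) X Y x) 0, Subsingleton.elim (X x) 0,
      Subsingleton.elim (Y x) 0]
    simp
  rw [not_subsingleton_iff_nontrivial] at hs
  -- The Jacobi identity is applied to `X`, `Y` and `f W` with `W x = w ≠ 0`: the second derivatives
  -- of `f` appear there as coefficients of `W x`.
  obtain ⟨w, hw⟩ := exists_ne (0 : TangentSpace (𝓡 m) x)
  set W := extend (𝔼 m) w with hWdef
  have hW : SmoothNear W x := smoothNear_extend w
  have key {U V : ∀ x : M, TangentSpace (𝓡 m) x} (hU : SmoothNear U x) (hV : SmoothNear V x) :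
      VectorField.mlieBracket (𝓡 m) U (VectorField.mlieBracket (𝓡 m) V (fun y => f y • W y)) x
        = mvfderiv (𝓡 m) (fun y => mvfderiv (𝓡 m) f y (V y)) x (U x) • W x
          + mvfderiv (𝓡 m) f x (V x) • VectorField.mlieBracket (𝓡 m) U W x
          + mvfderiv (𝓡 m) f x (U x) • VectorField.mlieBracket (𝓡 m) V W x
          + f x • VectorField.mlieBracket (𝓡 m) U (VectorField.mlieBracket (𝓡 m) V W) x := by
    have h1 : VectorField.mlieBracket (𝓡 m) V (fun y => f y • W y) =ᶠ[𝓝 x]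
        ((fun y => mvfderiv (𝓡 m) f y (V y) • W y)
          + fun y => f y • VectorField.mlieBracket (𝓡 m) V W y) := by
      filter_upwards [hf.eventually, hW.eventually] with y hy hy'
      exact VectorField.mlieBracket_smul_right hy.mdiff hy'.mdiff
    rw [Filter.EventuallyEq.mlieBracket_vectorField_eq (Filter.EventuallyEq.refl _ U) h1,
      VectorField.mlieBracket_add_right (SmoothNear.smul (hf.mvfderiv hV) hW).mdiff
        (SmoothNear.smul hf (hV.mlieBracket hW)).mdiff]
    have h2 : VectorField.mlieBracket (𝓡 m) U (fun y => mvfderiv (𝓡 m) f y (V y) • W y) x = _ :=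
      VectorField.mlieBracket_smul_right (hf.mvfderiv hV).mdiff hW.mdiff
    have h3 : VectorField.mlieBracket (𝓡 m) U
        (fun y => f y • VectorField.mlieBracket (𝓡 m) V W y) x = _ :=
      VectorField.mlieBracket_smul_right hf.mdiff (hV.mlieBracket hW).mdiff
    rw [h2, h3]
    abel
  have hj := fun {V : ∀ x : M, TangentSpace (𝓡 m) x} (hV : SmoothNear V x) =>
    VectorField.leibniz_identity_mlieBracket_apply (I := 𝓡 m) (U := X) (V := Y) (W := V) (x := x)
      (hX.contMDiffAt.of_le (by simp; exact WithTop.coe_le_coe.2 le_top))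
      (hY.contMDiffAt.of_le (by simp; exact WithTop.coe_le_coe.2 le_top))
      (hV.contMDiffAt.of_le (by simp; exact WithTop.coe_le_coe.2 le_top))
  have j1 := hj (SmoothNear.smul hf hW)
  have j2 := hj hW
  have h4 : VectorField.mlieBracket (𝓡 m) (VectorField.mlieBracket (𝓡 m) X Y)
      (fun y => f y • W y) x = _ :=
    VectorField.mlieBracket_smul_right hf.mdiff hW.mdiff
  rw [key hX hY, key hY hX, h4, j2] at j1
  have hWx : W x = w := by simp [hWdef]
  rw [hWx] at j1
  -- After the Jacobi identity for `W` itself is used, all other brackets cancel and only a multiple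
  -- of `w` is left.
  have h5 : (mvfderiv (𝓡 m) f x (VectorField.mlieBracket (𝓡 m) X Y x)
      - (mvfderiv (𝓡 m) (fun y => mvfderiv (𝓡 m) f y (Y y)) x (X x)
        - mvfderiv (𝓡 m) (fun y => mvfderiv (𝓡 m) f y (X y)) x (Y x))) • w = 0 := by
    simp only [sub_smul, smul_add] at j1 ⊢
    rw [← sub_eq_zero] at j1
    rw [← neg_eq_zero, ← j1]
    abel
  have := (smul_eq_zero.1 h5).resolve_right hw
  linarith

/-- An operation on vector fields smooth near `x` which is local and linear over the functions
smooth near `x`. -/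
structure SmoothTensorialAt {A : Type*} [AddCommGroup A] [Module ℝ A]
    (Φ : (∀ x : M, TangentSpace (𝓡 m) x) → A) (x : M) : Prop where
  congr : ∀ {X Y : ∀ x : M, TangentSpace (𝓡 m) x}, (∀ᶠ y in 𝓝 x, X y = Y y) → Φ X = Φ Y
  add : ∀ {X Y : ∀ x : M, TangentSpace (𝓡 m) x}, SmoothNear X x → SmoothNear Y x →
    Φ (fun y => X y + Y y) = Φ X + Φ Y
  smul : ∀ {f : M → ℝ} {X : ∀ x : M, TangentSpace (𝓡 m) x}, SmoothFunNear m f x →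
    SmoothNear X x → Φ (fun y => f y • X y) = f x • Φ X

section Tensorial

variable {A : Type*} [AddCommGroup A] [Module ℝ A] {Φ : (∀ x : M, TangentSpace (𝓡 m) x) → A}

omit [RiemannianBundle (fun x : M => TangentSpace (𝓡 m) x)]
  [IsContMDiffRiemannianBundle (𝓡 m) ∞ (𝔼 m) (fun x : M => TangentSpace (𝓡 m) x)] in
lemma SmoothTensorialAt.zero (h : SmoothTensorialAt Φ x) : Φ (fun _ => 0) = 0 := by
  simpa using h.smul (SmoothFunNear.const 0) (smoothNear_zero (m := m) (x := x))

omit [RiemannianBundle (fun x : M => TangentSpace (𝓡 m) x)]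
  [IsContMDiffRiemannianBundle (𝓡 m) ∞ (𝔼 m) (fun x : M => TangentSpace (𝓡 m) x)] in
lemma SmoothTensorialAt.sum (h : SmoothTensorialAt Φ x) {ι : Type*} (s : Finset ι)
    {X : ι → ∀ x : M, TangentSpace (𝓡 m) x} (hX : ∀ i ∈ s, SmoothNear (X i) x) :
    Φ (fun y => ∑ i ∈ s, X i y) = ∑ i ∈ s, Φ (X i) := by
  classical
  induction s using Finset.induction_on with
  | empty => simpa using h.zero
  | insert a s ha ih =>
    simp only [Finset.sum_insert ha]
    rw [h.add (hX a (by simp)) (SmoothNear.sum fun i hi => hX i (by simp [hi])),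
      ih fun i hi => hX i (by simp [hi])]

/-- A tensorial operation depends only on the value of the vector field at the point. -/
lemma SmoothTensorialAt.pointwise (h : SmoothTensorialAt Φ x) (hX : SmoothNear X x)
    (hY : SmoothNear Y x) (hXY : X x = Y x) : Φ X = Φ Y := by
  obtain ⟨k, E, hE, hexp⟩ := exists_tangent_frame (m := m) x
  have hD : SmoothNear (fun y => X y - Y y) x := hX.sub hY
  have h0 : Φ (fun y => X y - Y y) = 0 := by
    have h1 : ∀ᶠ y in 𝓝 x, X y - Y y
        = ∑ i, inner ℝ (E i y) (X y - Y y) • E i y := by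
      filter_upwards [hexp] with y hy using hy _
    rw [h.congr h1]
    refine (h.sum _ fun i _ => .smul ((hE i).inner hD) (hE i)).trans ?_
    refine Finset.sum_eq_zero fun i _ => ?_
    rw [h.smul ((hE i).inner hD) (hE i), hXY]
    simp
  have h2 := h.add hY hD
  rw [h0, add_zero] at h2
  rw [← h2]
  simp

end Tensorial

/-- The curvature expression of three vector fields. -/
def riem (U V W : ∀ x : M, TangentSpace (𝓡 m) x) (x : M) : TangentSpace (𝓡 m) x :=
  nabla (U x) (fun y => nabla (V y) W) - nabla (V x) (fun y => nabla (U y) W)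
    - nabla (VectorField.mlieBracket (𝓡 m) U V x) W

omit [IsContMDiffRiemannianBundle (𝓡 m) ∞ (𝔼 m) (fun x : M => TangentSpace (𝓡 m) x)] in
lemma curvature_eq_riem (u v w : TangentSpace (𝓡 m) x) :
    curvature u v w = riem (extend (𝔼 m) u) (extend (𝔼 m) v) (extend (𝔼 m) w) x := by
  simp [curvature, riem]

lemma riem_swap (U V W : ∀ x : M, TangentSpace (𝓡 m) x) (hW : SmoothNear W x) :
    riem U V W x = - riem V U W x := by
  unfold riem
  rw [VectorField.mlieBracket_swap_apply (V := U), nabla_neg_dir hW.mdiff]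
  abel

/-- For `U = f X` the term `V(f) ∇_X W` arises once from differentiating `f ∇_X W` and once, with
the opposite sign, from the bracket. -/
lemma smoothTensorialAt_riem_left {V W : ∀ x : M, TangentSpace (𝓡 m) x} (hV : SmoothNear V x)
    (hW : SmoothNear W x) : SmoothTensorialAt (fun U => riem U V W x) x where
  congr {X Y} h := by
    have h1 : ∀ᶠ y in 𝓝 x, nabla (X y) W
        = nabla (Y y) W := by
      filter_upwards [h] with y hy using by rw [hy]
    have h2 : VectorField.mlieBracket (𝓡 m) X V x = VectorField.mlieBracket (𝓡 m) Y V x :=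
      Filter.EventuallyEq.mlieBracket_vectorField_eq h (Filter.EventuallyEq.refl _ V)
    simp only [riem, nabla_congr h1, h.self_of_nhds, h2]
  add {X Y} hX hY := by
    have h1 : ∀ᶠ y in 𝓝 x, nabla (X y + Y y) W
        = nabla (X y) W + nabla (Y y) W := by
      filter_upwards [hW.eventually] with y hy using nabla_add_dir hy.mdiff _ _
    have h2 : VectorField.mlieBracket (𝓡 m) (fun y => X y + Y y) V x = _ :=
      VectorField.mlieBracket_add_left hX.mdiff hY.mdiff
    simp only [riem, nabla_congr h1]
    rw [h2, nabla_add (hX.nabla hW).mdiff (hY.nabla hW).mdiff, nabla_add_dir (hV.nabla hW).mdiff,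
      nabla_add_dir hW.mdiff]
    abel
  smul {f X} hf hX := by
    have h1 : ∀ᶠ y in 𝓝 x, nabla (f y • X y) W
        = f y • nabla (X y) W := by
      filter_upwards [hW.eventually] with y hy using nabla_smul_dir hy.mdiff _ _
    have h2 : VectorField.mlieBracket (𝓡 m) (fun y => f y • X y) V x = _ :=
      VectorField.mlieBracket_smul_left hf.mdiff hX.mdiff
    simp only [riem, nabla_congr h1]
    rw [h2, nabla_smul hf.mdiff (hX.nabla hW).mdiff, nabla_smul_dir (hV.nabla hW).mdiff,
      nabla_add_dir hW.mdiff, nabla_smul_dir hW.mdiff, nabla_smul_dir hW.mdiff]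
    module

/-- The first-order terms in `f` are symmetric in `U` and `V` and cancel; the second-order ones
leave the factor `U(V f) − V(U f) − [U, V] f`, which is zero by `mvfderiv_mlieBracket`. -/
lemma smoothTensorialAt_riem_right {U V : ∀ x : M, TangentSpace (𝓡 m) x} (hU : SmoothNear U x)
    (hV : SmoothNear V x) : SmoothTensorialAt (fun W => riem U V W x) x where
  congr {X Y} h := by
    have h1 (Z : ∀ x : M, TangentSpace (𝓡 m) x) :
        ∀ᶠ y in 𝓝 x, nabla (Z y) X
          = nabla (Z y) Y := by
      filter_upwards [eventually_eventually_nhds.2 h] with y hy using nabla_congr hy _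
    simp only [riem, nabla_congr (h1 _), nabla_congr h]
  add {X Y} hX hY := by
    have h1 (Z : ∀ x : M, TangentSpace (𝓡 m) x) :
        ∀ᶠ y in 𝓝 x, nabla (Z y) (fun z => X z + Y z)
          = nabla (Z y) X + nabla (Z y) Y := by
      filter_upwards [hX.eventually, hY.eventually] with y hy hy' using
        nabla_add hy.mdiff hy'.mdiff _
    simp only [riem, nabla_congr (h1 _)]
    rw [nabla_add (hV.nabla hX).mdiff (hV.nabla hY).mdiff,
      nabla_add (hU.nabla hX).mdiff (hU.nabla hY).mdiff, nabla_add hX.mdiff hY.mdiff]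
    abel
  smul {f X} hf hX := by
    have h1 (Z : ∀ x : M, TangentSpace (𝓡 m) x) :
        ∀ᶠ y in 𝓝 x, nabla (Z y) (fun z => f z • X z)
          = mvfderiv (𝓡 m) f y (Z y) • X y + f y • nabla (Z y) X := by
      filter_upwards [hf.eventually, hX.eventually] with y hy hy' using
        nabla_smul hy.mdiff hy'.mdiff _
    have h2 {Z Z' : ∀ x : M, TangentSpace (𝓡 m) x} (hZ : SmoothNear Z x) (hZ' : SmoothNear Z' x) :
        nabla (Z' x) (fun y => mvfderiv (𝓡 m) f y (Z y) • X y + f y • nabla (Z y) X)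
          = mvfderiv (𝓡 m) (fun y => mvfderiv (𝓡 m) f y (Z y)) x (Z' x) • X x
            + mvfderiv (𝓡 m) f x (Z x) • nabla (Z' x) X
            + mvfderiv (𝓡 m) f x (Z' x) • nabla (Z x) X
            + f x • nabla (Z' x) (fun y => nabla (Z y) X) := by
      rw [nabla_add (SmoothNear.smul (hf.mvfderiv hZ) hX).mdiff
        (SmoothNear.smul hf (hZ.nabla hX)).mdiff, nabla_smul (hf.mvfderiv hZ).mdiff hX.mdiff,
        nabla_smul hf.mdiff (hZ.nabla hX).mdiff]
      module
    simp only [riem, nabla_congr (h1 _)]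
    rw [h2 hV hU, h2 hU hV, nabla_smul hf.mdiff hX.mdiff, mvfderiv_mlieBracket hU hV hf]
    module

/-- The curvature tensor can be computed with any smooth extensions of the three vectors. -/
lemma curvature_eq {U V W : ∀ x : M, TangentSpace (𝓡 m) x} (hU : SmoothNear U x)
    (hV : SmoothNear V x) (hW : SmoothNear W x) : curvature (U x) (V x) (W x) = riem U V W x := by
  have eU := smoothNear_extend (U x)
  have eV := smoothNear_extend (V x)
  have eW := smoothNear_extend (W x)
  -- The extensions are exchanged one slot at a time; the middle slot is reduced to the first by
  -- antisymmetry.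
  rw [curvature_eq_riem, (smoothTensorialAt_riem_left eV eW).pointwise eU hU (by simp),
    riem_swap _ _ _ eW, (smoothTensorialAt_riem_left hU eW).pointwise eV hV (by simp),
    ← riem_swap _ _ _ eW, (smoothTensorialAt_riem_right hU hV).pointwise eW hW (by simp)]

end Frames

/-! ### Foliated charts, coordinate fields and adapted frames. -/

section Charts

variable {m k l : ℕ} {M : Type*} [TopologicalSpace M] [ChartedSpace (𝔼 m) M]
  {φ : OpenPartialHomeomorph M (𝔼 k × 𝔼 l)} {x y : M}

/-- The derivative of a coordinate system. -/
def chartDeriv (m : ℕ) {M : Type*} [TopologicalSpace M] [ChartedSpace (𝔼 m) M]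
    (φ : OpenPartialHomeomorph M (𝔼 k × 𝔼 l)) (y : M) :
    TangentSpace (𝓡 m) y →L[ℝ] 𝔼 k × 𝔼 l :=
  mfderiv (𝓡 m) 𝓘(ℝ, 𝔼 k × 𝔼 l) φ y

/-- The derivative of the inverse of a coordinate system. -/
def chartDerivSymm (m : ℕ) {M : Type*} [TopologicalSpace M] [ChartedSpace (𝔼 m) M]
    (φ : OpenPartialHomeomorph M (𝔼 k × 𝔼 l)) (z : 𝔼 k × 𝔼 l) :
    𝔼 k × 𝔼 l →L[ℝ] TangentSpace (𝓡 m) (φ.symm z) :=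
  mfderiv 𝓘(ℝ, 𝔼 k × 𝔼 l) (𝓡 m) φ.symm z

lemma IsSmoothChart.contMDiffAt (hφ : IsSmoothChart (m := m) φ) (hy : y ∈ φ.source) :
    ContMDiffAt (𝓡 m) 𝓘(ℝ, 𝔼 k × 𝔼 l) ∞ φ y :=
  hφ.smooth.contMDiffAt (φ.open_source.mem_nhds hy)

lemma IsSmoothChart.contMDiffAt_symm (hφ : IsSmoothChart (m := m) φ) {z : 𝔼 k × 𝔼 l}
    (hz : z ∈ φ.target) : ContMDiffAt 𝓘(ℝ, 𝔼 k × 𝔼 l) (𝓡 m) ∞ φ.symm z :=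
  hφ.smooth_symm.contMDiffAt (φ.open_target.mem_nhds hz)

lemma IsSmoothChart.mdifferentiableAt (hφ : IsSmoothChart (m := m) φ) (hy : y ∈ φ.source) :
    MDifferentiableAt (𝓡 m) 𝓘(ℝ, 𝔼 k × 𝔼 l) φ y :=
  (hφ.contMDiffAt hy).mdifferentiableAt (by simp)

lemma IsSmoothChart.mdifferentiableAt_symm (hφ : IsSmoothChart (m := m) φ) {z : 𝔼 k × 𝔼 l}
    (hz : z ∈ φ.target) : MDifferentiableAt 𝓘(ℝ, 𝔼 k × 𝔼 l) (𝓡 m) φ.symm z :=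
  (hφ.contMDiffAt_symm hz).mdifferentiableAt (by simp)

lemma mfderiv_snd_chart (hφ : IsSmoothChart (m := m) φ) (hy : y ∈ φ.source)
    (v : TangentSpace (𝓡 m) y) :
    mfderiv (𝓡 m) (𝓡 l) (fun z => (φ z).2) y v = (chartDeriv m φ y v).2 := by
  have h := (((ContinuousLinearMap.snd ℝ (𝔼 k) (𝔼 l)).hasMFDerivAt (x := φ y))).comp y
    (hφ.mdifferentiableAt hy).hasMFDerivAt
  have h' : mfderiv (𝓡 m) (𝓡 l) (fun z => (φ z).2) y = _ := h.mfderiv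
  rw [h']
  rfl

lemma mfderiv_fst_chart (hφ : IsSmoothChart (m := m) φ) (hy : y ∈ φ.source)
    (v : TangentSpace (𝓡 m) y) :
    mfderiv (𝓡 m) (𝓡 k) (fun z => (φ z).1) y v = (chartDeriv m φ y v).1 := by
  have h := (((ContinuousLinearMap.fst ℝ (𝔼 k) (𝔼 l)).hasMFDerivAt (x := φ y))).comp y
    (hφ.mdifferentiableAt hy).hasMFDerivAt
  have h' : mfderiv (𝓡 m) (𝓡 k) (fun z => (φ z).1) y = _ := h.mfderiv
  rw [h']
  rfl

lemma mvfderiv_snd_chart_apply (hφ : IsSmoothChart (m := m) φ) (hy : y ∈ φ.source)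
    (v : TangentSpace (𝓡 m) y) (j : Fin l) :
    mvfderiv (𝓡 m) (fun z => (φ z).2 j) y v = (chartDeriv m φ y v).2 j := by
  have h := ((((EuclideanSpace.proj j : 𝔼 l →L[ℝ] ℝ).comp
    (ContinuousLinearMap.snd ℝ (𝔼 k) (𝔼 l))).hasMFDerivAt (x := φ y))).comp y
    (hφ.mdifferentiableAt hy).hasMFDerivAt
  have h' : mfderiv (𝓡 m) 𝓘(ℝ) (fun z => (φ z).2 j) y = _ := h.mfderiv
  rw [mvfderiv, h']
  rfl

lemma smoothFunNear_snd_chart (hφ : IsSmoothChart (m := m) φ) (hx : x ∈ φ.source) (j : Fin l) :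
    SmoothFunNear m (fun z => (φ z).2 j) x := by
  filter_upwards [φ.open_source.mem_nhds hx] with y hy
  have h := (((EuclideanSpace.proj j : 𝔼 l →L[ℝ] ℝ).comp
    (ContinuousLinearMap.snd ℝ (𝔼 k) (𝔼 l))).contMDiff (n := ∞)).contMDiffAt.comp y
    (hφ.contMDiffAt hy)
  exact h

lemma mem_tangent_iff_chartDeriv_snd {T : Distribution m M} (hφ : IsSmoothChart (m := m) φ)
    (hT : TangentToFstSlices T φ) (hy : y ∈ φ.source) (v : TangentSpace (𝓡 m) y) :
    v ∈ T y ↔ (chartDeriv m φ y v).2 = 0 := by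
  rw [hT y hy v, mfderiv_snd_chart hφ hy]
  rfl

lemma mem_tangent_iff_chartDeriv_fst {T : Distribution m M} (hφ : IsSmoothChart (m := m) φ)
    (hT : TangentToSndSlices T φ) (hy : y ∈ φ.source) (v : TangentSpace (𝓡 m) y) :
    v ∈ T y ↔ (chartDeriv m φ y v).1 = 0 := by
  rw [hT y hy v, mfderiv_fst_chart hφ hy]
  rfl

lemma chartDeriv_comp_chartDerivSymm (hφ : IsSmoothChart (m := m) φ) {z : 𝔼 k × 𝔼 l}
    (hz : z ∈ φ.target) (c : 𝔼 k × 𝔼 l) :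
    chartDeriv m φ (φ.symm z) (chartDerivSymm m φ z c) = c := by
  have h := (hφ.mdifferentiableAt (φ.map_target hz)).hasMFDerivAt.comp z
    (hφ.mdifferentiableAt_symm hz).hasMFDerivAt
  have h2 : HasMFDerivAt 𝓘(ℝ, 𝔼 k × 𝔼 l) 𝓘(ℝ, 𝔼 k × 𝔼 l) (φ ∘ φ.symm) z
      (ContinuousLinearMap.id ℝ (𝔼 k × 𝔼 l)) :=
    (hasMFDerivAt_id z).congr_of_eventuallyEq (φ.eventually_right_inverse hz)
  exact congrArg (fun L : 𝔼 k × 𝔼 l →L[ℝ] 𝔼 k × 𝔼 l => L c) (hasMFDerivAt_unique h h2)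

/-- Stated in `𝔼 m` because the two sides live in the tangent spaces at `φ.symm (φ y)` and at `y`.
-/
lemma chartDerivSymm_comp_chartDeriv (hφ : IsSmoothChart (m := m) φ) (hy : y ∈ φ.source)
    (v : TangentSpace (𝓡 m) y) :
    (chartDerivSymm m φ (φ y) (chartDeriv m φ y v) : 𝔼 m) = v := by
  have h := (hφ.mdifferentiableAt_symm (φ.map_source hy)).hasMFDerivAt.comp y
    (hφ.mdifferentiableAt hy).hasMFDerivAt
  have h2 : HasMFDerivAt (𝓡 m) (𝓡 m) (φ.symm ∘ φ) y
      (ContinuousLinearMap.id ℝ (TangentSpace (𝓡 m) y)) :=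
    (hasMFDerivAt_id y).congr_of_eventuallyEq (φ.eventually_left_inverse hy)
  exact congrArg (fun L : 𝔼 m →L[ℝ] 𝔼 m => L v) (hasMFDerivAt_unique h h2)

lemma chartDeriv_bijective (hφ : IsSmoothChart (m := m) φ) (hy : y ∈ φ.source) :
    Function.Bijective (chartDeriv m φ y) := by
  refine ⟨fun v w h => ?_, fun c => ?_⟩
  · have hv := chartDerivSymm_comp_chartDeriv hφ hy v
    rw [h, chartDerivSymm_comp_chartDeriv hφ hy w] at hv
    exact hv.symm
  · have := chartDeriv_comp_chartDerivSymm hφ (φ.map_source hy) c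
    rw [φ.left_inv hy] at this
    exact ⟨_, this⟩

instance t2SpaceTangentSpace (x : M) : T2Space (TangentSpace (𝓡 m) x) :=
  inferInstanceAs (T2Space (𝔼 m))

/-- The derivative of a coordinate system as an isomorphism. -/
def chartDerivEquiv (hφ : IsSmoothChart (m := m) φ) (hy : y ∈ φ.source) :
    TangentSpace (𝓡 m) y ≃L[ℝ] 𝔼 k × 𝔼 l :=
  (LinearEquiv.ofBijective (chartDeriv m φ y : TangentSpace (𝓡 m) y →ₗ[ℝ] 𝔼 k × 𝔼 l)
    (chartDeriv_bijective hφ hy)).toContinuousLinearEquiv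

lemma isInvertible_chartDeriv (hφ : IsSmoothChart (m := m) φ) (hy : y ∈ φ.source) :
    (chartDeriv m φ y).IsInvertible :=
  ⟨chartDerivEquiv hφ hy, rfl⟩

/-- The coordinate vector field with constant coefficients `c`. -/
def coordField (m : ℕ) {M : Type*} [TopologicalSpace M] [ChartedSpace (𝔼 m) M]
    (φ : OpenPartialHomeomorph M (𝔼 k × 𝔼 l)) (c : 𝔼 k × 𝔼 l) : ∀ y : M, TangentSpace (𝓡 m) y :=
  VectorField.mpullback (𝓡 m) 𝓘(ℝ, 𝔼 k × 𝔼 l) φ (fun _ => c)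

lemma chartDeriv_coordField (hφ : IsSmoothChart (m := m) φ) (hy : y ∈ φ.source) (c : 𝔼 k × 𝔼 l) :
    chartDeriv m φ y (coordField m φ c y) = c := by
  have h : coordField m φ c y = (chartDeriv m φ y).inverse c := rfl
  rw [h]
  exact (isInvertible_chartDeriv hφ hy).self_apply_inverse c

lemma coordField_eq (hφ : IsSmoothChart (m := m) φ) (hy : y ∈ φ.source)
    (v : TangentSpace (𝓡 m) y) : coordField m φ (chartDeriv m φ y v) y = v :=
  (chartDeriv_bijective hφ hy).1 (chartDeriv_coordField hφ hy _)

/-- The derivative of the chart carries `T y` isomorphically onto `ℝᵏ × {0}`. -/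
lemma finrank_tangent_of_chart {T : Distribution m M} (hφ : IsSmoothChart (m := m) φ)
    (hT : TangentToFstSlices T φ) (hy : y ∈ φ.source) : Module.finrank ℝ (T y) = k := by
  let L : T y →ₗ[ℝ] 𝔼 k := (LinearMap.fst ℝ (𝔼 k) (𝔼 l)).comp
    ((chartDeriv m φ y : TangentSpace (𝓡 m) y →ₗ[ℝ] 𝔼 k × 𝔼 l).comp (T y).subtype)
  have hL : Function.Bijective L := by
    refine ⟨fun v w h => ?_, fun c => ?_⟩
    · apply Subtype.ext
      apply (chartDeriv_bijective hφ hy).1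
      refine Prod.ext h ?_
      rw [(mem_tangent_iff_chartDeriv_snd hφ hT hy _).1 v.2,
        (mem_tangent_iff_chartDeriv_snd hφ hT hy _).1 w.2]
    · refine ⟨⟨coordField m φ (c, 0) y, ?_⟩, ?_⟩
      · rw [mem_tangent_iff_chartDeriv_snd hφ hT hy, chartDeriv_coordField hφ hy]
      · exact congrArg Prod.fst (chartDeriv_coordField hφ hy (c, 0))
  rw [(LinearEquiv.ofBijective L hL).finrank_eq]
  simp

lemma Foliation.finrank_tangent (F : Foliation m k l M) (x : M) :
    Module.finrank ℝ (F.tangent x) = k := by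
  obtain ⟨φ, hx, hφ, hT⟩ := F.exists_chart x
  exact finrank_tangent_of_chart hφ hT hx

variable [IsManifold (𝓡 m) ∞ M]

lemma smoothNear_coordField (hφ : IsSmoothChart (m := m) φ) (hx : x ∈ φ.source) (c : 𝔼 k × 𝔼 l) :
    SmoothNear (coordField m φ c) x := by
  filter_upwards [φ.open_source.mem_nhds hx] with y hy
  refine ContMDiffAt.mpullback_vectorField_preimage (n := ∞) ?_ (hφ.contMDiffAt hy)
    (isInvertible_chartDeriv hφ hy) (by simp)
  exact contMDiffAt_vectorSpace_iff_contDiffAt.2 contDiffAt_const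

lemma mlieBracket_eq_lieBracket {E : Type*} [NormedAddCommGroup E] [NormedSpace ℝ E]
    (V W : ∀ x : E, TangentSpace 𝓘(ℝ, E) x) :
    VectorField.mlieBracket 𝓘(ℝ, E) V W = VectorField.lieBracket ℝ V W := by
  rw [← VectorField.mlieBracketWithin_univ, VectorField.mlieBracketWithin_eq_lieBracketWithin]
  exact VectorField.lieBracketWithin_univ

/-- Coordinate fields are pullbacks of constant fields, and the bracket is natural under pullback.
-/
lemma mlieBracket_coordField (hφ : IsSmoothChart (m := m) φ) (hx : x ∈ φ.source)
    (c d : 𝔼 k × 𝔼 l) :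
    VectorField.mlieBracket (𝓡 m) (coordField m φ c) (coordField m φ d) x = 0 := by
  have hc (c : 𝔼 k × 𝔼 l) : MDifferentiableAt 𝓘(ℝ, 𝔼 k × 𝔼 l) 𝓘(ℝ, 𝔼 k × 𝔼 l).tangent
      (fun z => (⟨z, c⟩ : TangentBundle 𝓘(ℝ, 𝔼 k × 𝔼 l) (𝔼 k × 𝔼 l))) (φ x) :=
    (contMDiffAt_vectorSpace_iff_contDiffAt.2 (contDiffAt_const (n := 1))).mdifferentiableAt
      (by simp)
  have h := VectorField.mpullback_mlieBracket (I := 𝓡 m) (I' := 𝓘(ℝ, 𝔼 k × 𝔼 l)) (n := ∞)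
    (V := fun _ => c) (W := fun _ => d) (hc c) (hc d) (hφ.contMDiffAt hx)
    (by simp; exact WithTop.coe_le_coe.2 le_top)
  refine h.symm.trans ?_
  have h0 : VectorField.mlieBracket 𝓘(ℝ, 𝔼 k × 𝔼 l) (M := 𝔼 k × 𝔼 l) (fun _ => c) (fun _ => d)
      = 0 := by
    exact (mlieBracket_eq_lieBracket _ _).trans (by ext1 z; simp [VectorField.lieBracket]; rfl)
  rw [h0]
  simp

variable {X Y : ∀ x : M, TangentSpace (𝓡 m) x}

/-- The tangent bundle of a foliation is involutive. -/
lemma Foliation.mlieBracket_mem (F : Foliation m k l M) (hX : SmoothNear X x) (hY : SmoothNear Y x)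
    (hXF : ∀ᶠ y in 𝓝 x, X y ∈ F.tangent y) (hYF : ∀ᶠ y in 𝓝 x, Y y ∈ F.tangent y) :
    VectorField.mlieBracket (𝓡 m) X Y x ∈ F.tangent x := by
  obtain ⟨φ, hx, hφ, hT⟩ := F.exists_chart x
  rw [mem_tangent_iff_chartDeriv_snd hφ hT hx]
  -- A field tangent to `F` annihilates the transverse coordinates on a neighbourhood, so both
  -- iterated derivatives in the commutator formula vanish.
  have hz {Z : ∀ x : M, TangentSpace (𝓡 m) x} (hZF : ∀ᶠ y in 𝓝 x, Z y ∈ F.tangent y) (j : Fin l)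
      (w : TangentSpace (𝓡 m) x) :
      mvfderiv (𝓡 m) (fun y => mvfderiv (𝓡 m) (fun z => (φ z).2 j) y (Z y)) x w = 0 := by
    have : (fun y => mvfderiv (𝓡 m) (fun z => (φ z).2 j) y (Z y)) =ᶠ[𝓝 x] fun _ => 0 := by
      filter_upwards [hZF, φ.open_source.mem_nhds hx] with y hy hys
      rw [mvfderiv_snd_chart_apply hφ hys, (mem_tangent_iff_chartDeriv_snd hφ hT hys _).1 hy]
      simp
    rw [mvfderiv_congr this, mvfderiv_const]
    simp
  ext j
  rw [← mvfderiv_snd_chart_apply hφ hx, mvfderiv_mlieBracket hX hY (smoothFunNear_snd_chart hφ hx j),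
    hz hYF, hz hXF]
  simp

variable [RiemannianBundle (fun x : M => TangentSpace (𝓡 m) x)]
  [IsContMDiffRiemannianBundle (𝓡 m) ∞ (𝔼 m) (fun x : M => TangentSpace (𝓡 m) x)]

/-- An orthonormal basis of the tangent space of a leaf extends to a smooth local orthonormal frame
of the foliation. -/
lemma Foliation.exists_frame (F : Foliation m k l M) {r : ℕ} {b : Fin r → TangentSpace (𝓡 m) x}
    (hb : Orthonormal ℝ b) (hbF : ∀ i, b i ∈ F.tangent x) :
    ∃ E : Fin r → ∀ x : M, TangentSpace (𝓡 m) x, (∀ i, SmoothNear (E i) x) ∧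
      (∀ᶠ y in 𝓝 x, Orthonormal ℝ (fun i => E i y)) ∧
      (∀ᶠ y in 𝓝 x, ∀ i, E i y ∈ F.tangent y) ∧ ∀ i, E i x = b i := by
  obtain ⟨φ, hx, hφ, hT⟩ := F.exists_chart x
  obtain ⟨E, hE, hon, hspan, hval⟩ := exists_orthonormal_frame (x := x)
    (S := fun i => coordField m φ (chartDeriv m φ x (b i))) (fun i => smoothNear_coordField hφ hx _)
    (by simpa only [coordField_eq hφ hx] using hb)
  refine ⟨E, hE, hon, ?_, fun i => by rw [hval, coordField_eq hφ hx]⟩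
  filter_upwards [φ.open_source.mem_nhds hx] with y hy i
  refine Submodule.span_le.2 ?_ (hspan y i)
  rintro _ ⟨j, rfl⟩
  simp only [SetLike.mem_coe]
  rw [mem_tangent_iff_chartDeriv_snd hφ hT hy, chartDeriv_coordField hφ hy,
    (mem_tangent_iff_chartDeriv_snd hφ hT hx _).1 (hbF j)]

/-- A local orthonormal frame of a foliation extending a given orthonormal basis of the tangent
space of a leaf, with the corresponding formula for the orthogonal projection. -/
lemma Foliation.exists_orthonormalBasis_frame (F : Foliation m k l M) {r : ℕ}
    (b : OrthonormalBasis (Fin r) ℝ (F.tangent x)) :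
    ∃ E : Fin r → ∀ x : M, TangentSpace (𝓡 m) x, (∀ i, SmoothNear (E i) x) ∧
      (∀ᶠ y in 𝓝 x, Orthonormal ℝ (fun i => E i y)) ∧
      (∀ᶠ y in 𝓝 x, ∀ i, E i y ∈ F.tangent y) ∧ (∀ i, E i x = b i) ∧
      ∀ᶠ y in 𝓝 x, ∀ w : TangentSpace (𝓡 m) y,
        (F.tangent y).starProjection w = ∑ i, inner ℝ (E i y) w • E i y := by
  obtain ⟨E, hE, hon, hmem, hval⟩ := F.exists_frame (b := fun i => (b i : TangentSpace (𝓡 m) x))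
    (b.orthonormal.comp_linearIsometry (F.tangent x).subtypeₗᵢ) (fun i => (b i).2)
  refine ⟨E, hE, hon, hmem, hval, ?_⟩
  filter_upwards [hon, hmem] with y h1 h2 w
  refine starProjection_eq_sum_of_orthonormal _ h1 h2 ?_ w
  rw [F.finrank_tangent y, ← F.finrank_tangent x, Module.finrank_eq_card_basis b.toBasis]
  simp

lemma SmoothNear.tangentPart (F : Foliation m k l M) (hX : SmoothNear X x) :
    SmoothNear (F.tangentPart X) x := by
  obtain ⟨E, hE, -, -, -, hP⟩ := F.exists_orthonormalBasis_frame
    (stdOrthonormalBasis ℝ (F.tangent x))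
  have h : SmoothNear (fun y => ∑ i, Inner.inner ℝ (E i y) (X y) • E i y) x :=
    .sum fun i _ => .smul ((hE i).inner hX) (hE i)
  refine h.congr ?_
  filter_upwards [hP] with y hy using hy _

lemma SmoothNear.normalPart (F : Foliation m k l M) (hX : SmoothNear X x) :
    SmoothNear (F.normalPart X) x :=
  hX.sub (hX.tangentPart F)

omit [IsManifold (𝓡 m) ∞ M]
  [IsContMDiffRiemannianBundle (𝓡 m) ∞ (𝔼 m) (fun x : M => TangentSpace (𝓡 m) x)]

lemma Foliation.tangentPart_mem (F : Foliation m k l M) (X : ∀ x : M, TangentSpace (𝓡 m) x)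
    (y : M) : F.tangentPart X y ∈ F.tangent y :=
  Submodule.starProjection_apply_mem _ _

lemma Foliation.normalPart_mem (F : Foliation m k l M) (X : ∀ x : M, TangentSpace (𝓡 m) x)
    (y : M) : F.normalPart X y ∈ (F.tangent y)ᗮ :=
  Submodule.sub_starProjection_mem_orthogonal _

end Charts

/-! ### Orthogonal complements and linear algebra of orthonormal bases. -/

section Pairs

variable {n p : ℕ} {M : Type*} [TopologicalSpace M] [ChartedSpace (𝔼 (n + p)) M]
  [RiemannianBundle (fun x : M => TangentSpace (𝓡 (n + p)) x)]
  {F : Foliation (n + p) n p M} {G : Foliation (n + p) p n M}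

lemma Orthogonal.eq_orthogonal (h : Orthogonal F G) (x : M) : G.tangent x = (F.tangent x)ᗮ := by
  refine Submodule.eq_of_le_of_finrank_eq (fun v hv => ?_) ?_
  · rw [Submodule.mem_orthogonal]
    exact fun u hu => h x u hu v hv
  · have h1 := Submodule.finrank_add_finrank_orthogonal (F.tangent x)
    have h2 : Module.finrank ℝ (TangentSpace (𝓡 (n + p)) x) = n + p := by
      change Module.finrank ℝ (𝔼 (n + p)) = n + p
      simp
    rw [F.finrank_tangent, h2] at h1
    rw [G.finrank_tangent]
    omega

lemma Orthogonal.symm (h : Orthogonal F G) (x : M) : F.tangent x = (G.tangent x)ᗮ := by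
  rw [h.eq_orthogonal, Submodule.orthogonal_orthogonal]

end Pairs

section InnerProduct

variable {V : Type*} [NormedAddCommGroup V] [InnerProductSpace ℝ V] [FiniteDimensional ℝ V]
  {K : Submodule ℝ V}

lemma exists_orthonormalBasis_coe {r : ℕ} {e : Fin r → V} (he : Orthonormal ℝ e)
    (hmem : ∀ i, e i ∈ K) (hr : Module.finrank ℝ K = r) :
    ∃ b : OrthonormalBasis (Fin r) ℝ K, ∀ i, (b i : V) = e i := by
  have hon : Orthonormal ℝ (fun i => (⟨e i, hmem i⟩ : K)) := by
    rw [← K.subtypeₗᵢ.orthonormal_comp_iff]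
    exact he
  obtain ⟨b, hb⟩ := Orthonormal.exists_orthonormalBasis_extension_of_card_eq (𝕜 := ℝ) (E := K)
    (ι := Fin r) (by simpa using hr) (v := fun i => ⟨e i, hmem i⟩) (s := univ)
    (hon.comp _ Subtype.val_injective)
  exact ⟨b, fun i => by rw [hb i (mem_univ i)]⟩

lemma inner_starProjection_orthogonal (w : V) {ν : V} (hν : ν ∈ Kᗮ) :
    inner ℝ (Kᗮ.starProjection w) ν = inner ℝ w ν := by
  rw [Submodule.inner_starProjection_left_eq_right, Submodule.starProjection_eq_self_iff.2 hν]

lemma inner_starProjection_of_mem (w : V) {u : V} (hu : u ∈ K) :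
    inner ℝ (K.starProjection w) u = inner ℝ w u := by
  rw [Submodule.inner_starProjection_left_eq_right, Submodule.starProjection_eq_self_iff.2 hu]

omit [FiniteDimensional ℝ V] in
lemma eq_of_mem_of_inner_eq {u w : V} (hu : u ∈ K) (hw : w ∈ K)
    (h : ∀ z ∈ K, inner ℝ u z = inner ℝ w z) : u = w := by
  have h0 : inner ℝ (u - w) (u - w) = 0 := by
    rw [inner_sub_left, h _ (K.sub_mem hu hw), sub_self]
  exact sub_eq_zero.1 (inner_self_eq_zero.1 h0)

end InnerProduct

/-! ### Second fundamental form, Weingarten map and mean curvature of a foliation. -/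

section Extrinsic

variable {m k l : ℕ} {M : Type*} [TopologicalSpace M] [ChartedSpace (𝔼 m) M]
  [IsManifold (𝓡 m) ∞ M] [RiemannianBundle (fun x : M => TangentSpace (𝓡 m) x)]
  [IsContMDiffRiemannianBundle (𝓡 m) ∞ (𝔼 m) (fun x : M => TangentSpace (𝓡 m) x)]
  {X Y Z : ∀ x : M, TangentSpace (𝓡 m) x} {x : M} {ν : TangentSpace (𝓡 m) x}

/-- Metric compatibility for a constant inner product: `c = 0` serves orthogonal fields, and the
constants `δᵢⱼ` serve orthonormal frames. -/
lemma inner_nabla_eq_neg (hX : FieldDiffAt X x) (hY : FieldDiffAt Y x) {c : ℝ}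
    (h : ∀ᶠ y in 𝓝 x, inner ℝ (X y) (Y y) = c) (v : TangentSpace (𝓡 m) x) :
    inner ℝ (nabla v X) (Y x) = - inner ℝ (X x) (nabla v Y) := by
  have h1 := mvfderiv_inner hX hY v
  have h2 : (fun y => inner ℝ (X y) (Y y)) =ᶠ[𝓝 x] fun _ => c := h
  rw [mvfderiv_congr h2, mvfderiv_const] at h1
  simp only [zero_apply] at h1
  linarith

omit [IsContMDiffRiemannianBundle (𝓡 m) ∞ (𝔼 m) (fun x : M => TangentSpace (𝓡 m) x)] in
lemma Foliation.normalPart_extend (F : Foliation m k l M) (hν : ν ∈ (F.tangent x)ᗮ) :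
    F.normalPart (extend (𝔼 m) ν) x = ν := by
  rw [Foliation.normalPart, Foliation.tangentPart, extend_apply_self,
    (Submodule.starProjection_apply_eq_zero_iff _).2 hν, sub_zero]

omit [IsContMDiffRiemannianBundle (𝓡 m) ∞ (𝔼 m) (fun x : M => TangentSpace (𝓡 m) x)] in
lemma Foliation.tangentPart_extend (F : Foliation m k l M) (hν : ν ∈ F.tangent x) :
    F.tangentPart (extend (𝔼 m) ν) x = ν := by
  rw [Foliation.tangentPart, extend_apply_self, Submodule.starProjection_eq_self_iff.2 hν]

/-- The second fundamental form computed with any tangent vector field. -/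
lemma Foliation.secondFundamentalForm_eq (F : Foliation m k l M) (hX : FieldDiffAt X x)
    (hXF : ∀ᶠ y in 𝓝 x, X y ∈ F.tangent y) (hν : ν ∈ (F.tangent x)ᗮ) (v : TangentSpace (𝓡 m) x) :
    F.secondFundamentalForm ν v (X x) = inner ℝ (nabla v X) ν := by
  have hN := ((smoothNear_extend ν).normalPart F).mdiff
  have h := inner_nabla_eq_neg (c := 0) hX hN
    (hXF.mono fun y hy => Submodule.inner_right_of_mem_orthogonal hy (F.normalPart_mem _ y)) v
  rw [F.normalPart_extend hν] at h
  rw [h, Foliation.secondFundamentalForm, inner_neg_left, real_inner_comm]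

/-- The second fundamental form computed with any normal vector field. -/
lemma Foliation.secondFundamentalForm_eq_normal (F : Foliation m k l M) (hY : FieldDiffAt Y x)
    (hYF : ∀ᶠ y in 𝓝 x, Y y ∈ (F.tangent y)ᗮ) {w : TangentSpace (𝓡 m) x} (hw : w ∈ F.tangent x)
    (v : TangentSpace (𝓡 m) x) :
    F.secondFundamentalForm (Y x) v w = - inner ℝ (nabla v Y) w := by
  have hW := ((smoothNear_extend w).tangentPart F).mdiff
  have h := inner_nabla_eq_neg (c := 0) hW hY
    (hYF.mono fun y hy => Submodule.inner_right_of_mem_orthogonal (F.tangentPart_mem _ y) hy) v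
  have h2 := F.secondFundamentalForm_eq hW (.of_forall fun y => F.tangentPart_mem _ y)
    hYF.self_of_nhds v
  rw [F.tangentPart_extend hw] at h h2
  rw [h2, h, real_inner_comm]

/-- The Weingarten operator as an endomorphism of the tangent space of the leaf. -/
def Foliation.weingartenMap (F : Foliation m k l M) (ν : TangentSpace (𝓡 m) x) :
    F.tangent x →ₗ[ℝ] F.tangent x where
  toFun v := ⟨F.weingarten ν v, (F.tangent x).neg_mem (Submodule.starProjection_apply_mem _ _)⟩
  map_add' v w := by
    apply Subtype.ext
    simp only [Foliation.weingarten, Submodule.coe_add,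
      nabla_add_dir ((smoothNear_extend ν).normalPart F).mdiff, map_add, neg_add]
  map_smul' c v := by
    apply Subtype.ext
    simp only [Foliation.weingarten, Submodule.coe_smul, RingHom.id_apply,
      nabla_smul_dir ((smoothNear_extend ν).normalPart F).mdiff, map_smul, smul_neg]

lemma Foliation.inner_weingartenMap (F : Foliation m k l M) (ν : TangentSpace (𝓡 m) x)
    (v w : F.tangent x) :
    inner ℝ (F.weingartenMap ν v) w = F.secondFundamentalForm ν v w := by
  change inner ℝ (F.weingarten ν v) (w : TangentSpace (𝓡 m) x) = _
  rw [Foliation.weingarten, inner_neg_left, inner_starProjection_of_mem _ w.2,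
    Foliation.secondFundamentalForm, inner_neg_left]

lemma Foliation.trace_weingartenMap (F : Foliation m k l M) (ν : TangentSpace (𝓡 m) x)
    {ι : Type*} [Fintype ι] (b : OrthonormalBasis ι ℝ (F.tangent x)) :
    LinearMap.trace ℝ _ (F.weingartenMap ν) = ∑ i, F.secondFundamentalForm ν (b i) (b i) := by
  rw [LinearMap.trace_eq_sum_inner _ b]
  refine Finset.sum_congr rfl fun i _ => ?_
  rw [real_inner_comm, F.inner_weingartenMap]

omit [IsContMDiffRiemannianBundle (𝓡 m) ∞ (𝔼 m) (fun x : M => TangentSpace (𝓡 m) x)] in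
lemma Foliation.meanCurvature_mem (F : Foliation m k l M) (x : M) :
    F.meanCurvature x ∈ (F.tangent x)ᗮ :=
  Submodule.smul_mem _ _ (Submodule.starProjection_apply_mem _ _)

/-- Rewriting the mean curvature as a trace frees it from the basis fixed in its definition, so any
orthonormal basis may be used afterwards. -/
lemma Foliation.inner_meanCurvature (F : Foliation m k l M) (hν : ν ∈ (F.tangent x)ᗮ) :
    inner ℝ (F.meanCurvature x) ν = (1 / (k : ℝ)) * LinearMap.trace ℝ _ (F.weingartenMap ν) := by
  rw [Foliation.meanCurvature, real_inner_smul_left, inner_starProjection_orthogonal _ hν,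
    F.trace_weingartenMap ν (stdOrthonormalBasis ℝ (F.tangent x)), sum_inner]
  congr 1
  refine Finset.sum_congr rfl fun i _ => ?_
  rw [← F.secondFundamentalForm_eq ((smoothNear_extend _).tangentPart F).mdiff
    (.of_forall fun y => F.tangentPart_mem _ y) hν,
    F.tangentPart_extend (stdOrthonormalBasis ℝ (F.tangent x) i).2]

lemma Foliation.sum_secondFundamentalForm (F : Foliation m k l M) (hk : 1 ≤ k)
    (hν : ν ∈ (F.tangent x)ᗮ) {ι : Type*} [Fintype ι] (b : OrthonormalBasis ι ℝ (F.tangent x)) :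
    ∑ i, F.secondFundamentalForm ν (b i) (b i) = inner ℝ ((k : ℝ) • F.meanCurvature x) ν := by
  have : (k : ℝ) ≠ 0 := by positivity
  rw [real_inner_smul_left, F.inner_meanCurvature hν, F.trace_weingartenMap ν b]
  field_simp

/-- For totally umbilical leaves, and for curves, the second fundamental form is determined by the
mean curvature vector. -/
lemma Foliation.secondFundamentalForm_of_umbilical (F : Foliation m k l M) (hk : 1 ≤ k)
    (h : 2 ≤ k → F.IsTotallyUmbilical) (hν : ν ∈ (F.tangent x)ᗮ) {v w : TangentSpace (𝓡 m) x}
    (hv : v ∈ F.tangent x) (hw : w ∈ F.tangent x) :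
    F.secondFundamentalForm ν v w = inner ℝ v w * inner ℝ (F.meanCurvature x) ν := by
  have hk' : (k : ℝ) ≠ 0 := by positivity
  have hc : ∃ c : ℝ, F.weingartenMap ν = c • LinearMap.id := by
    -- On a one-dimensional space every endomorphism is a multiple of the identity, so curves need
    -- no umbilicity hypothesis.
    rcases hk.eq_or_lt with hk1 | hk2
    · have h1 : Module.finrank ℝ (F.tangent x) = 1 := by rw [F.finrank_tangent, ← hk1]
      obtain ⟨u, hu0, hu⟩ := finrank_eq_one_iff'.1 h1
      obtain ⟨c, hc⟩ := hu (F.weingartenMap ν u)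
      refine ⟨c, LinearMap.ext fun v => ?_⟩
      obtain ⟨a, rfl⟩ := hu v
      rw [map_smul, ← hc]
      simp [smul_comm a c]
    · obtain ⟨c, hc⟩ := h hk2 x ν hν
      exact ⟨c, LinearMap.ext fun v => Subtype.ext (hc v v.2)⟩
  obtain ⟨c, hc⟩ := hc
  rw [F.inner_meanCurvature hν, ← F.inner_weingartenMap ν ⟨v, hv⟩ ⟨w, hw⟩, hc, map_smul,
    LinearMap.trace_id, F.finrank_tangent, LinearMap.smul_apply, real_inner_smul_left,
    LinearMap.id_apply, smul_eq_mul, Submodule.coe_inner]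
  field_simp

/-- The right-hand side varies smoothly when `E` is a smooth frame, unlike the pointwise choices in
the definition; smoothness of the mean curvature vector rests on this form. -/
lemma Foliation.meanCurvature_eq (F : Foliation m k l M) {r : ℕ}
    {E : Fin r → ∀ x : M, TangentSpace (𝓡 m) x} (hE : ∀ i, FieldDiffAt (E i) x)
    (hEF : ∀ i, ∀ᶠ y in 𝓝 x, E i y ∈ F.tangent y) {b : OrthonormalBasis (Fin r) ℝ (F.tangent x)}
    (hb : ∀ i, (b i : TangentSpace (𝓡 m) x) = E i x) :
    F.meanCurvature x
      = (1 / (k : ℝ)) • F.normalPart (fun y => ∑ i, nabla (E i y) (E i)) x := by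
  refine eq_of_mem_of_inner_eq (F.meanCurvature_mem x)
    (Submodule.smul_mem _ _ (F.normalPart_mem _ x)) fun ν hν => ?_
  rw [F.inner_meanCurvature hν, real_inner_smul_left, F.trace_weingartenMap ν b,
    Foliation.normalPart, inner_sub_left,
    Submodule.inner_right_of_mem_orthogonal (F.tangentPart_mem _ x) hν, sub_zero, sum_inner]
  congr 1
  refine Finset.sum_congr rfl fun i _ => ?_
  rw [hb i, F.secondFundamentalForm_eq (hE i) (hEF i) hν]

lemma Foliation.smoothNear_meanCurvature (F : Foliation m k l M) (x : M) :
    SmoothNear F.meanCurvature x := by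
  obtain ⟨E, hE, hon, hmem, -, -⟩ := F.exists_orthonormalBasis_frame
    (stdOrthonormalBasis ℝ (F.tangent x))
  have h : SmoothNear (fun y => (1 / (k : ℝ)) •
      F.normalPart (fun y => ∑ i, nabla (E i y) (E i)) y) x :=
    .const_smul _ (.normalPart F (.sum fun i _ => (hE i).nabla (hE i)))
  refine h.congr ?_
  filter_upwards [hon, hmem.eventually_nhds, Filter.eventually_all.2 fun i => (hE i).eventually]
    with y h1 h2 h3
  obtain ⟨b, hb⟩ := exists_orthonormalBasis_coe h1 h2.self_of_nhds
    (by rw [F.finrank_tangent, F.finrank_tangent])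
  exact F.meanCurvature_eq (fun i => (h3 i).mdiff) (fun i => h2.mono fun z hz => hz i) hb

end Extrinsic

/-! ### The trace formula for the mixed curvature. -/

section Mixed

variable {m k l : ℕ} {M : Type*} [TopologicalSpace M] [ChartedSpace (𝔼 m) M]
  [IsManifold (𝓡 m) ∞ M] [RiemannianBundle (fun x : M => TangentSpace (𝓡 m) x)]
  [IsContMDiffRiemannianBundle (𝓡 m) ∞ (𝔼 m) (fun x : M => TangentSpace (𝓡 m) x)]
  {E V : ∀ x : M, TangentSpace (𝓡 m) x} {x : M}

omit [IsManifold (𝓡 m) ∞ M] [RiemannianBundle (fun x : M => TangentSpace (𝓡 m) x)]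
  [IsContMDiffRiemannianBundle (𝓡 m) ∞ (𝔼 m) (fun x : M => TangentSpace (𝓡 m) x)] in
lemma mvfderiv_sum_apply {ι : Type} (s : Finset ι) {f : ι → M → ℝ}
    (hf : ∀ i ∈ s, FunDiffAt m (f i) x) (v : TangentSpace (𝓡 m) x) :
    mvfderiv (𝓡 m) (fun y => ∑ i ∈ s, f i y) x v = ∑ i ∈ s, mvfderiv (𝓡 m) (f i) x v := by
  classical
  induction s using Finset.induction_on with
  | empty => simp [mvfderiv_const]
  | insert a s ha h =>
    simp only [Finset.sum_insert ha]
    have hs : FunDiffAt m (fun y => ∑ i ∈ s, f i y) x := by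
      have h := MDifferentiableAt.sum (I := 𝓡 m) (f := f) (t := s) (z := x)
        fun i hi => hf i (by simp [hi])
      rwa [show ∑ i ∈ s, f i = fun y => ∑ i ∈ s, f i y by ext y; simp] at h
    rw [← h fun i hi => hf i (by simp [hi])]
    exact congrArg (fun L : TangentSpace (𝓡 m) x →L[ℝ] ℝ => L v)
      (mvfderiv_add (hf a (by simp)) hs)

/-- The sectional curvature term of two orthogonal vector fields. -/
lemma inner_riem_of_orthogonal (hE : SmoothNear E x) (hV : SmoothNear V x)
    (h : ∀ᶠ y in 𝓝 x, inner ℝ (E y) (V y) = 0) :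
    inner ℝ (riem V E E x) (V x)
      = mvfderiv (𝓡 m) (fun y => inner ℝ (nabla (E y) E) (V y)) x (V x)
        + inner ℝ (E x) (nabla (E x) (fun y => nabla (V y) V))
        + inner ℝ (nabla (V x) E) (nabla (E x) V)
        - inner ℝ (nabla (nabla (V x) E) E) (V x)
        + inner ℝ (nabla (nabla (E x) V) E) (V x) := by
  have hEE := (hE.nabla hE).mdiff
  have hVE := (hV.nabla hE).mdiff
  have hVV := (hV.nabla hV).mdiff
  have h1 : mvfderiv (𝓡 m) (fun y => inner ℝ (nabla (E y) E) (V y)) x (V x) = _ :=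
    mvfderiv_inner hEE hV.mdiff (V x)
  have h2 : mvfderiv (𝓡 m) (fun y => inner ℝ (nabla (V y) E) (V y)) x (E x) = _ :=
    mvfderiv_inner hVE hV.mdiff (E x)
  have h3 : mvfderiv (𝓡 m) (fun y => inner ℝ (-E y) (nabla (V y) V)) x (E x) = _ :=
    mvfderiv_inner hE.mdiff.neg hVV (E x)
  -- Orthogonality trades the derivative of `⟨∇_V E, V⟩` for that of `−⟨E, ∇_V V⟩`. The two terms
  -- `⟨∇_E E, ∇_V V⟩` produced by the product rule then cancel.
  have h4 : (fun y => inner ℝ (nabla (V y) E) (V y))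
      =ᶠ[𝓝 x] fun y => inner ℝ (-E y) (nabla (V y) V) := by
    filter_upwards [hE.eventually, hV.eventually, h.eventually_nhds] with y hy1 hy2 hy3
    rw [inner_nabla_eq_neg hy1.mdiff hy2.mdiff hy3, inner_neg_left]
  rw [mvfderiv_congr h4, h3, nabla_neg hE.mdiff, inner_neg_left, inner_neg_left] at h2
  rw [riem, inner_sub_left, inner_sub_left, ← nabla_sub_nabla hV.mdiff hE.mdiff,
    nabla_sub_dir hE.mdiff, inner_sub_left]
  linarith

/-- The second fundamental form is determined by the mean curvature vector as for umbilical
leaves. -/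
def Foliation.UmbilicalForm (G : Foliation m k l M) : Prop :=
  ∀ y : M, ∀ ν ∈ (G.tangent y)ᗮ, ∀ v ∈ G.tangent y, ∀ w ∈ G.tangent y,
    G.secondFundamentalForm ν v w = inner ℝ v w * inner ℝ (G.meanCurvature y) ν

/-- The sum of the principal curvature vectors. -/
def Foliation.curvatureSum (F : Foliation m k l M) (x : M) : TangentSpace (𝓡 m) x :=
  (k : ℝ) • F.meanCurvature x

lemma Foliation.smoothNear_curvatureSum (F : Foliation m k l M) (x : M) :
    SmoothNear F.curvatureSum x :=
  (F.smoothNear_meanCurvature x).const_smul _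

omit [IsContMDiffRiemannianBundle (𝓡 m) ∞ (𝔼 m) (fun x : M => TangentSpace (𝓡 m) x)] in
lemma Foliation.curvatureSum_mem (F : Foliation m k l M) (x : M) :
    F.curvatureSum x ∈ (F.tangent x)ᗮ :=
  Submodule.smul_mem _ _ (F.meanCurvature_mem x)

/-- The two sides differ by the inner product of `ν` with a bracket of fields tangent to `F`, which
is again tangent by involutivity. -/
lemma Foliation.secondFundamentalForm_comm (F : Foliation m k l M) {v w ν : TangentSpace (𝓡 m) x}
    (hν : ν ∈ (F.tangent x)ᗮ) (hv : v ∈ F.tangent x) (hw : w ∈ F.tangent x) :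
    F.secondFundamentalForm ν v w = F.secondFundamentalForm ν w v := by
  have hV := (smoothNear_extend v).tangentPart F
  have hW := (smoothNear_extend w).tangentPart F
  have hVF : ∀ᶠ y in 𝓝 x, F.tangentPart (extend (𝔼 m) v) y ∈ F.tangent y :=
    .of_forall fun y => F.tangentPart_mem _ y
  have hWF : ∀ᶠ y in 𝓝 x, F.tangentPart (extend (𝔼 m) w) y ∈ F.tangent y :=
    .of_forall fun y => F.tangentPart_mem _ y
  have h1 := F.secondFundamentalForm_eq hV.mdiff hVF hν w
  have h2 := F.secondFundamentalForm_eq hW.mdiff hWF hν v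
  have h3 := nabla_sub_nabla hV.mdiff hW.mdiff
  have h4 := Submodule.inner_right_of_mem_orthogonal (F.mlieBracket_mem hV hW hVF hWF) hν
  rw [F.tangentPart_extend hv] at h1 h3
  rw [F.tangentPart_extend hw] at h2 h3
  rw [← h3, inner_sub_left] at h4
  linarith

end Mixed

section Pairs

variable {n p : ℕ} {M : Type*} [TopologicalSpace M] [ChartedSpace (𝔼 (n + p)) M]
  [IsManifold (𝓡 (n + p)) ∞ M]
  [RiemannianBundle (fun x : M => TangentSpace (𝓡 (n + p)) x)]
  [IsContMDiffRiemannianBundle (𝓡 (n + p)) ∞ (𝔼 (n + p))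
    (fun x : M => TangentSpace (𝓡 (n + p)) x)]
  {F : Foliation (n + p) n p M} {G : Foliation (n + p) p n M}
  {U V : ∀ x : M, TangentSpace (𝓡 (n + p)) x} {x : M}

/-- Fields tangent to `F` are normal to `G`, so umbilicity determines the `G`-part of their
derivative in a `G` direction `u`: it is a multiple of `u`. -/
lemma Foliation.UmbilicalForm.inner_nabla_normal (hU : G.UmbilicalForm) (horth : Orthogonal F G)
    (hX : FieldDiffAt U x) (hXF : ∀ᶠ y in 𝓝 x, U y ∈ F.tangent y)
    {u w : TangentSpace (𝓡 (n + p)) x} (hu : u ∈ G.tangent x) (hw : w ∈ G.tangent x) :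
    inner ℝ (nabla u U) w = - (inner ℝ u w * inner ℝ (G.meanCurvature x) (U x)) := by
  have hXG : ∀ᶠ y in 𝓝 x, U y ∈ (G.tangent y)ᗮ := hXF.mono fun y hy => by rwa [← horth.symm]
  rw [← hU x _ hXG.self_of_nhds u hu w hw, G.secondFundamentalForm_eq_normal hX hXG hw, neg_neg]

lemma Foliation.UmbilicalForm.inner_nabla_tangent (hU : G.UmbilicalForm) (horth : Orthogonal F G)
    (hX : FieldDiffAt V x) (hXG : ∀ᶠ y in 𝓝 x, V y ∈ G.tangent y)
    {u w : TangentSpace (𝓡 (n + p)) x} (hu : u ∈ G.tangent x) (hw : w ∈ F.tangent x) :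
    inner ℝ (nabla u V) w = inner ℝ u (V x) * inner ℝ (G.meanCurvature x) w := by
  have hw' : w ∈ (G.tangent x)ᗮ := by rwa [← horth.symm]
  rw [← hU x _ hw' u hu _ hXG.self_of_nhds, G.secondFundamentalForm_eq hX hXG hw']

omit [IsManifold (𝓡 (n + p)) ∞ M] [IsContMDiffRiemannianBundle (𝓡 (n + p)) ∞ (𝔼 (n + p))
    (fun x : M => TangentSpace (𝓡 (n + p)) x)] in
lemma Foliation.sum_inner_smul (F : Foliation (n + p) n p M) {ι : Type*} [Fintype ι]
    (b : OrthonormalBasis ι ℝ (F.tangent x)) {w : TangentSpace (𝓡 (n + p)) x}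
    (hw : w ∈ F.tangent x) :
    ∑ i, inner ℝ (b i : TangentSpace (𝓡 (n + p)) x) w • (b i : TangentSpace (𝓡 (n + p)) x) = w := by
  have h := congrArg (F.tangent x).subtype (b.sum_repr' ⟨w, hw⟩)
  simpa using h

omit [IsManifold (𝓡 (n + p)) ∞ M] [IsContMDiffRiemannianBundle (𝓡 (n + p)) ∞ (𝔼 (n + p))
    (fun x : M => TangentSpace (𝓡 (n + p)) x)] in
lemma Orthogonal.sub_sum_mem (horth : Orthogonal F G) {ι : Type*} [Fintype ι]
    (b : OrthonormalBasis ι ℝ (F.tangent x)) (w : TangentSpace (𝓡 (n + p)) x) :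
    w - ∑ i, inner ℝ (b i : TangentSpace (𝓡 (n + p)) x) w • (b i : TangentSpace (𝓡 (n + p)) x)
      ∈ G.tangent x := by
  rw [horth.eq_orthogonal]
  have h := F.sum_inner_smul b (Submodule.starProjection_apply_mem (F.tangent x) w)
  simp only [← Submodule.inner_starProjection_left_eq_right,
    Submodule.starProjection_eq_self_iff.2 (b _).2] at h
  rw [h]
  exact Submodule.sub_starProjection_mem_orthogonal _

/-- The part of the mixed curvature that involves the derivatives of the frame algebraically. -/
lemma Foliation.UmbilicalForm.sum_mixed (hU : G.UmbilicalForm) (horth : Orthogonal F G)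
    (hV : FieldDiffAt V x) (hVG : ∀ᶠ y in 𝓝 x, V y ∈ G.tangent y) {ι : Type*} [Fintype ι]
    (b : OrthonormalBasis ι ℝ (F.tangent x)) {E : ι → ∀ x : M, TangentSpace (𝓡 (n + p)) x}
    (hE : ∀ i, FieldDiffAt (E i) x) (hEF : ∀ i, ∀ᶠ y in 𝓝 x, E i y ∈ F.tangent y)
    (hEE : ∀ i j, ∃ c : ℝ, ∀ᶠ y in 𝓝 x, inner ℝ (E i y) (E j y) = c)
    (hb : ∀ i, E i x = b i) :
    ∑ i, (inner ℝ (nabla (V x) (E i)) (nabla (E i x) V)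
        - inner ℝ (nabla (nabla (V x) (E i)) (E i)) (V x)
        + inner ℝ (nabla (nabla (E i x) V) (E i)) (V x))
      = - 2 * inner ℝ (nabla (G.meanCurvature x) V) (V x)
        - ‖V x‖ ^ 2 * ‖G.meanCurvature x‖ ^ 2
        - ∑ i, ∑ j, F.secondFundamentalForm (V x) (b i) (b j) ^ 2 := by
  set h := G.meanCurvature x with hh
  have hhF : h ∈ F.tangent x := by
    rw [horth.symm]
    exact G.meanCurvature_mem x
  have hvG : V x ∈ G.tangent x := hVG.self_of_nhds
  have hvF : V x ∈ (F.tangent x)ᗮ := by rwa [← horth.eq_orthogonal]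
  have hbF (i : ι) : E i x ∈ F.tangent x := (hEF i).self_of_nhds
  set a : ι → ι → ℝ := fun i j => F.secondFundamentalForm (V x) (b i) (b j) with ha
  have hsymm (i j : ι) : a i j = a j i := F.secondFundamentalForm_comm hvF (b i).2 (b j).2
  have ha' (i j : ι) (v : TangentSpace (𝓡 (n + p)) x) (hv : v = b i) :
      inner ℝ (nabla v (E j)) (V x) = a i j := by
    rw [← F.secondFundamentalForm_eq (hE j) (hEF j) hvF, hb, hv]
  have hEV (i : ι) : ∀ᶠ y in 𝓝 x, inner ℝ (E i y) (V y) = 0 := by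
    filter_upwards [hEF i, hVG] with y h1 h2 using horth y _ h1 _ h2
  have hD (i j : ι) : inner ℝ (E j x) (nabla (E i x) V) = - a i j := by
    have := inner_nabla_eq_neg (hE j) hV (hEV j) (E i x)
    rw [ha' i j _ (hb i)] at this
    linarith
  -- The rotation coefficients of the frame along `V`. They are skew because the frame is
  -- orthonormal, whereas `a` is symmetric, so `∑ o i j * a i j` vanishes and the choice of frame
  -- leaves no trace.
  set o : ι → ι → ℝ := fun i j => inner ℝ (E j x) (nabla (V x) (E i)) with ho
  have hskew (i j : ι) : o i j = - o j i := by
    obtain ⟨c, hc⟩ := hEE i j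
    have := inner_nabla_eq_neg (hE i) (hE j) hc (V x)
    rw [real_inner_comm] at this
    exact this
  -- Splitting of `∇_V Eᵢ` along the two foliations; its `G`-part is read off from umbilicity.
  have hC (i : ι) : nabla (V x) (E i)
      = ∑ j, o i j • E j x - inner ℝ (E i x) h • V x := by
    have h1 := horth.sub_sum_mem b (nabla (V x) (E i))
    simp only [← hb] at h1
    have h2 := eq_of_mem_of_inner_eq h1
      ((G.tangent x).neg_mem ((G.tangent x).smul_mem (inner ℝ (E i x) h) hvG)) fun z hz => ?_
    · rw [sub_eq_iff_eq_add] at h2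
      rw [h2]
      abel
    · have h3 : inner ℝ (∑ j, inner ℝ (E j x) (nabla (V x) (E i)) • E j x) z = 0 :=
        horth x _ (Submodule.sum_mem _ fun j _ => Submodule.smul_mem _ _ (hbF j)) z hz
      rw [inner_sub_left, h3, hU.inner_nabla_normal horth (hE i) (hEF i) hvG hz, inner_neg_left,
        real_inner_smul_left, real_inner_comm (E i x)]
      ring
  have hterm (i : ι) : inner ℝ (nabla (V x) (E i)) (nabla (E i x) V)
        - inner ℝ (nabla (nabla (V x) (E i)) (E i)) (V x)
        + inner ℝ (nabla (nabla (E i x) V) (E i)) (V x)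
      = - 2 * (inner ℝ (E i x) h * inner ℝ (nabla (E i x) V) (V x))
        - ‖V x‖ ^ 2 * inner ℝ (E i x) h ^ 2
        - ∑ j, a i j ^ 2 - 2 * ∑ j, o i j * a i j := by
    have t1 : inner ℝ (nabla (V x) (E i)) (nabla (E i x) V)
        = - ∑ j, o i j * a i j - inner ℝ (E i x) h * inner ℝ (nabla (E i x) V) (V x) := by
      rw [hC, inner_sub_left, sum_inner, real_inner_smul_left, real_inner_comm (V x)]
      simp only [real_inner_smul_left, hD, mul_neg, Finset.sum_neg_distrib]
    have t2 : inner ℝ (nabla (nabla (V x) (E i)) (E i)) (V x)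
        = ∑ j, o i j * a i j + ‖V x‖ ^ 2 * inner ℝ (E i x) h ^ 2 := by
      rw [hC, nabla_sub_dir (hE i), nabla_sum_dir _ (hE i), nabla_smul_dir (hE i), inner_sub_left,
        sum_inner, real_inner_smul_left, hU.inner_nabla_normal horth (hE i) (hEF i) hvG hvG,
        real_inner_self_eq_norm_sq, ← hh, real_inner_comm (E i x)]
      simp only [nabla_smul_dir (hE i), real_inner_smul_left, ha' _ i _ (hb _)]
      simp only [hsymm _ i]
      ring
    have t3 : inner ℝ (nabla (nabla (E i x) V) (E i)) (V x)
        = - ∑ j, a i j ^ 2 - inner ℝ (E i x) h * inner ℝ (nabla (E i x) V) (V x) := by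
      -- The `F`-part of `∇_{Eᵢ} V` is `−∑ a i j • E j`. Its `G`-part is not known, but umbilicity
      -- only involves the inner product of that part with `V x`.
      have h1 := horth.sub_sum_mem b (nabla (E i x) V)
      simp only [← hb, hD] at h1
      have h2 := hU.inner_nabla_normal horth (hE i) (hEF i) h1 hvG
      rw [nabla_sub_dir (hE i), nabla_sum_dir _ (hE i), inner_sub_left, sum_inner, inner_sub_left,
        horth x _ (Submodule.sum_mem _ fun j _ => Submodule.smul_mem _ _ (hbF j)) _ hvG,
        ← hh, real_inner_comm (E i x)] at h2
      simp only [nabla_smul_dir (hE i), real_inner_smul_left, ha' _ i _ (hb _)] at h2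
      simp only [hsymm _ i, neg_mul, Finset.sum_neg_distrib, ← pow_two] at h2
      linarith
    rw [t1, t2, t3]
    ring
  have ho0 : ∑ i, ∑ j, o i j * a i j = 0 := by
    have : ∑ i, ∑ j, o i j * a i j = - ∑ i, ∑ j, o i j * a i j := by
      conv_lhs => rw [Finset.sum_comm]
      rw [← Finset.sum_neg_distrib]
      refine Finset.sum_congr rfl fun i _ => ?_
      rw [← Finset.sum_neg_distrib]
      refine Finset.sum_congr rfl fun j _ => ?_
      rw [hskew, hsymm]
      ring
    linarith
  have hsum : ∑ i, inner ℝ (E i x) h • E i x = h := by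
    simp only [hb]
    exact F.sum_inner_smul b hhF
  have hs1 : ∑ i, inner ℝ (E i x) h * inner ℝ (nabla (E i x) V) (V x)
      = inner ℝ (nabla h V) (V x) := by
    conv_rhs => rw [← hsum, nabla_sum_dir _ hV, sum_inner]
    refine Finset.sum_congr rfl fun i _ => ?_
    rw [nabla_smul_dir hV, real_inner_smul_left]
  have hs2 : ∑ i, inner ℝ (E i x) h ^ 2 = ‖h‖ ^ 2 := by
    rw [← real_inner_self_eq_norm_sq]
    conv_rhs => rw [← hsum, sum_inner]
    refine Finset.sum_congr rfl fun i _ => ?_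
    rw [real_inner_smul_left, hsum, pow_two]
  rw [Finset.sum_congr rfl fun i _ => hterm i]
  simp only [Finset.sum_sub_distrib, ← Finset.mul_sum]
  rw [hs1, hs2, ho0]
  ring

set_option maxHeartbeats 1000000 in
/-- The trace of the mixed curvature in terms of the extrinsic geometry of the two foliations. -/
lemma Foliation.UmbilicalForm.curvatureTrace_eq (hU : G.UmbilicalForm) (horth : Orthogonal F G)
    (hn : 1 ≤ n) {v : TangentSpace (𝓡 (n + p)) x} (hv : v ∈ G.tangent x) :
    F.curvatureTrace v = inner ℝ (nabla v F.curvatureSum) v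
      + ‖v‖ ^ 2 * (F.divergence G.meanCurvature x - ‖G.meanCurvature x‖ ^ 2)
      - ∑ i, ∑ j, F.secondFundamentalForm v (stdOrthonormalBasis ℝ (F.tangent x) i)
          (stdOrthonormalBasis ℝ (F.tangent x) j) ^ 2 := by
  set b := stdOrthonormalBasis ℝ (F.tangent x)
  obtain ⟨E, hE, hon, hEF', hb, -⟩ := F.exists_orthonormalBasis_frame b
  have hEF : ∀ i, ∀ᶠ y in 𝓝 x, E i y ∈ F.tangent y := fun i => hEF'.mono fun y hy => hy i
  have hvF : v ∈ (F.tangent x)ᗮ := by rwa [← horth.eq_orthogonal]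
  obtain ⟨V, hV, hVG, hVx⟩ : ∃ V : ∀ x : M, TangentSpace (𝓡 (n + p)) x, SmoothNear V x ∧
      (∀ᶠ y in 𝓝 x, V y ∈ G.tangent y) ∧ V x = v := by
    refine ⟨F.normalPart (extend (𝔼 (n + p)) v), (smoothNear_extend v).normalPart F,
      .of_forall fun y => ?_, F.normalPart_extend hvF⟩
    rw [horth.eq_orthogonal]
    exact F.normalPart_mem _ y
  subst hVx
  have hEV (i) : ∀ᶠ y in 𝓝 x, inner ℝ (E i y) (V y) = 0 := by
    filter_upwards [hEF i, hVG] with y h1 h2 using horth y _ h1 _ h2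
  have hK : F.curvatureTrace (V x) = ∑ i, inner ℝ (riem V (E i) (E i) x) (V x) := by
    refine Finset.sum_congr rfl fun i _ => ?_
    rw [← curvature_eq hV (hE i) (hE i), hb]
  have hξ : SmoothNear F.curvatureSum x := F.smoothNear_curvatureSum x
  have hh : SmoothNear G.meanCurvature x := G.smoothNear_meanCurvature x
  have hVV : SmoothNear (fun y => nabla (V y) V) x := hV.nabla hV
  -- Needed on a neighbourhood, since this identity is differentiated along `V` in `S1`.
  have hsumξ : ∀ᶠ y in 𝓝 x, ∀ w ∈ G.tangent y,
      ∑ i, inner ℝ (nabla (E i y) (E i)) w = inner ℝ (F.curvatureSum y) w := by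
    filter_upwards [hon, hEF'.eventually_nhds,
      Filter.eventually_all.2 fun i => (hE i).eventually] with y h1 h2 h3 w hw
    obtain ⟨c, hc⟩ := exists_orthonormalBasis_coe h1 h2.self_of_nhds
      (by rw [F.finrank_tangent, F.finrank_tangent])
    have hw' : w ∈ (F.tangent y)ᗮ := by rwa [← horth.eq_orthogonal]
    rw [Foliation.curvatureSum, ← F.sum_secondFundamentalForm hn hw' c]
    refine Finset.sum_congr rfl fun i _ => ?_
    rw [hc, F.secondFundamentalForm_eq (h3 i).mdiff (h2.mono fun z hz => hz i) hw']
  have S1 : ∑ i, mvfderiv (𝓡 (n + p)) (fun y => inner ℝ (nabla (E i y) (E i)) (V y)) x (V x)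
      = inner ℝ (nabla (V x) F.curvatureSum) (V x)
        + inner ℝ (F.curvatureSum x) (nabla (V x) V) := by
    rw [← mvfderiv_inner hξ.mdiff hV.mdiff,
      ← mvfderiv_sum_apply _ fun i _ => ((hE i).nabla (hE i)).mdiff.inner hV.mdiff]
    refine mvfderiv_congr ?_ _
    filter_upwards [hsumξ, hVG] with y h1 h2 using h1 _ h2
  -- By umbilicity the `F`-part of `∇_V V` is `|V|² h`. Its divergence along `F` yields the term
  -- `div_F h`, while the `G`-part `W` contributes only through `ξ`.
  obtain ⟨W, hW, hWG, hWeq⟩ : ∃ W : ∀ x : M, TangentSpace (𝓡 (n + p)) x, SmoothNear W x ∧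
      (∀ᶠ y in 𝓝 x, W y ∈ G.tangent y) ∧
      ∀ y, nabla (V y) V = inner ℝ (V y) (V y) • G.meanCurvature y + W y := by
    refine ⟨fun y => nabla (V y) V - inner ℝ (V y) (V y) • G.meanCurvature y,
      hVV.sub (.smul (hV.inner hV) hh), ?_, fun y => (add_sub_cancel _ _).symm⟩
    filter_upwards [hV.eventually, hVG.eventually_nhds] with y h1 h2
    rw [horth.eq_orthogonal, Submodule.mem_orthogonal']
    intro u hu
    rw [inner_sub_left, real_inner_smul_left,
      hU.inner_nabla_tangent horth h1.mdiff h2 h2.self_of_nhds hu, sub_self]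
  have S2 : ∑ i, inner ℝ (E i x) (nabla (E i x) (fun y => nabla (V y) V))
      = 2 * inner ℝ (nabla (G.meanCurvature x) V) (V x)
        + ‖V x‖ ^ 2 * F.divergence G.meanCurvature x
        - inner ℝ (F.curvatureSum x) (nabla (V x) V) := by
    have hterm (i) : inner ℝ (E i x) (nabla (E i x) (fun y => nabla (V y) V))
        = 2 * (inner ℝ (E i x) (G.meanCurvature x) * inner ℝ (nabla (E i x) V) (V x))
          + ‖V x‖ ^ 2 * inner ℝ (E i x) (nabla (E i x) G.meanCurvature)
          - inner ℝ (nabla (E i x) (E i)) (W x) := by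
      have hEW : ∀ᶠ y in 𝓝 x, inner ℝ (E i y) (W y) = 0 := by
        filter_upwards [hEF i, hWG] with y h1 h2 using horth y _ h1 _ h2
      rw [nabla_congr (.of_forall hWeq), nabla_add
        (Y := fun y => inner ℝ (V y) (V y) • G.meanCurvature y)
        (SmoothNear.smul (hV.inner hV) hh).mdiff hW.mdiff,
        nabla_smul (hV.inner hV).mdiff hh.mdiff, mvfderiv_inner hV.mdiff hV.mdiff, inner_add_right,
        inner_add_right, real_inner_smul_right, real_inner_smul_right,
        inner_nabla_eq_neg (hE i).mdiff hW.mdiff hEW, real_inner_self_eq_norm_sq,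
        real_inner_comm (nabla (E i x) V)]
      ring
    have hdiv : F.divergence G.meanCurvature x
        = ∑ i, inner ℝ (E i x) (nabla (E i x) G.meanCurvature) := by
      simp only [hb]
      rfl
    have hhF : G.meanCurvature x ∈ F.tangent x := by
      rw [horth.symm]
      exact G.meanCurvature_mem x
    have hs : ∑ i, inner ℝ (E i x) (G.meanCurvature x) * inner ℝ (nabla (E i x) V) (V x)
        = inner ℝ (nabla (G.meanCurvature x) V) (V x) := by
      conv_rhs => rw [← F.sum_inner_smul b hhF, nabla_sum_dir _ hV.mdiff, sum_inner]
      refine Finset.sum_congr rfl fun i _ => ?_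
      rw [nabla_smul_dir hV.mdiff, real_inner_smul_left, hb]
    have hξW : inner ℝ (F.curvatureSum x) (nabla (V x) V)
        = inner ℝ (F.curvatureSum x) (W x) := by
      have h0 : inner ℝ (F.curvatureSum x) (G.meanCurvature x) = 0 :=
        Submodule.inner_left_of_mem_orthogonal hhF (F.curvatureSum_mem x)
      rw [hWeq, inner_add_right, real_inner_smul_right, h0, mul_zero, zero_add]
    rw [Finset.sum_congr rfl fun i _ => hterm i, Finset.sum_sub_distrib, Finset.sum_add_distrib,
      ← Finset.mul_sum, ← Finset.mul_sum, hs, ← hdiv, hsumξ.self_of_nhds _ hWG.self_of_nhds, hξW]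
  have S3 := hU.sum_mixed horth hV.mdiff hVG b (fun i => (hE i).mdiff) hEF (fun i j => by
    classical
    exact ⟨_, hon.mono fun y hy => orthonormal_iff_ite.1 hy i j⟩) hb
  -- In the total, `⟨ξ, ∇_V V⟩` cancels between `S1` and `S2`, and `2⟨∇_h V, V⟩` between `S2` and
  -- `S3`.
  rw [hK, Finset.sum_congr rfl fun i _ => inner_riem_of_orthogonal (hE i) hV (hEV i)]
  simp only [add_sub_assoc, add_assoc] at S3 ⊢
  rw [Finset.sum_add_distrib, Finset.sum_add_distrib, S1, S2, S3]
  ring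

end Pairs

/-! ### The descent principle on complete spaces. -/

section Caristi

open Filter

/-- A form of Caristi's fixed point theorem: on a complete space there is no set on which a
nonnegative function can always be decreased at a rate bounded below by the distance travelled. -/
lemma eq_empty_of_descent {M : Type*} [EMetricSpace M] [CompleteSpace M] {T : Set M} {u : M → ℝ}
    {C : ℝ} (hC : 0 ≤ C) (hu0 : ∀ x, 0 ≤ u x) (hu : ∀ x ∈ T, ContinuousAt u x)
    (hT : ∀ (s : ℕ → M) (c : ℝ) (y : M), (∀ k, s k ∈ T) → (∀ k, u (s k) ≤ c) →
      Tendsto s atTop (𝓝 y) → y ∈ T)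
    (hstep : ∀ x ∈ T, ∃ y ∈ T, edist x y ≤ ENNReal.ofReal (C * (u x - u y)) ∧ u y < u x) :
    T = ∅ := by
  by_contra hne
  obtain ⟨x₀, hx₀⟩ := nonempty_iff_ne_empty.2 hne
  -- The Caristi relation: `y` is reached from `x` at a distance paid for by the decrease of `u`. It
  -- is transitive, and `I x` below is the infimum of `u` over the points reachable from `x`.
  let R : M → M → Prop := fun x y =>
    y ∈ T ∧ edist x y ≤ ENNReal.ofReal (C * (u x - u y)) ∧ u y ≤ u x
  have hrefl {x : M} (hx : x ∈ T) : R x x := ⟨hx, by simp, le_rfl⟩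
  have htrans {x y z : M} (h1 : R x y) (h2 : R y z) : R x z := by
    refine ⟨h2.1, (edist_triangle x y z).trans ((add_le_add h1.2.1 h2.2.1).trans ?_),
      h2.2.2.trans h1.2.2⟩
    rw [← ENNReal.ofReal_add (mul_nonneg hC (sub_nonneg.2 h1.2.2))
      (mul_nonneg hC (sub_nonneg.2 h2.2.2))]
    exact ENNReal.ofReal_le_ofReal (by linarith)
  let I : M → ℝ := fun x => sInf (u '' {y | R x y})
  have hbdd (x : M) : BddBelow (u '' {y | R x y}) := ⟨0, by rintro _ ⟨y, -, rfl⟩; exact hu0 y⟩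
  have hI {x y : M} (h : R x y) : I x ≤ u y := csInf_le (hbdd x) ⟨y, h, rfl⟩
  -- Every step goes at least half of the way from `u x` down to the infimum `I x`.
  have hnext (x : T) : ∃ y : T, R x y ∧ u y ≤ (u x + I x) / 2 := by
    obtain ⟨y, hy, hd, hlt⟩ := hstep x x.2
    have h1 : I x < (u x + I x) / 2 := by
      have : I x ≤ u y := hI ⟨hy, hd, hlt.le⟩
      linarith
    obtain ⟨_, ⟨z, hz, rfl⟩, hz'⟩ := exists_lt_of_csInf_lt (s := u '' {y | R x y})
      ⟨u x, x, hrefl x.2, rfl⟩ h1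
    exact ⟨⟨z, hz.1⟩, hz, hz'.le⟩
  choose f hf1 hf2 using hnext
  let s : ℕ → T := fun k => f^[k] ⟨x₀, hx₀⟩
  have hs (k : ℕ) : s (k + 1) = f (s k) := Function.iterate_succ_apply' f k _
  have hR {j k : ℕ} (h : j ≤ k) : R (s j) (s k) := by
    induction k, h using Nat.le_induction with
    | base => exact hrefl (s j).2
    | succ k _ ih => exact htrans ih (hs k ▸ hf1 (s k))
  have hanti : Antitone fun k => u (s k) := fun j k h => (hR h).2.2
  have hub : BddBelow (range fun k => u (s k)) := ⟨0, by rintro _ ⟨y, rfl⟩; exact hu0 _⟩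
  have hlim := tendsto_atTop_ciInf hanti hub
  set ℓ := ⨅ k, u (s k)
  have hℓ (k : ℕ) : ℓ ≤ u (s k) := ciInf_le hub k
  have hcauchy : CauchySeq fun k => (s k : M) := by
    refine EMetric.cauchySeq_iff_le_tendsto_0.2
      ⟨fun N => ENNReal.ofReal (C * (u (s N) - ℓ)), fun j k N hj hk => ?_, ?_⟩
    · wlog hjk : j ≤ k generalizing j k
      · rw [edist_comm]
        exact this k j hk hj (le_of_not_ge hjk)
      · refine (hR hjk).2.1.trans (ENNReal.ofReal_le_ofReal ?_)
        have h1 := hanti hj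
        have h2 := hℓ k
        exact mul_le_mul_of_nonneg_left (by simp only at h1; linarith) hC
    · have : Tendsto (fun N => C * (u (s N) - ℓ)) atTop (𝓝 (C * (ℓ - ℓ))) :=
        (hlim.sub_const ℓ).const_mul C
      rw [sub_self, mul_zero] at this
      simpa using ENNReal.tendsto_ofReal this
  obtain ⟨y, hy⟩ := cauchySeq_tendsto_of_complete hcauchy
  -- The sequence has `u` bounded by its first value, which is what the closedness hypothesis asks
  -- for.
  have hyT : y ∈ T := hT _ (u (s 0)) y (fun k => (s k).2) (fun k => hanti (Nat.zero_le k)) hy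
  have huy : Tendsto (fun k => u (s k)) atTop (𝓝 (u y)) := (hu y hyT).tendsto.comp hy
  have hℓy : ℓ = u y := tendsto_nhds_unique hlim huy
  have hRy (j : ℕ) : R (s j) y := by
    refine ⟨hyT, ?_, hℓy ▸ hℓ j⟩
    have h1 : Tendsto (fun k => edist (s j : M) (s k)) atTop (𝓝 (edist (s j : M) y)) :=
      tendsto_const_nhds.edist hy
    have h2 : Tendsto (fun k => ENNReal.ofReal (C * (u (s j) - u (s k)))) atTop
        (𝓝 (ENNReal.ofReal (C * (u (s j) - u y)))) :=
      ENNReal.tendsto_ofReal ((huy.const_sub _).const_mul C)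
    exact le_of_tendsto_of_tendsto h1 h2 (eventually_atTop.2 ⟨j, fun k hk => (hR hk).2.1⟩)
  obtain ⟨z, hz, hd, hlt⟩ := hstep y hyT
  -- The point `z` below the limit `y` is reachable from every `s k`, so the half-way rule applies
  -- to it; in the limit `u y ≤ u z`, contradicting `u z < u y`.
  have hle (k : ℕ) : u (s (k + 1)) ≤ (u (s k) + u z) / 2 := by
    have h1 := hf2 (s k)
    have h2 := hI (htrans (hRy k) ⟨hz, hd, hlt.le⟩)
    rw [hs]
    linarith
  have := le_of_tendsto_of_tendsto' (huy.comp (tendsto_add_atTop_nat 1))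
    ((huy.add_const (u z)).div_const 2) hle
  linarith

end Caristi

/-! ### Coordinate lines in plaques and saturated sets. -/

section Plaques

variable {m k l : ℕ} {M : Type*} [TopologicalSpace M] [ChartedSpace (𝔼 m) M]
  {φ : OpenPartialHomeomorph M (𝔼 k × 𝔼 l)} {x y : M}

/-- The curve with constant velocity `w` in the coordinates `φ`. -/
def coordLine (φ : OpenPartialHomeomorph M (𝔼 k × 𝔼 l)) (z w : 𝔼 k × 𝔼 l) (t : ℝ) : M :=
  φ.symm (z + t • w)

lemma contMDiffAt_coordLine (hφ : IsSmoothChart (m := m) φ) {z w : 𝔼 k × 𝔼 l} {t : ℝ}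
    (ht : z + t • w ∈ φ.target) : ContMDiffAt 𝓘(ℝ) (𝓡 m) ∞ (coordLine φ z w) t := by
  have h : ContDiff ℝ ∞ (fun t : ℝ => z + t • w) := by fun_prop
  exact ContMDiffAt.comp t (hφ.contMDiffAt_symm ht) h.contMDiff.contMDiffAt

lemma chartDerivSymm_eq_coordField (hφ : IsSmoothChart (m := m) φ) {z : 𝔼 k × 𝔼 l}
    (hz : z ∈ φ.target) (w : 𝔼 k × 𝔼 l) :
    chartDerivSymm m φ z w = coordField m φ w (φ.symm z) :=
  (chartDeriv_bijective hφ (φ.map_target hz)).1 ((chartDeriv_comp_chartDerivSymm hφ hz w).trans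
    (chartDeriv_coordField hφ (φ.map_target hz) w).symm)

lemma hasMFDerivAt_coordLine (hφ : IsSmoothChart (m := m) φ) {z w : 𝔼 k × 𝔼 l} {t : ℝ}
    (ht : z + t • w ∈ φ.target) :
    HasMFDerivAt 𝓘(ℝ) (𝓡 m) (coordLine φ z w) t
      (ContinuousLinearMap.toSpanSingleton ℝ
        (coordField m φ w (coordLine φ z w t) : TangentSpace (𝓡 m) (coordLine φ z w t)) :
        ℝ →L[ℝ] TangentSpace (𝓡 m) (coordLine φ z w t)) := by
  have h : HasDerivAt (fun t : ℝ => z + t • w) w t := by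
    simpa using ((hasDerivAt_id t).smul_const w).const_add z
  have h1 : HasMFDerivAt 𝓘(ℝ) (𝓡 m) (coordLine φ z w) t _ :=
    (hφ.mdifferentiableAt_symm ht).hasMFDerivAt.comp t h.hasFDerivAt.hasMFDerivAt
  have h2 : chartDerivSymm m φ (z + t • w) w = coordField m φ w (coordLine φ z w t) :=
    chartDerivSymm_eq_coordField hφ ht w
  rw [← h2]
  refine h1.congr_mfderiv (ContinuousLinearMap.ext_ring ?_)
  symm
  change (1 : ℝ) • chartDerivSymm m φ (z + t • w) w
    = chartDerivSymm m φ (z + t • w) ((1 : ℝ) • w)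
  rw [one_smul, one_smul]

lemma joinedByTangentCurve_of_segment {T : Distribution m M} (hφ : IsSmoothChart (m := m) φ)
    {z w : 𝔼 k × 𝔼 l} (hseg : ∀ t ∈ Icc (0 : ℝ) 1, z + t • w ∈ φ.target)
    (hT : ∀ y ∈ φ.source, coordField m φ w y ∈ T y) :
    JoinedByTangentCurve T (φ.symm z) (φ.symm (z + w)) := by
  refine ⟨coordLine φ z w, 0, 1, zero_le_one, fun t ht =>
    ((contMDiffAt_coordLine hφ (hseg t ht)).of_le (by simp)).contMDiffWithinAt, fun t ht => ?_,
    by simp [coordLine], by simp [coordLine]⟩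
  have h := hasMFDerivAt_coordLine hφ (hseg t ht)
  rw [(h.hasMFDerivWithinAt).mfderivWithin 
    (uniqueMDiffOn_iff_uniqueDiffOn.2 (uniqueDiffOn_Icc zero_lt_one) t ht)]
  change (1 : ℝ) • coordField m φ w (coordLine φ z w t) ∈ _
  rw [one_smul]
  exact hT _ (φ.map_target (hseg t ht))

/-- The set `S` is a union of leaves. -/
def Foliation.Saturated (F : Foliation m k l M) (S : Set M) : Prop :=
  ∀ x ∈ S, ∀ y, JoinedByTangentCurve F.tangent x y → y ∈ S

lemma Foliation.IsLeaf.saturated {F : Foliation m k l M} {S : Set M} (hS : F.IsLeaf S) :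
    F.Saturated S := by
  obtain ⟨x, rfl⟩ := hS
  exact fun y hy z hz => Relation.ReflTransGen.tail hy hz

/-- Leaves need not be closed, while the descent needs a closed set. Points of `S` close to `x` can
be moved inside their own plaques without leaving `S`; letting them tend to `x` puts the plaque
through `x` into the closure. -/
lemma Foliation.Saturated.coordLine_mem_closure {F : Foliation m k l M} {S : Set M}
    (hS : F.Saturated S) (hφ : IsSmoothChart (m := m) φ) (hT : TangentToFstSlices F.tangent φ)
    (hx : x ∈ φ.source) (hxS : x ∈ closure S) {w : 𝔼 k × 𝔼 l} (hw : w.2 = 0) :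
    ∀ᶠ t : ℝ in 𝓝 0, φ x + t • w ∈ φ.target ∧ coordLine φ (φ x) w t ∈ closure S := by
  obtain ⟨r, hr, hball⟩ := Metric.isOpen_iff.1 φ.open_target _ (φ.map_source hx)
  have hcont : Filter.Tendsto (fun t : ℝ => φ x + t • w) (𝓝 0) (𝓝 (φ x)) :=
    Continuous.tendsto' (by fun_prop) _ _ (by simp)
  filter_upwards [hcont (Metric.ball_mem_nhds _ hr)] with t ht
  have ht' : φ x + t • w ∈ Metric.ball (φ x) r := ht
  refine ⟨hball ht', ?_⟩
  -- `q y` has the transverse coordinate of `y`, so the segment from `φ y` to `q y` lies in a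
  -- plaque; for `y = x` it ends at `φ x + t • w` because `w.2 = 0`. The convex ball keeps the
  -- segments inside the target.
  set q : M → 𝔼 k × 𝔼 l := fun y => ((φ x + t • w).1, (φ y).2) with hq
  have hqc : ContinuousAt q x := by
    have := φ.continuousAt hx
    fun_prop
  have hqx : q x = φ x + t • w := by
    ext1
    · rfl
    · simp [hq, hw]
  have hsymm : ContinuousAt (fun y => φ.symm (q y)) x := by
    refine ContinuousAt.comp (f := q) ?_ hqc
    rw [hqx]
    exact φ.continuousAt_symm (hball ht')
  have hev : ∀ᶠ y in 𝓝 x, y ∈ S → φ.symm (q y) ∈ S := by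
    filter_upwards [φ.open_source.mem_nhds hx, φ.continuousAt hx (Metric.ball_mem_nhds _ hr),
      hqc.preimage_mem_nhds (hqx ▸ Metric.isOpen_ball.mem_nhds ht')] with y hy1 hy2 hy3 hyS
    have hv : (q y - φ y).2 = 0 := by simp [hq]
    have := joinedByTangentCurve_of_segment (T := F.tangent) hφ (z := φ y) (w := q y - φ y)
      (fun s hs => hball ((convex_ball (φ x) r).add_smul_sub_mem hy2 hy3 hs)) (fun y' hy' => by
        rw [mem_tangent_iff_chartDeriv_snd hφ hT hy', chartDeriv_coordField hφ hy', hv])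
    rw [φ.left_inv hy1, add_sub_cancel] at this
    exact hS y hyS _ this
  have : coordLine φ (φ x) w t = φ.symm (q x) := by rw [hqx]; rfl
  rw [this]
  rw [mem_closure_iff_frequently] at hxS
  refine mem_closure_of_frequently_of_tendsto ?_ hsymm.tendsto
  exact (hxS.and_eventually hev).mono fun y hy => hy.2 hy.1

lemma coordLine_zero (hx : x ∈ φ.source) (w : 𝔼 k × 𝔼 l) : coordLine φ (φ x) w 0 = x := by
  simp [coordLine, φ.left_inv hx]

lemma hasDerivAt_comp_coordLine (hφ : IsSmoothChart (m := m) φ) {z w : 𝔼 k × 𝔼 l} {t : ℝ}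
    (ht : z + t • w ∈ φ.target) {f : M → ℝ} (hf : FunDiffAt m f (coordLine φ z w t)) :
    HasDerivAt (fun t => f (coordLine φ z w t))
      (mvfderiv (𝓡 m) f (coordLine φ z w t) (coordField m φ w (coordLine φ z w t))) t := by
  have h1 := hasMFDerivAt_coordLine (m := m) hφ ht
  have h2 : HasMFDerivAt 𝓘(ℝ) 𝓘(ℝ) (fun t => f (coordLine φ z w t)) t _ :=
    (MDifferentiableAt.hasMFDerivAt hf).comp t h1
  have h3 := hasMFDerivAt_iff_hasFDerivAt.1 h2
  refine hasDerivAt_iff_hasFDerivAt.2 (h3.congr_fderiv (ContinuousLinearMap.ext_ring ?_))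
  change mfderiv (𝓡 m) 𝓘(ℝ) f (coordLine φ z w t)
    ((1 : ℝ) • coordField m φ w (coordLine φ z w t)) = _
  rw [one_smul]
  exact (one_smul ℝ _).symm

lemma hasDerivAt_comp_coordLine_zero (hφ : IsSmoothChart (m := m) φ) (hx : x ∈ φ.source)
    {f : M → ℝ} (hf : FunDiffAt m f x) (w : 𝔼 k × 𝔼 l) :
    HasDerivAt (fun t => f (coordLine φ (φ x) w t)) (mvfderiv (𝓡 m) f x (coordField m φ w x)) 0 := by
  have h0 := coordLine_zero hx w
  have ht : φ x + (0 : ℝ) • w ∈ φ.target := by simpa using φ.map_source hx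
  have hf' : FunDiffAt m f (coordLine φ (φ x) w 0) := by rwa [h0]
  have h := hasDerivAt_comp_coordLine hφ ht hf'
  rwa [h0] at h

lemma SmoothFunNear.continuousAt {f : M → ℝ} (hf : SmoothFunNear m f x) : ContinuousAt f x :=
  hf.contMDiffAt.continuousAt

end Plaques

/-! ### Riemannian distance along coordinate lines. -/

section Distance

variable {m k l : ℕ} {M : Type*} [EMetricSpace M] [ChartedSpace (𝔼 m) M]
  {φ : OpenPartialHomeomorph M (𝔼 k × 𝔼 l)} {x y : M}
  [IsManifold (𝓡 m) ∞ M] [RiemannianBundle (fun x : M => TangentSpace (𝓡 m) x)]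
  [IsContMDiffRiemannianBundle (𝓡 m) ∞ (𝔼 m) (fun x : M => TangentSpace (𝓡 m) x)]
  [IsRiemannianManifold (𝓡 m) M]

/-- By continuity the speed of the coordinate line stays below `C` for small times, and the distance
is at most the length. -/
lemma eventually_edist_coordLine_le (hφ : IsSmoothChart (m := m) φ) (hx : x ∈ φ.source)
    {w : 𝔼 k × 𝔼 l} {C : ℝ} (hC : ‖coordField m φ w x‖ < C) :
    ∀ᶠ t : ℝ in 𝓝[>] 0, edist x (coordLine φ (φ x) w t) ≤ ENNReal.ofReal (C * t) := by
  have h0 := coordLine_zero hx w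
  have hX := smoothNear_coordField (m := m) hφ hx w
  have hcont : ContinuousAt (coordLine φ (φ x) w) 0 :=
    (contMDiffAt_coordLine (m := m) hφ (by simpa using φ.map_source hx)).continuousAt
  have hnorm : ∀ᶠ y in 𝓝 x, ‖coordField m φ w y‖ < C := by
    have h1 : ContinuousAt (fun y => inner ℝ (coordField m φ w y) (coordField m φ w y)) x :=
      (hX.inner hX).continuousAt
    have hC0 : 0 ≤ C := (norm_nonneg _).trans hC.le
    have h2 : inner ℝ (coordField m φ w x) (coordField m φ w x) < C ^ 2 := by
      rw [real_inner_self_eq_norm_sq]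
      exact pow_lt_pow_left₀ hC (norm_nonneg _) two_ne_zero
    filter_upwards [h1.eventually (gt_mem_nhds h2)] with y hy
    rw [real_inner_self_eq_norm_sq] at hy
    exact lt_of_pow_lt_pow_left₀ 2 hC0 hy
  have htar : ∀ᶠ t : ℝ in 𝓝 0, φ x + t • w ∈ φ.target := by
    have : ContinuousAt (fun t : ℝ => φ x + t • w) 0 := by fun_prop
    exact this.eventually (φ.open_target.mem_nhds (by simpa using φ.map_source hx))
  have hboth := htar.and (hcont.eventually (by rwa [h0]))
  obtain ⟨ε, hε, hball⟩ := Metric.eventually_nhds_iff.1 hboth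
  filter_upwards [Ioo_mem_nhdsGT hε] with t ht
  have hI {s : ℝ} (hs : s ∈ Icc 0 t) := hball (y := s) (by
    rw [dist_zero_right, Real.norm_eq_abs, abs_of_nonneg hs.1]
    exact hs.2.trans_lt ht.2)
  rw [IsRiemannianManifold.out (I := 𝓡 m) x]
  refine (riemannianEDist_le_pathELength (γ := coordLine φ (φ x) w) (a := 0) (b := t)
    (fun s hs => ((contMDiffAt_coordLine hφ (hI hs).1).of_le (by simp)).contMDiffWithinAt)
    h0 rfl ht.1.le).trans ?_
  rw [pathELength_eq_lintegral_mfderiv_Icc]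
  calc ∫⁻ s in Icc 0 t, ‖mfderiv 𝓘(ℝ) (𝓡 m) (coordLine φ (φ x) w) s (1 : ℝ)‖ₑ
      ≤ ∫⁻ _ in Icc 0 t, ENNReal.ofReal C := by
        refine MeasureTheory.setLIntegral_mono measurable_const fun s hs => ?_
        rw [(hasMFDerivAt_coordLine hφ (hI hs).1).mfderiv]
        change ‖(1 : ℝ) • coordField m φ w (coordLine φ (φ x) w s)‖ₑ ≤ _
        rw [one_smul, ← ofReal_norm]
        exact ENNReal.ofReal_le_ofReal (hI hs).2.le
    _ = ENNReal.ofReal (C * t) := by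
        rw [MeasureTheory.setLIntegral_const, Real.volume_Icc, sub_zero,
          ← ENNReal.ofReal_mul ((norm_nonneg _).trans hC.le)]

end Distance

/-! ### The Riccati inequality and its equality case. -/

section Pairs

variable {n p : ℕ} {M : Type*} [TopologicalSpace M] [ChartedSpace (𝔼 (n + p)) M]
  [IsManifold (𝓡 (n + p)) ∞ M]
  [RiemannianBundle (fun x : M => TangentSpace (𝓡 (n + p)) x)]
  [IsContMDiffRiemannianBundle (𝓡 (n + p)) ∞ (𝔼 (n + p))
    (fun x : M => TangentSpace (𝓡 (n + p)) x)]
  {F : Foliation (n + p) n p M} {G : Foliation (n + p) p n M} {x : M}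

/-- `⟨ξ, v⟩` is the trace of the matrix of `A_v`. Its square is at most `n` times the sum of the
squared diagonal entries, hence at most `n |A_v|²`; the trace formula replaces `|A_v|²`, and the
term `−|v|² |h|²` is dropped. -/
lemma Foliation.UmbilicalForm.sq_inner_curvatureSum_le (hU : G.UmbilicalForm)
    (horth : Orthogonal F G) (hn : 1 ≤ n) {v : TangentSpace (𝓡 (n + p)) x}
    (hv : v ∈ G.tangent x) :
    inner ℝ (F.curvatureSum x) v ^ 2
      ≤ n * (inner ℝ (nabla v F.curvatureSum) v + ‖v‖ ^ 2 * F.divergence G.meanCurvature x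
        - F.curvatureTrace v) := by
  have hvF : v ∈ (F.tangent x)ᗮ := by rwa [← horth.eq_orthogonal]
  set b := stdOrthonormalBasis ℝ (F.tangent x) with hb
  have h1 := hU.curvatureTrace_eq horth hn hv
  have h2 := sq_sum_le_card_mul_sum_sq (s := Finset.univ)
    (f := fun i => F.secondFundamentalForm v (b i) (b i))
  have hcard : ((Finset.univ : Finset (Fin (Module.finrank ℝ (F.tangent x)))).card : ℝ) = n := by
    rw [Finset.card_univ, Fintype.card_fin, F.finrank_tangent]
  rw [F.sum_secondFundamentalForm hn hvF, hcard] at h2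
  have h3 : ∑ i, F.secondFundamentalForm v (b i) (b i) ^ 2
      ≤ ∑ i, ∑ j, F.secondFundamentalForm v (b i) (b j) ^ 2 :=
    Finset.sum_le_sum fun i _ => Finset.single_le_sum
      (f := fun j => F.secondFundamentalForm v (b i) (b j) ^ 2) (fun j _ => sq_nonneg _)
      (Finset.mem_univ i)
  refine h2.trans (mul_le_mul_of_nonneg_left ?_ (Nat.cast_nonneg n))
  have h4 : 0 ≤ ‖v‖ ^ 2 * ‖G.meanCurvature x‖ ^ 2 := by positivity
  linarith

/-- The Riccati inequality for `v = ξ/|ξ|`, multiplied out so that no division remains: it holds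
also where `ξ = 0` and is a closed condition. -/
lemma Foliation.UmbilicalForm.sq_norm_curvatureSum_le (hU : G.UmbilicalForm)
    (horth : Orthogonal F G) (hn : 1 ≤ n)
    (hdiv : ∀ v ∈ G.tangent x, ‖v‖ = 1 →
      F.divergence G.meanCurvature x ≤ F.curvatureTrace v) :
    2 * inner ℝ (F.curvatureSum x) (F.curvatureSum x) ^ 2
      ≤ n * mvfderiv (𝓡 (n + p)) (fun y => inner ℝ (F.curvatureSum y) (F.curvatureSum y)) x
        (F.curvatureSum x) := by
  set ξ := F.curvatureSum with hξ
  have hd : FieldDiffAt ξ x := (F.smoothNear_curvatureSum x).mdiff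
  have hG : ξ x ∈ G.tangent x := by
    rw [horth.eq_orthogonal]
    exact F.curvatureSum_mem x
  rw [mvfderiv_inner hd hd]
  by_cases h0 : ξ x = 0
  · simp [h0]
  have ha : 0 < ‖ξ x‖ := norm_pos_iff.2 h0
  set v := ‖ξ x‖⁻¹ • ξ x with hv
  have hvG : v ∈ G.tangent x := Submodule.smul_mem _ _ hG
  have hv1 : ‖v‖ = 1 := by
    rw [hv, norm_smul, norm_inv, norm_norm, inv_mul_cancel₀ ha.ne']
  have h1 := hU.sq_inner_curvatureSum_le horth hn hvG
  rw [hv1, ← hξ] at h1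
  have h2 := hdiv v hvG hv1
  have h3 : inner ℝ (ξ x) v ^ 2 ≤ n * inner ℝ (nabla v ξ) v :=
    h1.trans (mul_le_mul_of_nonneg_left (by linarith) (Nat.cast_nonneg n))
  rw [hv, nabla_smul_dir hd, real_inner_smul_right, real_inner_smul_right,
    real_inner_smul_left, real_inner_self_eq_norm_sq] at h3
  rw [real_inner_comm (nabla (ξ x) ξ), real_inner_self_eq_norm_sq]
  field_simp at h3
  nlinarith

omit [IsManifold (𝓡 (n + p)) ∞ M] [IsContMDiffRiemannianBundle (𝓡 (n + p)) ∞ (𝔼 (n + p))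
    (fun x : M => TangentSpace (𝓡 (n + p)) x)] in
lemma norm_eq_sqrt_inner_field (X : ∀ x : M, TangentSpace (𝓡 (n + p)) x) (y : M) :
    ‖X y‖ = √(inner ℝ (X y) (X y)) := by
  rw [real_inner_self_eq_norm_sq, Real.sqrt_sq (norm_nonneg _)]

/-- The derivative of the curvature sum in the directions of a plaque on which it vanishes. -/
lemma Foliation.Saturated.inner_nabla_curvatureSum {S : Set M} (hS : G.Saturated S)
    (hzero : ∀ y ∈ closure S, F.curvatureSum y = 0) (hx : x ∈ closure S)
    {v : TangentSpace (𝓡 (n + p)) x} (hv : v ∈ G.tangent x) :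
    inner ℝ (nabla v F.curvatureSum) v = 0 := by
  obtain ⟨φ, hxφ, hφ, hT⟩ := G.exists_chart x
  have hξ := F.smoothNear_curvatureSum x
  have he := smoothNear_extend v
  have hw : (chartDeriv (n + p) φ x v).2 = 0 := (mem_tangent_iff_chartDeriv_snd hφ hT hxφ v).1 hv
  have h1 := hasDerivAt_comp_coordLine_zero hφ hxφ (hξ.mdiff.inner he.mdiff)
    (chartDeriv (n + p) φ x v)
  -- The plaque through `x` lies in the closure of `S`, where `ξ = 0`; the derivative along it is
  -- `⟨∇_v ξ, v⟩`, the other product-rule term having the factor `ξ x = 0`.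
  have h2 : (fun t => inner ℝ (F.curvatureSum (coordLine φ (φ x) (chartDeriv (n + p) φ x v) t))
      (extend (𝔼 (n + p)) v (coordLine φ (φ x) (chartDeriv (n + p) φ x v) t)))
      =ᶠ[𝓝 (0 : ℝ)] fun _ => (0 : ℝ) := by
    filter_upwards [hS.coordLine_mem_closure hφ hT hxφ hx hw] with t ht
    rw [hzero _ ht.2, inner_zero_left]
  have h3 := h1.unique ((hasDerivAt_const (0 : ℝ) (0 : ℝ)).congr_of_eventuallyEq h2)
  rw [coordField_eq hφ hxφ, mvfderiv_inner hξ.mdiff he.mdiff, hzero x hx, inner_zero_left,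
    add_zero, extend_apply_self] at h3
  exact h3

/-- Where the curvature sum vanishes along the plaques, the mean curvature vector and the second
fundamental forms vanish as well. -/
lemma Foliation.Saturated.vanishing (hU : G.UmbilicalForm) (horth : Orthogonal F G) (hn : 1 ≤ n)
    {S : Set M} (hS : G.Saturated S) (hzero : ∀ y ∈ closure S, F.curvatureSum y = 0)
    (hx : x ∈ closure S) {v : TangentSpace (𝓡 (n + p)) x} (hv : v ∈ G.tangent x) (hv1 : ‖v‖ = 1)
    (hdiv : F.divergence G.meanCurvature x ≤ F.curvatureTrace v) :
    G.meanCurvature x = 0 ∧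
      (∀ i j, F.secondFundamentalForm v (stdOrthonormalBasis ℝ (F.tangent x) i)
        (stdOrthonormalBasis ℝ (F.tangent x) j) = 0) ∧
      F.curvatureTrace v = F.divergence G.meanCurvature x := by
  have h1 := hU.curvatureTrace_eq horth hn hv
  rw [hS.inner_nabla_curvatureSum hzero hx hv, hv1] at h1
  have h2 : 0 ≤ ∑ i, ∑ j, F.secondFundamentalForm v (stdOrthonormalBasis ℝ (F.tangent x) i)
      (stdOrthonormalBasis ℝ (F.tangent x) j) ^ 2 :=
    Finset.sum_nonneg fun i _ => Finset.sum_nonneg fun j _ => sq_nonneg _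
  have h3 : 0 ≤ ‖G.meanCurvature x‖ ^ 2 := sq_nonneg _
  -- The trace formula now reads `|h|² + |A_v|² = div_F h − Tr K^v ≤ 0`.
  have h4 : ‖G.meanCurvature x‖ ^ 2 = 0 := by linarith
  have h5 : ∑ i, ∑ j, F.secondFundamentalForm v (stdOrthonormalBasis ℝ (F.tangent x) i)
      (stdOrthonormalBasis ℝ (F.tangent x) j) ^ 2 = 0 := by linarith
  refine ⟨by simpa using h4, fun i j => ?_, by linarith⟩
  rw [Finset.sum_eq_zero_iff_of_nonneg fun i _ => Finset.sum_nonneg fun j _ => sq_nonneg _] at h5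
  have h6 := h5 i (Finset.mem_univ i)
  rw [Finset.sum_eq_zero_iff_of_nonneg fun j _ => sq_nonneg _] at h6
  exact pow_eq_zero_iff two_ne_zero |>.1 (h6 j (Finset.mem_univ j))

/-- Totally geodesic leaves, from the vanishing of the components of the second fundamental
forms. -/
lemma Foliation.isTotallyGeodesic_of_components
    (h : ∀ x : M, ∀ ν ∈ (F.tangent x)ᗮ, ‖ν‖ = 1 → ∀ i j,
      F.secondFundamentalForm ν (stdOrthonormalBasis ℝ (F.tangent x) i)
        (stdOrthonormalBasis ℝ (F.tangent x) j) = 0) :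
    F.IsTotallyGeodesic := by
  intro x ν hν v hv w hw
  set b := stdOrthonormalBasis ℝ (F.tangent x)
  have hunit : ∀ ν ∈ (F.tangent x)ᗮ, ‖ν‖ = 1 → F.secondFundamentalForm ν v w = 0 := by
    intro ν hν hν1
    have hN := ((smoothNear_extend ν).normalPart F).mdiff
    rw [← F.sum_inner_smul b hv, ← F.sum_inner_smul b hw, Foliation.secondFundamentalForm,
      nabla_sum_dir _ hN, inner_neg_left, sum_inner, neg_eq_zero]
    refine Finset.sum_eq_zero fun i _ => ?_
    rw [inner_sum]
    refine Finset.sum_eq_zero fun j _ => ?_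
    have h1 := h x ν hν hν1 i j
    rw [Foliation.secondFundamentalForm, inner_neg_left, neg_eq_zero] at h1
    rw [nabla_smul_dir hN, real_inner_smul_left, real_inner_smul_right, h1, mul_zero, mul_zero]
  -- The form is defined through an extension of `ν`, which hides its linearity in `ν`; moving the
  -- derivative onto a tangent extension of `w` makes it visible.
  have hW := ((smoothNear_extend w).tangentPart F).mdiff
  have hWF : ∀ᶠ y in 𝓝 x, F.tangentPart (extend (𝔼 (n + p)) w) y ∈ F.tangent y :=
    .of_forall fun y => F.tangentPart_mem _ y
  have h1 := F.secondFundamentalForm_eq hW hWF hν v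
  rw [F.tangentPart_extend hw] at h1
  rw [h1]
  by_cases h0 : ν = 0
  · rw [h0, inner_zero_right]
  have ha : ‖ν‖ ≠ 0 := norm_ne_zero_iff.2 h0
  have hν' : ‖ν‖⁻¹ • ν ∈ (F.tangent x)ᗮ := Submodule.smul_mem _ _ hν
  have h2 := F.secondFundamentalForm_eq hW hWF hν' v
  rw [F.tangentPart_extend hw, hunit _ hν' (by
    rw [norm_smul, norm_inv, norm_norm, inv_mul_cancel₀ ha]), real_inner_smul_right] at h2
  exact (mul_eq_zero.1 h2.symm).resolve_left (inv_ne_zero ha)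

end Pairs

/-! ### Vanishing of the curvature sum by completeness. -/

section Complete

open Filter

variable {n p : ℕ} {M : Type*} [EMetricSpace M] [ChartedSpace (𝔼 (n + p)) M]
  [IsManifold (𝓡 (n + p)) ∞ M]
  [RiemannianBundle (fun x : M => TangentSpace (𝓡 (n + p)) x)]
  [IsContMDiffRiemannianBundle (𝓡 (n + p)) ∞ (𝔼 (n + p))
    (fun x : M => TangentSpace (𝓡 (n + p)) x)]
  [IsRiemannianManifold (𝓡 (n + p)) M] [CompleteSpace M]
  {F : Foliation (n + p) n p M} {G : Foliation (n + p) p n M} {x : M}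

/-- On a complete manifold the curvature sum vanishes on every union of leaves on which the
divergence of the mean curvature vector is bounded by the mixed curvature. -/
lemma Foliation.Saturated.curvatureSum_eq_zero (hU : G.UmbilicalForm) (horth : Orthogonal F G)
    (hn : 1 ≤ n) {S : Set M} (hS : G.Saturated S)
    (hdiv : ∀ x ∈ S, ∀ v ∈ G.tangent x, ‖v‖ = 1 →
      F.divergence G.meanCurvature x ≤ F.curvatureTrace v) :
    ∀ x ∈ closure S, F.curvatureSum x = 0 := by
  set ξ := F.curvatureSum with hξdef
  have hξ : ∀ x, SmoothNear ξ x := F.smoothNear_curvatureSum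
  set g : M → ℝ := fun y => inner ℝ (ξ y) (ξ y) with hg
  have hgs (x : M) : SmoothFunNear (n + p) g x := (hξ x).inner (hξ x)
  have hgc : Continuous g := continuous_iff_continuousAt.2 fun x => (hgs x).continuousAt
  have hnorm (y : M) : ‖ξ y‖ = √(g y) := norm_eq_sqrt_inner_field ξ y
  have hnc : Continuous fun y => ‖ξ y‖ := by
    simp only [hnorm]
    exact hgc.sqrt
  have hn' : (0 : ℝ) < n := by exact_mod_cast hn
  -- A closed condition, so it passes from `S` to its closure.
  have hgrad : ∀ x ∈ closure S, 2 * g x ^ 2 ≤ n * mvfderiv (𝓡 (n + p)) g x (ξ x) := by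
    have hcl : IsClosed {x | 2 * g x ^ 2 ≤ n * mvfderiv (𝓡 (n + p)) g x (ξ x)} := by
      refine isClosed_le (by fun_prop) (continuous_const.mul ?_)
      exact continuous_iff_continuousAt.2 fun x => ((hgs x).mvfderiv (hξ x)).continuousAt
    exact fun x hx => closure_minimal
      (fun y hy => hU.sq_norm_curvatureSum_le horth hn (hdiv y hy)) hcl hx
  -- Descent for `u = 1/|ξ|` along the direction `ξ/|ξ|`. The constant `4 * n` allows for speed up
  -- to 2 in place of 1 and for a decrease rate `1/(2n)` in place of `1/n`.
  have hempty : {x | x ∈ closure S ∧ ξ x ≠ 0} = ∅ := by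
    refine eq_empty_of_descent (u := fun y => ‖ξ y‖⁻¹) (C := 4 * n) (by positivity)
      (fun y => by positivity) (fun y hy => hnc.continuousAt.inv₀ (norm_ne_zero_iff.2 hy.2))
      (fun s c y hs hc hy => ?_) fun x hx => ?_
    -- A bound `1/|ξ| ≤ c` along the sequence gives `1 ≤ c |ξ|` in the limit, so the limit is not a
    -- zero of `ξ`.
    · refine ⟨isClosed_closure.mem_of_tendsto hy (.of_forall fun k => (hs k).1), fun h0 => ?_⟩
      have h1 : Tendsto (fun k => c * ‖ξ (s k)‖) atTop (𝓝 (c * ‖ξ y‖)) :=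
        ((hnc.tendsto y).comp hy).const_mul c
      have h2 : (1 : ℝ) ≤ c * ‖ξ y‖ := ge_of_tendsto' h1 fun k => by
        have hk : 0 < ‖ξ (s k)‖ := norm_pos_iff.2 (hs k).2
        have := mul_le_mul_of_nonneg_right (hc k) hk.le
        rwa [inv_mul_cancel₀ hk.ne'] at this
      rw [h0] at h2
      simp at h2
      linarith
    · obtain ⟨hxS, hx0⟩ := hx
      have ha : 0 < ‖ξ x‖ := norm_pos_iff.2 hx0
      have hga : g x = ‖ξ x‖ ^ 2 := real_inner_self_eq_norm_sq _
      have hξG : ξ x ∈ G.tangent x := by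
        rw [horth.eq_orthogonal]
        exact F.curvatureSum_mem x
      set v := ‖ξ x‖⁻¹ • ξ x with hv
      have hvG : v ∈ G.tangent x := Submodule.smul_mem _ _ hξG
      have hv1 : ‖v‖ = 1 := by
        rw [hv, norm_smul, norm_inv, norm_norm, inv_mul_cancel₀ ha.ne']
      obtain ⟨φ, hxφ, hφ, hT⟩ := G.exists_chart x
      set w := chartDeriv (n + p) φ x v with hwdef
      have hw : w.2 = 0 := (mem_tangent_iff_chartDeriv_snd hφ hT hxφ v).1 hvG
      have hwv : coordField (n + p) φ w x = v := coordField_eq hφ hxφ v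
      have hc0 : coordLine φ (φ x) w 0 = x := coordLine_zero hxφ w
      have hcc : ContinuousAt (coordLine φ (φ x) w) 0 :=
        (contMDiffAt_coordLine (m := n + p) hφ (by simpa using φ.map_source hxφ)).continuousAt
      have hmem : ∀ᶠ t : ℝ in 𝓝[>] 0, coordLine φ (φ x) w t ∈ closure S :=
        ((hS.coordLine_mem_closure hφ hT hxφ hxS hw).mono fun t ht => ht.2).filter_mono
          nhdsWithin_le_nhds
      have hne : ∀ᶠ t : ℝ in 𝓝[>] 0, ξ (coordLine φ (φ x) w t) ≠ 0 := by
        have h1 : ContinuousAt (fun t => ‖ξ (coordLine φ (φ x) w t)‖) 0 :=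
          hnc.continuousAt.comp hcc
        have h2 := h1.eventually (lt_mem_nhds (a := 0) (by beta_reduce; rw [hc0]; exact ha))
        exact (h2.mono fun t ht => norm_pos_iff.1 ht).filter_mono nhdsWithin_le_nhds
      have hdist := eventually_edist_coordLine_le (C := 2) hφ hxφ (w := w)
        (by rw [hwv, hv1]; norm_num)
      have hder : HasDerivAt (fun t => ‖ξ (coordLine φ (φ x) w t)‖⁻¹)
          (-(mvfderiv (𝓡 (n + p)) g x v / (2 * ‖ξ x‖)) / ‖ξ x‖ ^ 2) 0 := by
        have h1 := hasDerivAt_comp_coordLine_zero hφ hxφ (hgs x).mdiff w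
        rw [hwv] at h1
        have h2 := (h1.sqrt (by rw [hc0, hga]; positivity)).fun_inv
          (by rw [hc0, ← hnorm]; exact ha.ne')
        simpa only [hc0, ← hnorm] using h2
      -- The derivative of `1/|ξ|` is at most `−1/n`; giving up a factor 2 makes the inequality
      -- strict, so that it holds for difference quotients at small `t`.
      have hlt : -(mvfderiv (𝓡 (n + p)) g x v / (2 * ‖ξ x‖)) / ‖ξ x‖ ^ 2 < -(1 / (2 * n)) := by
        have h1 := hgrad x hxS
        have h2 : mvfderiv (𝓡 (n + p)) g x v = ‖ξ x‖⁻¹ * mvfderiv (𝓡 (n + p)) g x (ξ x) := by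
          rw [hv, map_smul, smul_eq_mul]
        rw [h2, neg_div, neg_lt_neg_iff]
        rw [hga] at h1
        have h3 : 1 / (n : ℝ) ≤ ‖ξ x‖⁻¹ * mvfderiv (𝓡 (n + p)) g x (ξ x) / (2 * ‖ξ x‖)
            / ‖ξ x‖ ^ 2 := by
          rw [div_div, inv_mul_eq_div, div_div, div_le_div_iff₀ hn' (by positivity)]
          nlinarith
        refine lt_of_lt_of_le ?_ h3
        exact one_div_lt_one_div_of_lt hn' (by linarith)
      have hslope := hder.tendsto_slope_zero_right.eventually (gt_mem_nhds hlt)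
      obtain ⟨t, h1, h2, h3, h4, ht⟩ :=
        (hmem.and (hne.and (hdist.and (hslope.and self_mem_nhdsWithin)))).exists
      have ht0 : (0 : ℝ) < t := ht
      rw [zero_add, hc0, smul_eq_mul, inv_mul_lt_iff₀ ht0] at h4
      have h5 : 0 < t * (1 / (2 * n)) := by positivity
      refine ⟨_, ⟨h1, h2⟩, h3.trans (ENNReal.ofReal_le_ofReal ?_), by linarith⟩
      have h6 : t * (1 / (2 * n)) ≤ ‖ξ x‖⁻¹ - ‖ξ (coordLine φ (φ x) w t)‖⁻¹ := by linarith
      have h7 := mul_le_mul_of_nonneg_left h6 (show (0 : ℝ) ≤ 4 * n by positivity)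
      refine le_trans (le_of_eq ?_) h7
      field_simp
      ring
  intro x hx
  by_contra h
  have : x ∈ {x | x ∈ closure S ∧ ξ x ≠ 0} := ⟨hx, h⟩
  rw [hempty] at this
  exact this

end Complete

/-! ### Coordinates adapted to both foliations. -/

section ProductChart

variable {n p : ℕ} {M : Type*} [TopologicalSpace M] [ChartedSpace (𝔼 (n + p)) M]
  [RiemannianBundle (fun x : M => TangentSpace (𝓡 (n + p)) x)]
  {F : Foliation (n + p) n p M} {G : Foliation (n + p) p n M} {x : M}
  {φ : OpenPartialHomeomorph M (𝔼 n × 𝔼 p)} {ψ : OpenPartialHomeomorph M (𝔼 p × 𝔼 n)}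

/-- The coordinate change from a foliated chart `φ` to the pair of transverse coordinates of two
foliated charts. -/
def transverseMap (φ : OpenPartialHomeomorph M (𝔼 n × 𝔼 p)) (ψ : OpenPartialHomeomorph M (𝔼 p × 𝔼 n))
    (z : 𝔼 n × 𝔼 p) : 𝔼 n × 𝔼 p :=
  ((ψ (φ.symm z)).2, z.2)

omit [RiemannianBundle (fun x : M => TangentSpace (𝓡 (n + p)) x)] in
lemma contDiffAt_transverseMap (hφ : IsSmoothChart (m := n + p) φ)
    (hψ : IsSmoothChart (m := n + p) ψ) {z : 𝔼 n × 𝔼 p} (hz : z ∈ φ.target)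
    (hzψ : φ.symm z ∈ ψ.source) : ContDiffAt ℝ ∞ (transverseMap φ ψ) z := by
  have h : ContMDiffAt 𝓘(ℝ, 𝔼 n × 𝔼 p) 𝓘(ℝ, 𝔼 p × 𝔼 n) ∞ (ψ ∘ φ.symm) z :=
    (hψ.contMDiffAt hzψ).comp z (hφ.contMDiffAt_symm hz)
  exact (contMDiffAt_iff_contDiffAt.1 h).snd.prodMk contDiffAt_snd

/-- A vector killed by the derivative corresponds to one tangent to both foliations, hence
orthogonal to itself; an injective endomorphism of a finite-dimensional space is invertible. -/
lemma hasFDerivAt_transverseMap (horth : Orthogonal F G) (hφ : IsSmoothChart (m := n + p) φ)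
    (hψ : IsSmoothChart (m := n + p) ψ) (hF : TangentToFstSlices F.tangent φ)
    (hG : TangentToFstSlices G.tangent ψ) {z : 𝔼 n × 𝔼 p} (hz : z ∈ φ.target)
    (hzψ : φ.symm z ∈ ψ.source) :
    ∃ e : (𝔼 n × 𝔼 p) ≃L[ℝ] (𝔼 n × 𝔼 p),
      HasFDerivAt (transverseMap φ ψ) (e : (𝔼 n × 𝔼 p) →L[ℝ] (𝔼 n × 𝔼 p)) z := by
  have h : HasMFDerivAt 𝓘(ℝ, 𝔼 n × 𝔼 p) 𝓘(ℝ, 𝔼 p × 𝔼 n) (ψ ∘ φ.symm) z _ :=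
    (hψ.mdifferentiableAt hzψ).hasMFDerivAt.comp z (hφ.mdifferentiableAt_symm hz).hasMFDerivAt
  have h1 := (hasMFDerivAt_iff_hasFDerivAt.1 h).snd.prodMk hasFDerivAt_snd
  set D := (chartDeriv (n + p) ψ (φ.symm z)).comp (chartDerivSymm (n + p) φ z) with hD
  set L : (𝔼 n × 𝔼 p) →L[ℝ] (𝔼 n × 𝔼 p) :=
    ((ContinuousLinearMap.snd ℝ (𝔼 p) (𝔼 n)).comp D).prod (ContinuousLinearMap.snd ℝ (𝔼 n) (𝔼 p))
  have hinj : Function.Injective (L : (𝔼 n × 𝔼 p) →ₗ[ℝ] (𝔼 n × 𝔼 p)) := by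
    rw [← LinearMap.ker_eq_bot, LinearMap.ker_eq_bot']
    intro c hc
    have h2 : (chartDeriv (n + p) ψ (φ.symm z) (chartDerivSymm (n + p) φ z c)).2 = 0 :=
      congrArg Prod.fst hc
    have h3 : c.2 = 0 := congrArg Prod.snd hc
    have h4 := chartDeriv_comp_chartDerivSymm hφ hz c
    have hu1 : chartDerivSymm (n + p) φ z c ∈ F.tangent (φ.symm z) := by
      rw [mem_tangent_iff_chartDeriv_snd hφ hF (φ.map_target hz), h4, h3]
    have hu2 : chartDerivSymm (n + p) φ z c ∈ G.tangent (φ.symm z) := by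
      rw [mem_tangent_iff_chartDeriv_snd hψ hG hzψ, h2]
    rw [← h4, inner_self_eq_zero.1 (horth _ _ hu1 _ hu2), map_zero]
  exact ⟨(LinearEquiv.ofInjectiveEndo _ hinj).toContinuousLinearEquiv, h1⟩

/-- Two orthogonal foliations have common foliated charts. -/
lemma Orthogonal.exists_product_chart (horth : Orthogonal F G) (x : M) :
    ∃ (χ : OpenPartialHomeomorph M (𝔼 n × 𝔼 p)) (A : Set (𝔼 n)) (B : Set (𝔼 p)),
      x ∈ χ.source ∧ χ.target = A ×ˢ B ∧ Convex ℝ A ∧ Convex ℝ B ∧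
      IsSmoothChart (m := n + p) χ ∧ TangentToFstSlices F.tangent χ ∧
      TangentToSndSlices G.tangent χ := by
  obtain ⟨φ, hxφ, hφ, hF⟩ := F.exists_chart x
  obtain ⟨ψ, hxψ, hψ, hG⟩ := G.exists_chart x
  have hzx : φ.symm (φ x) ∈ ψ.source := by rwa [φ.left_inv hxφ]
  obtain ⟨e, he⟩ := hasFDerivAt_transverseMap horth hφ hψ hF hG (φ.map_source hxφ) hzx
  have hcd := contDiffAt_transverseMap hφ hψ (φ.map_source hxφ) hzx
  let θ₀ := hcd.toOpenPartialHomeomorph (transverseMap φ ψ) he (by simp)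
  have hθ₀ : (θ₀ : 𝔼 n × 𝔼 p → 𝔼 n × 𝔼 p) = transverseMap φ ψ := rfl
  have hx₀ : φ x ∈ θ₀.source := hcd.mem_toOpenPartialHomeomorph_source he (by simp)
  let χ₀ := (φ.restrOpen ψ.source ψ.open_source).trans θ₀
  have hχ₀ : ∀ y ∈ χ₀.source, (y ∈ φ.source ∧ y ∈ ψ.source) ∧ φ y ∈ θ₀.source := by
    intro y hy
    simpa [χ₀] using hy
  have hxχ₀ : x ∈ χ₀.source := by simp [χ₀, hxφ, hxψ, hx₀]
  -- A ball for the sup norm is a product of balls, which gives a target of the form `A ×ˢ B` with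
  -- convex factors.
  obtain ⟨r, hr, hball⟩ := Metric.isOpen_iff.1 χ₀.open_target _ (χ₀.map_source hxχ₀)
  set A := Metric.ball (χ₀ x).1 r
  set B := Metric.ball (χ₀ x).2 r
  have hAB : A ×ˢ B ⊆ χ₀.target := by rwa [ball_prod_same]
  have hopen : IsOpen (A ×ˢ B) := Metric.isOpen_ball.prod Metric.isOpen_ball
  let χ := χ₀.trans (OpenPartialHomeomorph.ofSet (A ×ˢ B) hopen)
  have hχapply (y : M) : χ y = transverseMap φ ψ (φ y) := rfl
  have hχsource : ∀ y ∈ χ.source, y ∈ χ₀.source := by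
    intro y hy
    have : y ∈ χ₀.source ∧ χ₀ y ∈ A ×ˢ B := by simpa [χ] using hy
    exact this.1
  have htarget : χ.target = A ×ˢ B := by
    simp only [χ, OpenPartialHomeomorph.trans_target, OpenPartialHomeomorph.ofSet_target,
      OpenPartialHomeomorph.ofSet_symm, OpenPartialHomeomorph.ofSet_apply, preimage_id]
    exact inter_eq_left.2 hAB
  -- The first coordinate of `χ` is the transverse coordinate of the chart of `G`, and the second is
  -- that of the chart of `F`.
  have hev {y : M} (hy : y ∈ χ.source) : (fun z => (χ z).1) =ᶠ[𝓝 y] fun z => (ψ z).2 := by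
    filter_upwards [φ.open_source.mem_nhds (hχ₀ y (hχsource y hy)).1.1] with z hz
    rw [hχapply, transverseMap, φ.left_inv hz]
  refine ⟨χ, A, B, ?_, htarget, convex_ball _ _, convex_ball _ _, ⟨fun y hy => ?_, fun z hz => ?_⟩,
    fun y hy v => ?_, fun y hy v => ?_⟩
  · have : x ∈ χ₀.source ∧ χ₀ x ∈ A ×ˢ B :=
      ⟨hxχ₀, Metric.mem_ball_self hr, Metric.mem_ball_self hr⟩
    simpa [χ] using this
  · obtain ⟨⟨h1, h2⟩, -⟩ := hχ₀ y (hχsource y hy)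
    have h3 := contDiffAt_transverseMap hφ hψ (φ.map_source h1) (by rwa [φ.left_inv h1])
    exact (h3.contMDiffAt.comp y (hφ.contMDiffAt h1)).contMDiffWithinAt
  · have hy := hχsource _ (χ.map_target hz)
    obtain ⟨⟨h1, h2⟩, h3⟩ := hχ₀ _ hy
    have hz₀ : z ∈ χ₀.target := hAB (htarget ▸ hz)
    have hzθ : z ∈ θ₀.target ∧ θ₀.symm z ∈ (φ.restrOpen ψ.source ψ.open_source).target := by
      simpa [χ₀, OpenPartialHomeomorph.trans_target] using hz₀
    have hs : χ.symm z = φ.symm (θ₀.symm z) := rfl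
    have ht : θ₀.symm z ∈ φ.target := by
      have : θ₀.symm z ∈ φ.target ∧ φ.symm (θ₀.symm z) ∈ ψ.source := by
        simpa using hzθ.2
      exact this.1
    rw [hs] at h2
    -- Smoothness of the inverse is needed on the whole target, so invertibility of the derivative
    -- is used at each point and not only at `φ x`.
    obtain ⟨e', he'⟩ := hasFDerivAt_transverseMap horth hφ hψ hF hG ht h2
    have h4 := θ₀.contDiffAt_symm hzθ.1 he' (contDiffAt_transverseMap hφ hψ ht h2)
    exact ((hφ.contMDiffAt_symm ht).comp z h4.contMDiffAt).contMDiffWithinAt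
  · exact hF y (hχ₀ y (hχsource y hy)).1.1 v
  · rw [hG y (hχ₀ y (hχsource y hy)).1.2 v, (hev hy).mfderiv_eq]
    rfl

end ProductChart

/-! ### Splitting of the metric for two totally geodesic foliations. -/

section Product

variable {m k l : ℕ} {M : Type*} [TopologicalSpace M] [ChartedSpace (𝔼 m) M]
  {φ : OpenPartialHomeomorph M (𝔼 k × 𝔼 l)} {x y : M}

/-- The derivative of a map that is affine in the coordinates `φ`. -/
lemma mfderiv_coord_affine (hφ : IsSmoothChart (m := m) φ) (hy : y ∈ φ.source)
    (A : 𝔼 k × 𝔼 l →L[ℝ] 𝔼 k × 𝔼 l) (c : 𝔼 k × 𝔼 l) (hc : A (φ y) + c ∈ φ.target)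
    (u : TangentSpace (𝓡 m) y) :
    mfderiv (𝓡 m) (𝓡 m) (fun y => φ.symm (A (φ y) + c)) y u
      = coordField m φ (A (chartDeriv m φ y u)) (φ.symm (A (φ y) + c)) := by
  have h1 : HasMFDerivAt 𝓘(ℝ, 𝔼 k × 𝔼 l) 𝓘(ℝ, 𝔼 k × 𝔼 l) (fun z => A z + c) (φ y) A :=
    (A.hasFDerivAt.add_const c).hasMFDerivAt
  have h2 : HasMFDerivAt (𝓡 m) (𝓡 m) (fun y => φ.symm (A (φ y) + c)) y _ :=
    (hφ.mdifferentiableAt_symm hc).hasMFDerivAt.comp y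
      (h1.comp y (hφ.mdifferentiableAt hy).hasMFDerivAt)
  rw [h2.mfderiv]
  exact chartDerivSymm_eq_coordField hφ hc _

variable [IsManifold (𝓡 m) ∞ M] [RiemannianBundle (fun x : M => TangentSpace (𝓡 m) x)]
  [IsContMDiffRiemannianBundle (𝓡 m) ∞ (𝔼 m) (fun x : M => TangentSpace (𝓡 m) x)]
  {X Y W : ∀ x : M, TangentSpace (𝓡 m) x}

lemma nabla_comm_of_mlieBracket_eq_zero (hX : SmoothNear X x) (hW : SmoothNear W x)
    (h : VectorField.mlieBracket (𝓡 m) W X x = 0) : nabla (W x) X = nabla (X x) W :=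
  sub_eq_zero.1 ((nabla_sub_nabla hW.mdiff hX.mdiff).trans h)

/-- The metric of totally geodesic leaves is invariant under normal fields commuting with the
tangent fields. -/
lemma Foliation.IsTotallyGeodesic.mvfderiv_inner {F : Foliation m k l M} (hF : F.IsTotallyGeodesic)
    (hX : SmoothNear X x) (hY : SmoothNear Y x) (hW : SmoothNear W x)
    (hXF : ∀ᶠ y in 𝓝 x, X y ∈ F.tangent y) (hYF : ∀ᶠ y in 𝓝 x, Y y ∈ F.tangent y)
    (hWF : ∀ᶠ y in 𝓝 x, W y ∈ (F.tangent y)ᗮ)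
    (hWX : VectorField.mlieBracket (𝓡 m) W X x = 0)
    (hWY : VectorField.mlieBracket (𝓡 m) W Y x = 0) :
    mvfderiv (𝓡 m) (fun y => inner ℝ (X y) (Y y)) x (W x) = 0 := by
  -- Since `W` commutes with `X`, `∇_W X = ∇_X W`, whose inner product with `Y` is minus the second
  -- fundamental form of `F` in the direction `W`.
  have key {X Y : ∀ x : M, TangentSpace (𝓡 m) x} (hX : SmoothNear X x)
      (hXF : X x ∈ F.tangent x) (hYF : Y x ∈ F.tangent x)
      (hWX : VectorField.mlieBracket (𝓡 m) W X x = 0) : inner ℝ (nabla (W x) X) (Y x) = 0 := by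
    have h1 := F.secondFundamentalForm_eq_normal hW.mdiff hWF hYF (X x)
    rw [hF x _ hWF.self_of_nhds _ hXF _ hYF] at h1
    rw [nabla_comm_of_mlieBracket_eq_zero hX hW hWX]
    linarith
  rw [OrthFol.mvfderiv_inner hX.mdiff hY.mdiff, real_inner_comm (nabla (W x) Y),
    key hX hXF.self_of_nhds hYF.self_of_nhds hWX, key hY hYF.self_of_nhds hXF.self_of_nhds hWY,
    add_zero]

/-- The inner products of coordinate fields tangent to totally geodesic leaves are constant in the
normal coordinate directions. -/
lemma Foliation.IsTotallyGeodesic.inner_coordField_eq {k' l' : ℕ} {F : Foliation m k' l' M}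
    (hF : F.IsTotallyGeodesic)
    (hφ : IsSmoothChart (m := m) φ) {c d w z : 𝔼 k × 𝔼 l}
    (hseg : ∀ t ∈ Icc (0 : ℝ) 1, z + t • w ∈ φ.target)
    (hc : ∀ y ∈ φ.source, coordField m φ c y ∈ F.tangent y)
    (hd : ∀ y ∈ φ.source, coordField m φ d y ∈ F.tangent y)
    (hw : ∀ y ∈ φ.source, coordField m φ w y ∈ (F.tangent y)ᗮ) :
    inner ℝ (coordField m φ c (φ.symm z)) (coordField m φ d (φ.symm z))
      = inner ℝ (coordField m φ c (φ.symm (z + w))) (coordField m φ d (φ.symm (z + w))) := by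
  set f : M → ℝ := fun y => inner ℝ (coordField m φ c y) (coordField m φ d y) with hf
  have hder : ∀ t ∈ Icc (0 : ℝ) 1, HasDerivAt (fun t => f (coordLine φ z w t)) 0 t := by
    intro t ht
    have hs : coordLine φ z w t ∈ φ.source := φ.map_target (hseg t ht)
    have hC := smoothNear_coordField (m := m) hφ hs c
    have hD := smoothNear_coordField (m := m) hφ hs d
    have hW := smoothNear_coordField (m := m) hφ hs w
    have hev {P : M → Prop} (h : ∀ y ∈ φ.source, P y) : ∀ᶠ y in 𝓝 (coordLine φ z w t), P y :=
      Filter.mem_of_superset (φ.open_source.mem_nhds hs) h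
    have h1 := hasDerivAt_comp_coordLine hφ (hseg t ht) (f := f) (hC.inner hD).mdiff
    rwa [hF.mvfderiv_inner hC hD hW (hev hc) (hev hd) (hev hw) (mlieBracket_coordField hφ hs w c)
      (mlieBracket_coordField hφ hs w d)] at h1
  have h2 := constant_of_has_deriv_right_zero
    (f := fun t => f (coordLine φ z w t)) (a := 0) (b := 1)
    (fun t ht => (hder t ht).continuousAt.continuousWithinAt)
    (fun t ht => (hder t ⟨ht.1, ht.2.le⟩).hasDerivWithinAt) 1 (by simp)
  have h3 : f (coordLine φ z w 1) = f (coordLine φ z w 0) := h2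
  have e1 : coordLine φ z w 1 = φ.symm (z + w) := by simp [coordLine]
  have e0 : coordLine φ z w 0 = φ.symm z := by simp [coordLine]
  rw [e1, e0] at h3
  exact h3.symm

end Product

section Splitting

variable {n p : ℕ} {M : Type*} [TopologicalSpace M] [ChartedSpace (𝔼 (n + p)) M]
  [IsManifold (𝓡 (n + p)) ∞ M]
  [RiemannianBundle (fun x : M => TangentSpace (𝓡 (n + p)) x)]
  [IsContMDiffRiemannianBundle (𝓡 (n + p)) ∞ (𝔼 (n + p))
    (fun x : M => TangentSpace (𝓡 (n + p)) x)]
  {F : Foliation (n + p) n p M} {G : Foliation (n + p) p n M} {x : M}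

/-- A manifold with two orthogonal totally geodesic foliations is locally a Riemannian product of
their leaves. -/
theorem Orthogonal.isLocallyRiemannianProduct (horth : Orthogonal F G)
    (hF : F.IsTotallyGeodesic) (hG : G.IsTotallyGeodesic) : IsLocallyRiemannianProduct F G := by
  intro x
  obtain ⟨χ, A, B, hx, htarget, hA, hB, hχ, hχF, hχG⟩ := horth.exists_product_chart x
  refine ⟨χ, A, B, hx, htarget, hχ, hχF, hχG, ?_⟩
  intro π₁ π₂ y hy
  have hxt : χ x ∈ A ×ˢ B := htarget ▸ χ.map_source hx
  have hyt : χ y ∈ A ×ˢ B := htarget ▸ χ.map_source hy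
  have hcF (c : 𝔼 n × 𝔼 p) (hc : c.2 = 0) : ∀ y ∈ χ.source, coordField (n + p) χ c y ∈ F.tangent y :=
    fun y hy => by rw [mem_tangent_iff_chartDeriv_snd hχ hχF hy, chartDeriv_coordField hχ hy, hc]
  have hcG (c : 𝔼 n × 𝔼 p) (hc : c.1 = 0) : ∀ y ∈ χ.source, coordField (n + p) χ c y ∈ G.tangent y :=
    fun y hy => by rw [mem_tangent_iff_chartDeriv_fst hχ hχG hy, chartDeriv_coordField hχ hy, hc]
  have hseg {z w : 𝔼 n × 𝔼 p} (hz : z ∈ A ×ˢ B) (hw : z + w ∈ A ×ˢ B) :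
      ∀ t ∈ Icc (0 : ℝ) 1, z + t • w ∈ χ.target := fun t ht =>
    htarget ▸ (hA.prod hB).add_smul_mem hz hw ht
  set P₁ : 𝔼 n × 𝔼 p →L[ℝ] 𝔼 n × 𝔼 p :=
    (ContinuousLinearMap.inl ℝ (𝔼 n) (𝔼 p)).comp (ContinuousLinearMap.fst ℝ (𝔼 n) (𝔼 p))
  set P₂ : 𝔼 n × 𝔼 p →L[ℝ] 𝔼 n × 𝔼 p :=
    (ContinuousLinearMap.inr ℝ (𝔼 n) (𝔼 p)).comp (ContinuousLinearMap.snd ℝ (𝔼 n) (𝔼 p))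
  have hP₁ (z : 𝔼 n × 𝔼 p) : P₁ z = (z.1, 0) := rfl
  have hP₂ (z : 𝔼 n × 𝔼 p) : P₂ z = (0, z.2) := rfl
  have hπ₁ : π₁ = fun y => χ.symm (P₁ (χ y) + P₂ (χ x)) := by
    ext y
    simp [π₁, hP₁, hP₂]
  have hπ₂ : π₂ = fun y => χ.symm (P₂ (χ y) + P₁ (χ x)) := by
    ext y
    simp [π₂, hP₁, hP₂]
  have hm₁ : P₁ (χ y) + P₂ (χ x) ∈ A ×ˢ B := by
    simpa [hP₁, hP₂] using And.intro hyt.1 hxt.2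
  have hm₂ : P₂ (χ y) + P₁ (χ x) ∈ A ×ˢ B := by
    simpa [hP₁, hP₂] using And.intro hxt.1 hyt.2
  have hsplit (z : 𝔼 n × 𝔼 p) : P₁ z + P₂ z = z := by simp [hP₁, hP₂]
  refine ⟨?_, ?_, fun u v => ?_⟩
  · have h := joinedByTangentCurve_of_segment (T := F.tangent) hχ (z := χ x) (w := P₁ (χ y - χ x))
      (hseg hxt (by simpa [hP₁] using And.intro hyt.1 hxt.2)) (hcF _ rfl)
    rw [χ.left_inv hx] at h
    refine Relation.ReflTransGen.single ?_
    convert h using 2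
    ext1 <;> simp [hP₁]
  · have h := joinedByTangentCurve_of_segment (T := G.tangent) hχ (z := χ x) (w := P₂ (χ y - χ x))
      (hseg hxt (by simpa [hP₂] using And.intro hxt.1 hyt.2)) (hcG _ rfl)
    rw [χ.left_inv hx] at h
    refine Relation.ReflTransGen.single ?_
    convert h using 2
    ext1 <;> simp [hP₂]
  rw [hπ₁, hπ₂]
  have d₁ (u : TangentSpace (𝓡 (n + p)) y) := mfderiv_coord_affine hχ hy P₁ (P₂ (χ x))
    (htarget ▸ hm₁) u
  have d₂ (u : TangentSpace (𝓡 (n + p)) y) := mfderiv_coord_affine hχ hy P₂ (P₁ (χ x))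
    (htarget ▸ hm₂) u
  have hdec (u : TangentSpace (𝓡 (n + p)) y) :
      u = coordField (n + p) χ (P₁ (chartDeriv (n + p) χ y u)) y
        + coordField (n + p) χ (P₂ (chartDeriv (n + p) χ y u)) y := by
    apply (chartDeriv_bijective hχ hy).1
    rw [map_add, chartDeriv_coordField hχ hy, chartDeriv_coordField hχ hy, hsplit]
  -- Moving from `y` to `π₁ y` along a slice of `G` does not change the `F`-block of the metric;
  -- `i₂` is the same with the foliations exchanged, in the same chart.
  have i₁ (c d : 𝔼 n × 𝔼 p) := hF.inner_coordField_eq hχ (c := P₁ c) (d := P₁ d)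
    (z := χ y) (w := P₂ (χ x - χ y))
    (hseg hyt (by simpa [hP₂] using And.intro hyt.1 hxt.2)) (hcF _ rfl) (hcF _ rfl)
    (fun y hy => horth.eq_orthogonal y ▸ hcG _ rfl y hy)
  have i₂ (c d : 𝔼 n × 𝔼 p) := hG.inner_coordField_eq hχ (c := P₂ c) (d := P₂ d)
    (z := χ y) (w := P₁ (χ x - χ y))
    (hseg hyt (by simpa [hP₁] using And.intro hxt.1 hyt.2)) (hcG _ rfl) (hcG _ rfl)
    (fun y hy => horth.symm y ▸ hcF _ rfl y hy)
  have e₁ : χ y + P₂ (χ x - χ y) = P₁ (χ y) + P₂ (χ x) := by ext1 <;> simp [hP₁, hP₂]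
  have e₂ : χ y + P₁ (χ x - χ y) = P₂ (χ y) + P₁ (χ x) := by ext1 <;> simp [hP₁, hP₂]
  rw [e₁, χ.left_inv hy] at i₁
  rw [e₂, χ.left_inv hy] at i₂
  -- The mixed block of the metric vanishes by orthogonality, so the inner product is the sum of its
  -- two diagonal blocks.
  have hcross (c d : 𝔼 n × 𝔼 p) :
      inner ℝ (coordField (n + p) χ (P₁ c) y) (coordField (n + p) χ (P₂ d) y) = 0 :=
    horth y _ (hcF _ rfl y hy) _ (hcG _ rfl y hy)
  have hcross' (c d : 𝔼 n × 𝔼 p) :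
      inner ℝ (coordField (n + p) χ (P₂ c) y) (coordField (n + p) χ (P₁ d) y) = 0 :=
    (real_inner_comm _ _).trans (hcross d c)
  calc inner ℝ u v
      = inner ℝ (coordField (n + p) χ (P₁ (chartDeriv (n + p) χ y u)) y)
          (coordField (n + p) χ (P₁ (chartDeriv (n + p) χ y v)) y)
        + inner ℝ (coordField (n + p) χ (P₂ (chartDeriv (n + p) χ y u)) y)
          (coordField (n + p) χ (P₂ (chartDeriv (n + p) χ y v)) y) := by
        conv_lhs => rw [hdec u, hdec v]
        rw [inner_add_left, inner_add_right, inner_add_right, hcross, hcross',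
          add_zero, zero_add]
    _ = _ := by
        rw [i₁, i₂]
        exact congrArg₂ (· + ·) (by rw [d₁, d₁]) (by rw [d₂, d₂])

end Splitting

end OrthFol

end

/-! ### The theorem. -/

theorem theorem3 {n p : ℕ} (hn : 1 ≤ n) (hp : 1 ≤ p)
    {M : Type*} [EMetricSpace M] [ChartedSpace (OrthFol.𝔼 (n + p)) M]
    [IsManifold (𝓡 (n + p)) ∞ M]
    [RiemannianBundle (fun x : M => TangentSpace (𝓡 (n + p)) x)]
    [IsContMDiffRiemannianBundle (𝓡 (n + p)) ∞ (OrthFol.𝔼 (n + p))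
      (fun x : M => TangentSpace (𝓡 (n + p)) x)]
    [IsRiemannianManifold (𝓡 (n + p)) M] [CompleteSpace M]
    (F : OrthFol.Foliation (n + p) n p M) (Fperp : OrthFol.Foliation (n + p) p n M)
    (horth : OrthFol.Orthogonal F Fperp)
    (humb : 2 ≤ p → Fperp.IsTotallyUmbilical)
    (hbdd : ∃ C : ℝ, ∀ x, ‖Fperp.meanCurvature x‖ ≤ C)
    (L : Set M) (hL : Fperp.IsLeaf L)
    (hmax : ∃ x₀ ∈ L, ∀ x, ‖Fperp.meanCurvature x‖ ≤ ‖Fperp.meanCurvature x₀‖)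
    (htr : ∀ x, ∀ v ∈ Fperp.tangent x, ‖v‖ = 1 → 0 ≤ F.curvatureTrace v)
    (hdiv : ∀ x ∈ L, ∀ v ∈ Fperp.tangent x, ‖v‖ = 1 →
      F.divergence Fperp.meanCurvature x ≤ F.curvatureTrace v) :
    (∀ x, ∀ v ∈ Fperp.tangent x, ‖v‖ = 1 → F.curvatureTrace v = 0) ∧
      F.IsTotallyGeodesic ∧ Fperp.IsTotallyGeodesic ∧
      OrthFol.IsLocallyRiemannianProduct F Fperp := by
  have hU : Fperp.UmbilicalForm := fun y ν hν v hv w hw =>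
    Fperp.secondFundamentalForm_of_umbilical hp humb hν hv hw
  have hunit (x : M) : ∃ v ∈ Fperp.tangent x, ‖v‖ = 1 := by
    have hpos : 0 < Module.finrank ℝ (Fperp.tangent x) := by
      rw [Fperp.finrank_tangent]
      exact hp
    have := Module.finrank_pos_iff.1 hpos
    obtain ⟨v, hv⟩ := exists_norm_eq (Fperp.tangent x) zero_le_one
    exact ⟨v, v.2, hv⟩
  -- First run, on the leaf `L`: `h` vanishes at the maximum point of its norm, hence everywhere.
  have hmean : ∀ x, Fperp.meanCurvature x = 0 := by
    have hsat := hL.saturated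
    have hzero := hsat.curvatureSum_eq_zero hU horth hn hdiv
    obtain ⟨x₀, hx₀, hx₀max⟩ := hmax
    obtain ⟨v, hv, hv1⟩ := hunit x₀
    have h := (hsat.vanishing hU horth hn hzero (subset_closure hx₀) hv hv1
      (hdiv x₀ hx₀ v hv hv1)).1
    intro x
    have hx := hx₀max x
    rw [h, norm_zero] at hx
    exact norm_le_zero_iff.1 hx
  have hdiv0 (x : M) : F.divergence Fperp.meanCurvature x = 0 := by
    refine Finset.sum_eq_zero fun i _ => ?_
    rw [OrthFol.nabla_congr (.of_forall hmean), OrthFol.nabla_zero, inner_zero_right]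
  -- Second run, on all of `M`: as `div_F h = 0`, nonnegativity of the trace is now the divergence
  -- bound at every point.
  have hsat : Fperp.Saturated univ := fun _ _ y _ => mem_univ y
  have hdiv' : ∀ x ∈ (univ : Set M), ∀ v ∈ Fperp.tangent x, ‖v‖ = 1 →
      F.divergence Fperp.meanCurvature x ≤ F.curvatureTrace v := fun x _ v hv hv1 =>
    (hdiv0 x).le.trans (htr x v hv hv1)
  have hzero := hsat.curvatureSum_eq_zero hU horth hn hdiv'
  have hvan (x : M) (v : TangentSpace (𝓡 (n + p)) x) (hv : v ∈ Fperp.tangent x) (hv1 : ‖v‖ = 1) :=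
    hsat.vanishing hU horth hn hzero (subset_closure (mem_univ x)) hv hv1
      (hdiv' x (mem_univ x) v hv hv1)
  have hF : F.IsTotallyGeodesic := F.isTotallyGeodesic_of_components fun x ν hν hν1 =>
    (hvan x ν (by rwa [horth.eq_orthogonal]) hν1).2.1
  have hG : Fperp.IsTotallyGeodesic := fun x ν hν v hv w hw => by
    rw [hU x ν hν v hv w hw, hmean, inner_zero_left, mul_zero]
  exact ⟨fun x v hv hv1 => (hvan x v hv hv1).2.2.trans (hdiv0 x), hF, hG,
    horth.isLocallyRiemannianProduct hF hG⟩
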